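/- Let $\Bbbk$ be a commutative ring (for example a field), $\mathsf C$ a small category and $\mathcal A$ a diagram of algebras over $\mathsf C$, that is, a functor from $\mathsf C$ to associative, not necessarily unital, $\Bbbk$-algebras; let $\mathsf m[x]$ be the multiplication of $\mathcal A(x)$. The Hochschild bicomplex $C^{p,q}(\mathcal A,\mathcal A)$ is the product, over all $p$-simplices $x_0\leftarrow x_1\leftarrow\dots\leftarrow x_p$ of the nerve of $\mathsf C$, of the $\Bbbk$-modules of $q$-linear maps $\mathcal A(x_p)^q\to\mathcal A(x_0)$. **Quilts.** A quilt with vertices $1,\dots,n$ is a pair of a word $W$ in which every vertex occurs, no two consecutive letters agree and no two letters interlace (no subsequence $abab$ with $a\neq b$), and a planar rooted tree $T$ on the same vertices, such that (i) if $a$ occurs somewhere before $b$ in $W$, then $a$ is not a proper descendant of $b$ in $T$; (ii) if $b\ne a$ occurs between two occurrences of $a$, then $b$ is to the left of $a$ in $T$. It is maximal if $W$ has length $2n-2$. A quilt $Q$ acts on cochains $f_a\in C^{p_a,q_a}(\mathcal A,\mathcal A)$ by the signed sum $\widehat Q(f_1,\dots,f_n)$ over all colourings of $Q$. A colouring consists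 of strictly increasing maps $\zeta_a:\{0,\dots,p_a\}\to\{0,\dots,p'\}$ that are jointly surjective and such that $\{0,\dots,p_a\}$ is distributed onto the occurrences of $a$ in $W$, each occurrence getting a set which $\zeta_a$ maps onto an interval, where for consecutive letters the maximum of the first interval is the minimum of the second; and of a choice, for each edge of $T$ from a parent $a$ to a child, of one of the $q_a$ inputs of $f_a$, strictly increasing from left to right over the children of $a$. The corresponding term composes the $f_a$ along $T$, evaluated at the faces $\zeta_a$ of a $p'$-simplex, with the maps of $\mathcal A$ inserted where needed. Its sign is the sign of the permutation of $p_a$ vertical and $q_a-1$ horizontal letters for each $a$, listed initially by vertices in labelled order (for each vertex the vertical letters first), into the following order: first the initial vertical letters of the vertices $b$ that are interposed (i.e. $W=\cdots ab\cdots a\cdots$ for some $a$), in reverse order of first occurrence in $W$; then the other vertical letters along $W$; then the horizontal letters from left to right along $T$. (Where $p_a=0$ for an interposed $a$, or $q_a=0$, one uses $2$ in its place in this count.) **The Maurer–Cartan equation.** Let $P^0_n$ be $(-1)^{1+n(n-1)/2}$ times the sum of all maximal quilts whose vertices are labelled in the order of first occurrence in the word, and $P_n=P^0_n+P^0_{n+1}\circ_1\mathsf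 m$, where $\circ_1\mathsf m$ means insertion of $\mathsf m\in C^{0,2}(\mathcal A,\mathcal A)$ as the first argument. The total Hochschild complex with shifted degree is an $L_\infty$-algebra whose $n$-ary bracket $L_n$, $n\ge2$, is the antisymmetrization of $P_n$. For $F=f+g+h$ of shifted total degree $1$, with $f\in C^{0,2}(\mathcal A,\mathcal A)$, $g\in C^{1,1}(\mathcal A,\mathcal A)$ and $h\in C^{2,0}(\mathcal A,\mathcal A)$, the Maurer–Cartan equation is $$0=\delta F+\sum_{n\ge2}\widehat P_n(F,\dots,F)$$ in $C^{0,3}\oplus C^{1,2}\oplus C^{2,1}\oplus C^{3,0}$. Here $\delta$ is the sum of the simplicial coboundary $\sum_i(-1)^i\delta_i$ and the Hochschild coboundary $F\mapsto(\widehat Q_{1}-\widehat Q_{2})(\mathsf m,F)$, where $Q_{i}$ is the quilt with two vertices, root $i$ and a word of length $2$ beginning with $i$. Only finitely many terms of the series are nonzero. (In characteristic $0$ this is the usual equation $0=\delta F+\sum_{n\ge 2}\frac1{n!}\widehat L_n(F,\dots,F)$.) **Skew diagrams.** A skew diagram of algebras on $\Bbbk$-modules $M(x)$, $x\in\mathsf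 C$, consists of bilinear products on the $M(x)$, linear maps $\mathcal A'(\phi;-):M(x)\to M(y)$ for $\phi:x\to y$, and elements $c(\psi,\phi)$ of the unitalization $\Bbbk\oplus M(z)$ for $x\xrightarrow{\phi}y\xrightarrow{\psi}z$, such that the products are associative, the maps $\mathcal A'(\phi;-)$ are homomorphisms of algebras, and, in the unitalizations (to which $\mathcal A'$ is extended unitally), $$\mathcal A'(\psi;\mathcal A'(\phi;a))\cdot c(\psi,\phi)=c(\psi,\phi)\cdot\mathcal A'(\psi\phi;a),$$ $$\mathcal A'(\chi;c(\psi,\phi))\cdot c(\chi,\psi\phi)=c(\chi,\psi)\cdot c(\chi\psi,\phi)$$ for all composable $\phi,\psi,\chi$ and all $a$. **Theorem.** For $F=f+g+h$ as above: 1. $F$ satisfies the Maurer–Cartan equation if and only if $(\mathsf m+f,\ \mathcal A+g,\ 1+h)$, that is, the products $\mathsf m[x]+f[x]$, the maps $\mathcal A'=\mathcal A+g$ and the elements $c=1+h$, is a skew diagram of algebras on the modules underlying $\mathcal A$. 2. The assignment $f+g+h\mapsto(\mathsf m+f,\mathcal A+g,1+h)$ is a bijection from the set of solutions of the Maurer–Cartan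 equation onto the set of skew diagrams of algebras on the modules underlying $\mathcal A$ for which every $c(\psi,\phi)$ has unit component $1\in\Bbbk$. 3. If $F$ is a solution and $1+h(\psi,\phi)$ has a two-sided inverse in the unitalization of $\mathcal A(z)$ with the product $\mathsf m+f$, then $\mathcal A'(\psi;\mathcal A'(\phi;a))=[1+h(\psi,\phi)]\cdot\mathcal A'(\psi\phi;a)\cdot[1+h(\psi,\phi)]^{-1}$ for all $a$: $\mathcal A'$ is a functor up to conjugation by $1+h$. -/

import Mathlib

open CategoryTheory

namespace HochschildQuilt

universe w v u

/-! ### Words, planar rooted trees, quilts -/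

/-- The words over the alphabet `Fin n` in which every vertex occurs, no two consecutive letters
agree and no two vertices interlace. -/
structure IsWord {n : ℕ} (W : List (Fin n)) : Prop where
  surj : ∀ a, a ∈ W
  nondegenerate : W.IsChain (· ≠ ·)
  noInterlacing : ∀ a b, a ≠ b → ¬ List.Sublist [a, b, a, b] W

/-- Planar rooted trees with vertex set `Fin n`: `edge a b` says that `a` is the parent of `b`,
and `left a b` that `a` is strictly to the left of `b`. -/
@[ext] structure PlanarTree (n : ℕ) where
  edge : Fin n → Fin n → Prop
  left : Fin n → Fin n → Prop
  left_irrefl : ∀ a, ¬ left a a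
  left_trans : ∀ a b c, left a b → left b c → left a c
  acyclic : ∀ a, ¬ Relation.TransGen edge a a
  existsUnique_root : ∃! r, ∀ a, ¬ Relation.TransGen edge a r
  edge_minimal : ∀ a b, edge a b →
    ¬ ∃ c, Relation.TransGen edge a c ∧ Relation.TransGen edge c b
  comparable : ∀ a b, (left a b ∨ left b a) ↔
    ¬ (a = b ∨ Relation.TransGen edge a b ∨ Relation.TransGen edge b a)
  inherit : ∀ a b a' b', left a b → Relation.ReflTransGen edge a a' →
    Relation.ReflTransGen edge b b' → left a' b'

namespace PlanarTree

variable {n : ℕ} (T : PlanarTree n)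

/-- `T.lt a b`: the vertex `a` is a proper ancestor of `b` (the root is minimal). -/
def lt (a b : Fin n) : Prop := Relation.TransGen T.edge a b

/-- `T.le a b`: the vertex `a` is an ancestor of `b`, or equal to it. -/
def le (a b : Fin n) : Prop := Relation.ReflTransGen T.edge a b

/-- The root of a tree. -/
noncomputable def root : Fin n := T.existsUnique_root.choose

theorem wellFounded : WellFounded (fun b a : Fin n => T.edge a b) := by
  have : IsTrans (Fin n) (fun b a : Fin n => Relation.TransGen T.edge a b) :=
    ⟨fun a b c h₁ h₂ => h₂.trans h₁⟩
  have : Std.Irrefl (fun b a : Fin n => Relation.TransGen T.edge a b) := ⟨T.acyclic⟩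
  exact Subrelation.wf (fun h => Relation.TransGen.single h)
    (Finite.wellFounded_of_trans_of_irrefl (fun b a : Fin n => Relation.TransGen T.edge a b))

instance : Finite (PlanarTree n) :=
  Finite.of_injective (fun T : PlanarTree n => (T.edge, T.left)) (fun S T h => by
    simp only [Prod.mk.injEq] at h
    exact PlanarTree.ext h.1 h.2)

end PlanarTree

/-- A quilt with `n` vertices: a word and a planar rooted tree on the same vertices such that
(1) if `a` occurs somewhere before `b` in the word then `a` is not a proper descendant of `b`;
(2) if `b` occurs between two occurrences of `a` then `b` is to the left of `a` or equal to it. -/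
@[ext] structure Quilt (n : ℕ) where
  word : List (Fin n)
  tree : PlanarTree n
  isWord : IsWord word
  order : ∀ a b, List.Sublist [a, b] word → ¬ tree.lt b a
  nested : ∀ a b, List.Sublist [a, b, a] word → tree.left b a ∨ b = a

/-- The vertex `b` is interposed in the word `W` if `W = ... a b ... a ...` for some `a`. -/
def Interposed {n : ℕ} (W : List (Fin n)) (b : Fin n) : Prop :=
  ∃ (a : Fin n) (X Y Z : List (Fin n)), W = X ++ a :: b :: Y ++ a :: Z

/-- The quilts with `n` vertices and of degree `n - 2` (the degree of a quilt is the length of its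
word minus `n`) whose vertices are labelled in the order of first occurrence in the word. -/
def MaximalQuilt (n : ℕ) : Type :=
  {Q : Quilt n // Q.word.length + 2 = 2 * n ∧ StrictMono (fun a => Q.word.idxOf a)}

instance (n : ℕ) : Finite (MaximalQuilt n) := by
  have h : Finite {l : List (Fin n) // l.length = 2 * n - 2} :=
    inferInstanceAs (Finite (List.Vector (Fin n) (2 * n - 2)))
  refine Finite.of_injective
    (fun Q : MaximalQuilt n =>
      ((⟨Q.1.word, by have := Q.2.1; omega⟩, Q.1.tree) :
        {l : List (Fin n) // l.length = 2 * n - 2} × PlanarTree n)) ?_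
  intro P Q h
  simp only [Prod.mk.injEq, Subtype.mk.injEq] at h
  exact Subtype.ext (Quilt.ext h.1 h.2)

noncomputable instance (n : ℕ) : Fintype (MaximalQuilt n) := Fintype.ofFinite _

/-! ### Colourings -/

/-- A colouring of the word `W`: strictly increasing maps `ζ a : [p a] → [p']` whose images cover
`[p']`, with maps `π a : [p a] → W` onto the occurrences of `a`, such that `ζ a` maps each fibre of
`π a` onto an interval, and for two consecutive letters of `W` the maximum of the interval of the
first is the minimum of the interval of the second. The maps `π` are determined by `ζ`, and
`p' = ∑ a, p a - deg W` holds automatically. -/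
@[ext] structure WordColoring {n : ℕ} (W : List (Fin n)) (p : Fin n → ℕ) (p' : ℕ) where
  ζ : ∀ a, Fin (p a + 1) ↪o Fin (p' + 1)
  π : ∀ a, Fin (p a + 1) → Fin W.length
  cover : ∀ j, ∃ a i, ζ a i = j
  occurrence : ∀ a t, (∃ i, π a i = t) ↔ W.get t = a
  interval : ∀ a t, Set.OrdConnected (ζ a '' (π a ⁻¹' {t}))
  glue : ∀ t s : Fin W.length, (s : ℕ) = t + 1 →
    ∃ m, IsGreatest (ζ (W.get t) '' (π (W.get t) ⁻¹' {t})) m ∧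
      IsLeast (ζ (W.get s) '' (π (W.get s) ⁻¹' {s})) m

instance {n : ℕ} (W : List (Fin n)) (p : Fin n → ℕ) (p' : ℕ) : Finite (WordColoring W p p') := by
  have (m : ℕ) : Finite (Fin (m + 1) ↪o Fin (p' + 1)) := DFunLike.finite _
  exact Finite.of_injective (fun c : WordColoring W p p' => (c.ζ, c.π)) (fun c d h => by
    simp only [Prod.mk.injEq] at h
    exact WordColoring.ext h.1 h.2)

noncomputable instance {n : ℕ} (W : List (Fin n)) (p : Fin n → ℕ) (p' : ℕ) :
    Fintype (WordColoring W p p') := Fintype.ofFinite _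

/-- A colouring of the tree `T`: it assigns to the edge from `a` to `b` one of the `q a` inputs of
`a` (numbered from `0`), increasingly with the children of `a` from left to right. -/
@[ext] structure TreeColoring {n : ℕ} (T : PlanarTree n) (q : Fin n → ℕ) where
  I : ∀ a b, T.edge a b → Fin (q a)
  mono : ∀ a b c (hb : T.edge a b) (hc : T.edge a c), T.left b c → I a b hb < I a c hc

instance {n : ℕ} (T : PlanarTree n) (q : Fin n → ℕ) : Finite (TreeColoring T q) :=
  Finite.of_injective (fun c : TreeColoring T q => c.I) (fun _ _ h => TreeColoring.ext h)

noncomputable instance {n : ℕ} (T : PlanarTree n) (q : Fin n → ℕ) : Fintype (TreeColoring T q) :=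
  Fintype.ofFinite _

namespace TreeColoring

variable {n : ℕ} {T : PlanarTree n} {q : Fin n → ℕ} (c : TreeColoring T q)

/-- The `j`-th input of the vertex `a` is open if no child of `a` is attached to it. -/
def IsOpen (s : Σ a, Fin (q a)) : Prop := ¬ ∃ b, ∃ e : T.edge s.1 b, c.I s.1 b e = s.2

/-- The left-to-right order of the inputs of the vertices. -/
def InputLT (s t : Σ a, Fin (q a)) : Prop :=
  (s.1 = t.1 ∧ (s.2 : ℕ) < t.2) ∨ T.left s.1 t.1 ∨
    (∃ b, ∃ e : T.edge s.1 b, T.le b t.1 ∧ s.2 < c.I s.1 b e) ∨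
    (∃ b, ∃ e : T.edge t.1 b, T.le b s.1 ∧ c.I t.1 b e < t.2)

open Classical in
/-- The position (from `0`) of an open input among all open inputs, from left to right. -/
noncomputable def position (s : Σ a, Fin (q a)) : ℕ :=
  (Finset.univ.filter fun t => c.IsOpen t ∧ c.InputLT t s).card

end TreeColoring

/-! ### The sign of a colouring -/

namespace Quilt

variable {n : ℕ} (Q : Quilt n) {p q : Fin n → ℕ} {p' : ℕ}
  (c : WordColoring Q.word p p') (d : TreeColoring Q.tree q)

open Classical in
/-- The number of vertical letters of a vertex, namely `p a`; the case of an interposed vertex with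
`p a = 0` is treated by extrapolation modulo 2, as if `p a` were `2`. -/
noncomputable def numVert (p : Fin n → ℕ) (a : Fin n) : ℕ :=
  if Interposed Q.word a ∧ p a = 0 then 2 else p a

/-- One more than the number of horizontal letters of a vertex, namely `q a`; the case `q a = 0`
is treated by extrapolation modulo 2, as if `q a` were `2`. -/
def numHoriz (q : Fin n → ℕ) (a : Fin n) : ℕ := if q a = 0 then 2 else q a

/-- The letters to be shuffled: `p a` vertical letters `0, ..., p a - 1` and `q a - 1` horizontal
letters `1, ..., q a - 1` for each vertex `a`. The horizontal letter number `j + 1` is represented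
by `j`. -/
abbrev Letter (p q : Fin n → ℕ) : Type :=
  (Σ a, Fin (Q.numVert p a)) ⊕ (Σ a, Fin (numHoriz q a - 1))

/-- The initial order of the letters: by vertices in labelled order; for each vertex first the
vertical letters, then the horizontal letters, both in increasing order. -/
def InitialLT : Q.Letter p q → Q.Letter p q → Prop
  | .inl s, .inl t => s.1 < t.1 ∨ (s.1 = t.1 ∧ (s.2 : ℕ) < t.2)
  | .inl s, .inr t => s.1 ≤ t.1
  | .inr s, .inl t => s.1 < t.1
  | .inr s, .inr t => s.1 < t.1 ∨ (s.1 = t.1 ∧ (s.2 : ℕ) < t.2)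

/-- The vertical letters `0` of the interposed vertices. -/
def IsLeading (s : Σ a, Fin (Q.numVert p a)) : Prop := Interposed Q.word s.1 ∧ (s.2 : ℕ) = 0

/-- The occurrence in the word to which a vertical letter belongs. -/
def block (s : Σ a, Fin (Q.numVert p a)) : Fin Q.word.length :=
  c.π s.1 ⟨min s.2 (p s.1), by omega⟩

/-- The shuffled order of the vertical letters: first the letters `0` of the interposed
vertices, in the reverse of the order of first occurrence; then the other letters in the order of
their positions `ζ a i`, that is, along the word. -/
def VertLT (s t : Σ a, Fin (Q.numVert p a)) : Prop :=
  (Q.IsLeading s ∧ Q.IsLeading t ∧ Q.word.idxOf t.1 < Q.word.idxOf s.1) ∨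
  (Q.IsLeading s ∧ ¬ Q.IsLeading t) ∨
  (¬ Q.IsLeading s ∧ ¬ Q.IsLeading t ∧
    (Q.block c s < Q.block c t ∨ (Q.block c s = Q.block c t ∧ (s.2 : ℕ) < t.2)))

/-- The shuffled order of the horizontal letters, along the corner word of the tree: the letter
number `j` of `a` (represented by `j - 1`) sits between the inputs number `j` and `j + 1` of `a`
(represented by `j - 1` and `j`), with everything that is attached to them. -/
def HorizLT (s t : Σ a, Fin (numHoriz q a - 1)) : Prop :=
  (s.1 = t.1 ∧ (s.2 : ℕ) < t.2) ∨ Q.tree.left s.1 t.1 ∨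
    (∃ b, ∃ e : Q.tree.edge s.1 b, Q.tree.le b t.1 ∧ (s.2 : ℕ) < d.I s.1 b e) ∨
    (∃ b, ∃ e : Q.tree.edge t.1 b, Q.tree.le b s.1 ∧ (d.I t.1 b e : ℕ) ≤ t.2)

/-- The shuffled order of the letters: the vertical letters, then the horizontal ones. -/
def ShuffledLT : Q.Letter p q → Q.Letter p q → Prop
  | .inl s, .inl t => Q.VertLT c s t
  | .inl _, .inr _ => True
  | .inr _, .inl _ => False
  | .inr s, .inr t => Q.HorizLT d s t

open Classical in
/-- The sign of a colouring of `Q`: the sign of the permutation from the initial order of the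
letters to their shuffled order, computed from its inversions. -/
noncomputable def sign : ℤ :=
  (-1) ^ (Finset.univ.filter fun x : Q.Letter p q × Q.Letter p q =>
    Q.InitialLT x.1 x.2 ∧ Q.ShuffledLT c d x.2 x.1).card

end Quilt

/-! ### Diagrams of algebras and their Hochschild bicomplex -/

/-- A diagram of (associative, not necessarily unital) `k`-algebras over `C`: a functor from `C` to
the category of such algebras. -/
structure AlgDiagram (k : Type*) [CommRing k] (C : Type u) [Category.{v} C] where
  obj : C → Type w
  [ring : ∀ x, NonUnitalRing (obj x)]
  [module : ∀ x, Module k (obj x)]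
  [scalarTower : ∀ x, IsScalarTower k (obj x) (obj x)]
  [smulComm : ∀ x, SMulCommClass k (obj x) (obj x)]
  map : ∀ {x y : C}, (x ⟶ y) → (obj x →ₙₐ[k] obj y)
  map_id : ∀ (x : C) (a : obj x), map (𝟙 x) a = a
  map_comp : ∀ {x y z : C} (φ : x ⟶ y) (ψ : y ⟶ z) (a : obj x),
    map (φ ≫ ψ) a = map ψ (map φ a)

attribute [instance] AlgDiagram.ring AlgDiagram.module AlgDiagram.scalarTower AlgDiagram.smulComm

section Bicomplex

variable {k : Type*} [CommRing k] {C : Type u} [Category.{v} C] (A : AlgDiagram.{w} k C)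

/-- The `p`-simplices `x₀ ← x₁ ← ... ← x_p` of the nerve of `C`, as functors from the ordered set
`{0, ..., p}` to the opposite category. -/
abbrev Simplex (C : Type u) [Category.{v} C] (p : ℕ) := ComposableArrows Cᵒᵖ p

namespace Simplex

/-- The object `x_i` of the simplex `x₀ ← x₁ ← ... ← x_p`. -/
abbrev vertex {p : ℕ} (Φ : Simplex C p) (i : Fin (p + 1)) : C := (Φ.obj i).unop

/-- The face of a simplex along a strictly increasing map. -/
abbrev pull {p p' : ℕ} (Φ : Simplex C p') (ζ : Fin (p + 1) ↪o Fin (p' + 1)) : Simplex C p :=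
  ζ.monotone.functor ⋙ Φ

end Simplex

/-- The `(p, q)` component of the Hochschild bicomplex: the product over all simplices
`x₀ ← x₁ ← ... ← x_p` of the `k`-multilinear maps `A(x_p)^q → A(x₀)`. -/
abbrev Cochain (p q : ℕ) :=
  ∀ Φ : Simplex C p,
    MultilinearMap k (fun _ : Fin q => A.obj (Φ.vertex (Fin.last p))) (A.obj (Φ.vertex 0))

/-- The functions underlying cochains of bidegree `(p, q)`. -/
abbrev Values (p q : ℕ) :=
  ∀ Φ : Simplex C p, (Fin q → A.obj (Φ.vertex (Fin.last p))) → A.obj (Φ.vertex 0)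

open Classical in
/-- The linear map `A(x_l) → A(x_i)` given by the morphism `x_l → x_i` of a simplex, for `i ≤ l`.
(It is only ever used for `i ≤ l`, where `0` is a default value.) -/
noncomputable def AlgDiagram.along {p : ℕ} (Φ : Simplex C p) (i l : Fin (p + 1)) :
    A.obj (Φ.vertex l) →ₗ[k] A.obj (Φ.vertex i) :=
  if h : i ≤ l then
    ((A.map (Φ.map (homOfLE h)).unop : A.obj (Φ.vertex l) →ₙₐ[k] A.obj (Φ.vertex i)) :
      A.obj (Φ.vertex l) →ₗ[k] A.obj (Φ.vertex i))
  else 0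

section Action

variable {n : ℕ} {T : PlanarTree n} {p q : Fin n → ℕ} {p' : ℕ}

open Classical in
/-- The value at the vertex `a` of the composition of the cochains `f` along the tree `T`. The
`j`-th argument of `f a` is the value at the child attached to the `j`-th input of `a` if there is
one, and otherwise the argument `x i` where `i` is the position of this open input; both are
transported along the simplex `Φ`. -/
noncomputable def evalVertex (ζ : ∀ a, Fin (p a + 1) ↪o Fin (p' + 1)) (c : TreeColoring T q)
    (f : ∀ a, Cochain A (p a) (q a)) (Φ : Simplex C p')
    (x : ℕ → A.obj (Φ.vertex (Fin.last p'))) :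
    ∀ a : Fin n, A.obj (Φ.vertex (ζ a 0)) :=
  T.wellFounded.fix fun a rec =>
    f a (Φ.pull (ζ a)) fun j =>
      if h : ∃ b, ∃ e : T.edge a b, c.I a b e = j then
        A.along Φ (ζ a (Fin.last (p a))) (ζ h.choose 0) (rec h.choose h.choose_spec.choose)
      else A.along Φ (ζ a (Fin.last (p a))) (Fin.last p') (x (c.position ⟨a, j⟩))

/-- The action of a pair `(ζ, I)` on cochains. -/
noncomputable def act (ζ : ∀ a, Fin (p a + 1) ↪o Fin (p' + 1)) (c : TreeColoring T q)
    (f : ∀ a, Cochain A (p a) (q a)) (q' : ℕ) : Values A p' q' := fun Φ x =>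
  A.along Φ 0 (ζ T.root 0)
    (evalVertex A ζ c f Φ (fun i => if h : i < q' then x ⟨i, h⟩ else 0) T.root)

end Action

/-- The operation on cochains given by a quilt: the `(p', q')` component of `Q̂(f₁, ..., fₙ)`.
It vanishes unless `q' = 1 + ∑ (q a - 1)` and `p' = ∑ p a - deg Q`. -/
noncomputable def quiltAction {n : ℕ} (Q : Quilt n) {p q : Fin n → ℕ}
    (f : ∀ a, Cochain A (p a) (q a)) (p' q' : ℕ) : Values A p' q' :=
  if q' + n = 1 + ∑ a, q a then
    ∑ c : WordColoring Q.word p p', ∑ d : TreeColoring Q.tree q,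
      Q.sign c d • act A c.ζ d f q'
  else 0

/-! ### Coboundaries -/

/-- The tree with one vertex. -/
def trivialTree : PlanarTree 1 where
  edge _ _ := False
  left _ _ := False
  left_irrefl _ h := h
  left_trans _ _ _ h _ := h
  acyclic a h := by
    obtain ⟨_, h, _⟩ := Relation.TransGen.head'_iff.1 h
    exact h
  existsUnique_root := ⟨0, fun a h => by
    obtain ⟨_, h, _⟩ := Relation.TransGen.head'_iff.1 h
    exact h, fun _ _ => Subsingleton.elim _ _⟩
  edge_minimal _ _ h := h.elim
  comparable a b := by simp [Subsingleton.elim a b]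
  inherit _ _ _ _ h := h.elim

/-- The colouring of the tree with one vertex. -/
def trivialColoring (q : Fin 1 → ℕ) : TreeColoring trivialTree q where
  I _ _ h := h.elim
  mono _ _ _ h := h.elim

/-- The simplicial coboundary `∑ i, (-1)^i δ_i`, where `δ_i` is the action of the `i`-th face map
and the tree with one vertex. -/
noncomputable def simplicialCoboundary {p q : ℕ} (f : Cochain A p q) : Values A (p + 1) q :=
  ∑ i : Fin (p + 2), (-1 : ℤ) ^ (i : ℕ) •
    act A (n := 1) (p := fun _ => p) (p' := p + 1) (fun _ => Fin.succAboveOrderEmb i)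
      (trivialColoring fun _ => q) (fun _ => f) q

/-- The tree with two vertices and root `r`. -/
def twoTree (r : Fin 2) : PlanarTree 2 :=
  have key : ∀ a b : Fin 2, Relation.TransGen (fun a b => a = r ∧ b ≠ r) a b ↔ a = r ∧ b ≠ r := by
    intro a b
    refine ⟨fun h => ?_, fun h => Relation.TransGen.single h⟩
    induction h with
    | single h => exact h
    | tail _ h ih => exact absurd h.1 ih.2
  { edge := fun a b => a = r ∧ b ≠ r
    left := fun _ _ => False
    left_irrefl := fun _ h => h
    left_trans := fun _ _ _ h _ => h
    acyclic := fun a h => ((key a a).1 h).2 ((key a a).1 h).1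
    existsUnique_root := by
      simp only [key]
      exact ⟨r, fun a h => h.2 rfl, fun s hs => by_contra fun h => hs r ⟨rfl, h⟩⟩
    edge_minimal := by
      simp only [key]
      rintro a b - ⟨c, h, h'⟩
      exact h.2 h'.1
    comparable := by
      simp only [key]
      clear key
      revert r
      decide
    inherit := fun _ _ _ _ h => h.elim }

/-- The quilt with two vertices, root `r`, and the word formed by `r` and the other vertex. -/
def twoQuilt (r : Fin 2) : Quilt 2 where
  word := [r, r + 1]
  tree := twoTree r
  isWord := ⟨by revert r; decide, by revert r; decide, by
    intro a b _ h
    simpa using h.length_le⟩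
  order := by
    intro a b h hlt
    obtain ⟨c, -, hc⟩ := Relation.TransGen.tail'_iff.1 hlt
    have e := h.eq_of_length rfl
    simp only [List.cons.injEq] at e
    exact hc.2 e.1
  nested := by
    intro a b h
    simpa using h.length_le

/-- A cochain of total degree `2`, that is, of shifted total degree `1`, in the Hochschild complex:
it has components in the bidegrees `(0, 2)`, `(1, 1)` and `(2, 0)`. -/
structure DegreeOne where
  f : Cochain A 0 2
  g : Cochain A 1 1
  h : Cochain A 2 0

namespace DegreeOne

/-- The component of bidegree `(i, 2 - i)`. -/
def comp {A : AlgDiagram.{w} k C} (F : DegreeOne A) : ∀ i : Fin 3, Cochain A i (2 - i)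
  | 0 => F.f
  | 1 => F.g
  | 2 => F.h

end DegreeOne

/-- The operation of a quilt on cochains of shifted total degree `1`, extended multilinearly from
their homogeneous components. -/
noncomputable def quiltActionTotal {n : ℕ} (Q : Quilt n) (F : Fin n → DegreeOne A) (p' q' : ℕ) :
    Values A p' q' :=
  ∑ i : Fin n → Fin 3,
    quiltAction A Q (p := fun a => i a) (q := fun a => 2 - i a) (fun a => (F a).comp (i a)) p' q'

/-- The multiplication of the diagram of algebras, as a cochain of bidegree `(0, 2)`. -/
noncomputable def mulCochain : Cochain A 0 2 := fun Φ =>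
  MultilinearMap.mk' (fun a => (a 0 * a 1 : A.obj (Φ.vertex 0)))
    (by
      intro m i x y
      fin_cases i <;> simp [Function.update, add_mul, mul_add])
    (by
      intro m i c x
      fin_cases i <;> simp [Function.update, smul_mul_assoc, mul_smul_comm])

/-- The multiplication cochain, with zero components in the bidegrees `(1, 1)` and `(2, 0)`. -/
noncomputable def mulDegreeOne : DegreeOne A := ⟨mulCochain A, 0, 0⟩

/-- The Hochschild coboundary `(Q₁₂ - Q₂₁)^(m, F)`, where `m` is the multiplication and `Q₁₂`,
`Q₂₁` are the quilts with two vertices and root `1`, `2` respectively. -/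
noncomputable def hochschildCoboundary (F : DegreeOne A) (p' q' : ℕ) : Values A p' q' :=
  quiltActionTotal A (twoQuilt 0) ![mulDegreeOne A, F] p' q' -
    quiltActionTotal A (twoQuilt 1) ![mulDegreeOne A, F] p' q'

/-- The component of bidegree `(p', q')` of the simplicial coboundary of `F`. -/
noncomputable def simplicialCoboundaryTotal (F : DegreeOne A) : ∀ p' q' : ℕ, Values A p' q'
  | 1, 2 => simplicialCoboundary A F.f
  | 2, 1 => simplicialCoboundary A F.g
  | 3, 0 => simplicialCoboundary A F.h
  | _, _ => 0

/-! ### The Maurer-Cartan equation -/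

/-- The operation `P⁰ₙ`: the sum of all maximal quilts with `n` vertices labelled in the order of
first occurrence, times `(-1) ^ (1 + n (n - 1) / 2)`. -/
noncomputable def pZero (n : ℕ) (F : Fin n → DegreeOne A) (p' q' : ℕ) : Values A p' q' :=
  (-1 : ℤ) ^ (1 + n * (n - 1) / 2) • ∑ Q : MaximalQuilt n, quiltActionTotal A Q.1 F p' q'

/-- The operation `Pₙ = P⁰ₙ + P⁰ₙ₊₁ ∘₁ m`, applied to `(F, ..., F)`. Its antisymmetrization is the
`n`-ary bracket of the `L∞`-algebra structure on the Hochschild complex. -/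
noncomputable def pTerm (n : ℕ) (F : DegreeOne A) (p' q' : ℕ) : Values A p' q' :=
  pZero A n (fun _ => F) p' q' +
    pZero A (n + 1) (Fin.cons (mulDegreeOne A) (fun _ => F)) p' q'

/-- The partial sums of the Maurer-Cartan series `δF + ∑_{n ≥ 2} Pₙ(F, ..., F)`, where
`δ` is the sum of the simplicial and the Hochschild coboundaries. -/
noncomputable def maurerCartanSum (F : DegreeOne A) (N p' q' : ℕ) : Values A p' q' :=
  simplicialCoboundaryTotal A F p' q' + hochschildCoboundary A F p' q' +
    ∑ n ∈ Finset.Icc 2 N, pTerm A n F p' q'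

/-- The Maurer-Cartan equation `0 = δF + ∑_{n ≥ 2} Pₙ(F, ..., F)`, an equation in total degree `3`.
The sum of the series is understood as the eventual value of its partial sums. -/
def IsMaurerCartan (F : DegreeOne A) : Prop :=
  ∀ p' q' : ℕ, p' + q' = 3 → ∀ᶠ N in Filter.atTop, maurerCartanSum A F N p' q' = 0

end Bicomplex

/-! ### Skew diagrams of algebras -/

/-- The product of the unitalization `k ⊕ M` of a module `M` with a bilinear product. -/
def unitizationMul {k M : Type*} [CommRing k] [AddCommGroup M] [Module k M]
    (μ : M →ₗ[k] M →ₗ[k] M) (s t : k × M) : k × M :=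
  (s.1 * t.1, s.1 • t.2 + t.1 • s.2 + μ s.2 t.2)

/-- The data of a skew diagram of algebras over `C` on a family of modules: a product on each
module, a linear map for each morphism, and for each composable pair of morphisms
`φ : x ⟶ y`, `ψ : y ⟶ z` an element of the unitalization of the algebra at `z`. -/
@[ext] structure SkewData (k : Type*) [CommRing k] {C : Type u} [Category.{v} C] (M : C → Type w)
    [∀ x, AddCommGroup (M x)] [∀ x, Module k (M x)] where
  mul : ∀ x, M x →ₗ[k] M x →ₗ[k] M x
  map : ∀ {x y : C}, (x ⟶ y) → M x →ₗ[k] M y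
  twist : ∀ {x y z : C}, (x ⟶ y) → (y ⟶ z) → k × M z

/-- A skew diagram of algebras: the products are associative, the linear maps are homomorphisms of
algebras, they are functorial up to conjugation by the twists, and the twists satisfy the cocycle
condition. The last two equations are equations in unitalizations. -/
structure SkewData.IsSkewDiagram {k : Type*} [CommRing k] {C : Type u} [Category.{v} C]
    {M : C → Type w} [∀ x, AddCommGroup (M x)] [∀ x, Module k (M x)] (D : SkewData k M) :
    Prop where
  assoc : ∀ (x : C) (a b c : M x), D.mul x (D.mul x a b) c = D.mul x a (D.mul x b c)
  map_mul : ∀ {x y : C} (φ : x ⟶ y) (a b : M x),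
    D.map φ (D.mul x a b) = D.mul y (D.map φ a) (D.map φ b)
  functorial : ∀ {x y z : C} (φ : x ⟶ y) (ψ : y ⟶ z) (a : M x),
    unitizationMul (D.mul z) (0, D.map ψ (D.map φ a)) (D.twist φ ψ) =
      unitizationMul (D.mul z) (D.twist φ ψ) (0, D.map (φ ≫ ψ) a)
  cocycle : ∀ {t x y z : C} (φ : t ⟶ x) (ψ : x ⟶ y) (χ : y ⟶ z),
    unitizationMul (D.mul z) ((D.twist φ ψ).1, D.map χ (D.twist φ ψ).2) (D.twist (φ ≫ ψ) χ) =
      unitizationMul (D.mul z) (D.twist ψ χ) (D.twist φ (ψ ≫ χ))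

section Deformation

variable {k : Type*} [CommRing k] {C : Type u} [Category.{v} C] (A : AlgDiagram.{w} k C)

theorem update_pair_zero {M : Type*} (a b c : M) : Function.update ![a, b] 0 c = ![c, b] := by
  ext i
  fin_cases i <;> rfl

theorem update_pair_one {M : Type*} (a b c : M) : Function.update ![a, b] 1 c = ![a, c] := by
  ext i
  fin_cases i <;> rfl

/-- The product `m[x] + f[x]` on `A(x)`. -/
noncomputable def deformedMul (F : DegreeOne A) (x : C) :
    A.obj x →ₗ[k] A.obj x →ₗ[k] A.obj x :=
  let f : MultilinearMap k (fun _ : Fin 2 => A.obj x) (A.obj x) :=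
    F.f (ComposableArrows.mk₀ (Opposite.op x))
  LinearMap.mk₂ k (fun a b => a * b + f ![a, b])
    (fun a a' b => by
      have h := f.map_update_add ![a, b] 0 a a'
      simp only [update_pair_zero] at h
      rw [h, add_mul]
      abel)
    (fun r a b => by
      have h := f.map_update_smul ![a, b] 0 r a
      simp only [update_pair_zero] at h
      rw [h, smul_mul_assoc, smul_add])
    (fun a b b' => by
      have h := f.map_update_add ![a, b] 1 b b'
      simp only [update_pair_one] at h
      rw [h, mul_add]
      abel)
    (fun r a b => by
      have h := f.map_update_smul ![a, b] 1 r b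
      simp only [update_pair_one] at h
      rw [h, mul_smul_comm, smul_add])

/-- The linear map `A[φ] + g[φ] : A(x) → A(y)`. -/
noncomputable def deformedMap (F : DegreeOne A) {x y : C} (φ : x ⟶ y) :
    A.obj x →ₗ[k] A.obj y :=
  let g : MultilinearMap k (fun _ : Fin 1 => A.obj x) (A.obj y) :=
    F.g (ComposableArrows.mk₁ φ.op)
  (A.map φ : A.obj x →ₗ[k] A.obj y) +
    (MultilinearMap.ofSubsingleton k (A.obj x) (A.obj y) (0 : Fin 1)).symm g

/-- The element `1 + h(ψ, φ)` of the unitalization of `A(z)`. -/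
def deformedTwist (F : DegreeOne A) {x y z : C} (φ : x ⟶ y) (ψ : y ⟶ z) : k × A.obj z :=
  (1, (F.h (ComposableArrows.mk₂ ψ.op φ.op) Fin.elim0 : A.obj z))

/-- The data `(m + f, A + g, 1 + h)` on the modules underlying `A`. -/
noncomputable def deform (F : DegreeOne A) : SkewData k A.obj where
  mul := deformedMul A F
  map := deformedMap A F
  twist := deformedTwist A F

end Deformation

end HochschildQuilt

/-!
The Maurer–Cartan series of a cochain `F = f + g + h` of shifted total degree one looks like an
infinite sum over all maximal quilts, but all except three of them act by zero, and the sum of the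
remaining terms is, bidegree by bidegree, the difference of the two sides of one axiom of skew
diagrams for `(m + f, A + g, 1 + h)`.

*Only three maximal quilts contribute.* The first letter of the word of a maximal quilt is the root
and does not occur again. The rest of the word has the largest length allowed by the
Davenport–Schinzel bound `length_add_one_le_two_mul_card`, so that it begins and ends with the same
letter `1`, and every letter other than `0`, `1` that occurs once is enclosed as in `c b c`. Hence
all vertices other than `0`, `1` are to the left of `1`, and in a colouring they have `p > 0`
(`MaximalQuilt.pos_of_coloring`). As `p + q = 2` at every vertex, each of them has at most one
input, and the root has at most two, one of which is used by `1`; so these vertices form a chain in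
the tree (`MaximalQuilt.comparable_of_coloring`). Consequently none of them is repeated in the word,
which is therefore `0 1 2 1 3 1 ⋯ 1`, and as `1` has at most three indices there are at most four
vertices (`MaximalQuilt.le_two_of_coloring`). What is left are the words `01`, `0121` and `012131`
(`MaximalQuilt.eq_edge`, `MaximalQuilt.eq_cherry`, `MaximalQuilt.eq_fork`).

*The remaining terms.* The counts of inputs and indices allow only a few ways to
put `f`, `g`, `h` at the vertices of these quilts. For each of them the colourings are listed: a
colouring of a word is determined by the distribution of the indices onto the occurrences
(`WordColoring.eq_of_π_eq`), and the trees are so small that their colourings are seen directly. The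
sign is evaluated from `Quilt.sign_eq`, the composition vertex by vertex.

*The sum.* Adding up, the components of the series in the bidegrees `(0, 3)`, `(1, 2)`, `(2, 1)` and
`(3, 0)` are the associativity of `m + f`, the multiplicativity of `A + g`, its functoriality up to
`1 + h`, and the cocycle condition for `1 + h` (`maurerCartanSum_03`, `maurerCartanSum_12`,
`maurerCartanSum_21`, `maurerCartanSum_30`). The bijection follows, as a cochain of shifted total
degree one is the same as an arbitrary deformation of the products and maps together with an
arbitrary family of twists with unit component `1`; and the conjugation formula is the functoriality
axiom multiplied by the inverse of the twist.
-/

namespace HochschildQuilt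

universe w v u

/-! ### Words without interlacing -/

/-- Two occurrences of `b` in a word without repetitions are separated by another letter. -/
theorem exists_sublist_of_two_le_count {α : Type*} [DecidableEq α] {W : List α} {b : α}
    (hW : W.IsChain (· ≠ ·)) (hb : 2 ≤ W.count b) :
    ∃ c, c ≠ b ∧ List.Sublist [b, c, b] W := by
  obtain ⟨X, R, rfl, hX⟩ :=
    List.eq_append_cons_of_mem (List.count_pos_iff.1 (by omega : 0 < W.count b))
  have hR : b ∈ R := by
    rw [← List.count_pos_iff]
    rw [List.count_append, List.count_cons_self, List.count_eq_zero_of_not_mem hX] at hb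
    omega
  obtain ⟨U, V, rfl, hU⟩ := List.eq_append_cons_of_mem hR
  have hc := (List.isChain_append.1 hW).2.1
  match U, hU, hc with
  | [], _, hc => simp at hc
  | c :: U, hU, _ =>
    refine ⟨c, fun h => hU (by simp [h]), ?_⟩
    refine List.Sublist.trans ?_ (List.sublist_append_right _ _)
    simp

/-- The length bound for words over `m` letters without repetitions and without interlacing
(Davenport–Schinzel sequences of order two), with the structure of the longest words: they begin
and end with the same letter, and every other letter that occurs only once is enclosed between two
adjacent occurrences of one letter. -/
theorem length_add_one_le_two_mul_card {α : Type*} [DecidableEq α] (W : List α) (h0 : W ≠ [])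
    (hW : W.IsChain (· ≠ ·)) (hI : ∀ a b, a ≠ b → ¬ List.Sublist [a, b, a, b] W) :
    W.length + 1 ≤ 2 * W.toFinset.card ∧
      (W.length + 1 = 2 * W.toFinset.card →
        ∃ a, W.head? = some a ∧ W.getLast? = some a ∧
          ∀ b ∈ W, b ≠ a → W.count b = 1 → ∃ c, [c, b, c] <:+: W) := by
  induction hn : W.length using Nat.strong_induction_on generalizing W with
  | _ n ih =>
  subst hn
  match W, h0, hW, hI, ih with
  | [x], _, _, _, _ => simp
  | x :: y :: R, _, hW, hI, ih =>
    have hR : (y :: R).IsChain (· ≠ ·) := (List.isChain_cons.1 hW).2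
    -- if the first letter occurs again, it splits the word into two parts without common letters
    by_cases hx : x ∈ y :: R
    · obtain ⟨U, V, hUV, hxU⟩ := List.eq_append_cons_of_mem hx
      have hU0 : U ≠ [] := by
        rintro rfl
        rw [hUV] at hW
        simp at hW
      rw [hUV] at hW hR hI ih ⊢
      have hdisj : Disjoint U.toFinset (x :: V).toFinset := by
        rw [Finset.disjoint_left]
        intro b hb hb'
        rw [List.mem_toFinset] at hb hb'
        have hbx : b ≠ x := fun h => hxU (h ▸ hb)
        have hbV : b ∈ V := by simpa [hbx] using hb'
        refine hI x b hbx.symm ?_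
        refine List.Sublist.cons_cons _ ?_
        exact (List.singleton_sublist.2 hb).append
          (List.Sublist.cons_cons _ (List.singleton_sublist.2 hbV))
      have hcard : (x :: (U ++ x :: V)).toFinset.card =
          U.toFinset.card + (x :: V).toFinset.card := by
        rw [← Finset.card_union_of_disjoint hdisj]
        congr 1
        ext b
        simp
      obtain ⟨h₁, e₁⟩ := ih U.length (by simp) U hU0 (List.isChain_append.1 hR).1
        (fun a b hab h => hI a b hab
          ((h.trans (List.sublist_append_left _ _)).trans (List.sublist_cons_self _ _))) rfl
      obtain ⟨h₂, e₂⟩ := ih (x :: V).length (by simp) (x :: V) (by simp)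
        (List.isChain_append.1 hR).2.1
        (fun a b hab h => hI a b hab
          ((h.trans (List.sublist_append_right _ _)).trans (List.sublist_cons_self _ _))) rfl
      have hl : (x :: (U ++ x :: V)).length = U.length + (x :: V).length + 1 := by
        simp
      rw [hcard, hl]
      refine ⟨by omega, fun he => ?_⟩
      obtain ⟨u, hu₁, hu₂, hu₃⟩ := e₁ (by omega)
      obtain ⟨w, hw₁, hw₂, hw₃⟩ := e₂ (by omega)
      obtain rfl : x = w := by simpa using hw₁
      refine ⟨x, by simp, ?_, ?_⟩
      · rw [← List.cons_append, List.getLast?_append, hw₂]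
        rfl
      · intro b hb hbx hc
        have hc' : U.count b + (x :: V).count b = 1 := by
          rw [List.count_cons_of_ne hbx.symm, List.count_append] at hc
          exact hc
        by_cases hbU : b ∈ U
        · have hpos := List.count_pos_iff.2 hbU
          by_cases hbu : b = u
          · subst hbu
            have hU1 : U = [b] := by
              match U, hu₁, hu₂, hc', hpos with
              | [c], h, _, _, _ => simpa using h
              | c :: d :: U, h, h', h'', _ =>
                obtain rfl : c = b := by simpa using h
                rw [List.count_cons_self] at h''
                have : c ∈ d :: U := List.mem_of_getLast? (by simpa using h')
                have := List.count_pos_iff.2 this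
                omega
            refine ⟨x, [], V, ?_⟩
            simp [hU1]
          · obtain ⟨c, hc⟩ := hu₃ b hbU hbu (by omega)
            refine ⟨c, hc.trans ?_⟩
            exact ⟨[x], x :: V, by simp⟩
        · have hbV : b ∈ x :: V := by
            rw [← List.count_pos_iff]
            rw [List.count_eq_zero_of_not_mem hbU] at hc'
            omega
          rw [List.count_eq_zero_of_not_mem hbU] at hc'
          obtain ⟨c, hc⟩ := hw₃ b hbV hbx (by omega)
          refine ⟨c, hc.trans ?_⟩
          exact ⟨x :: U, [], by simp⟩
    · obtain ⟨h₁, -⟩ := ih (y :: R).length (by simp) (y :: R) (by simp) hR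
        (fun a b hab h => hI a b hab (h.trans (List.sublist_cons_self _ _))) rfl
      have hcard : (x :: y :: R).toFinset.card = (y :: R).toFinset.card + 1 := by
        rw [List.toFinset_cons, Finset.card_insert_of_notMem (by simpa using hx)]
      rw [hcard, List.length_cons]
      exact ⟨by omega, fun h => by omega⟩

/-! ### Planar trees -/

namespace PlanarTree

variable {n : ℕ} (T : PlanarTree n)

theorem root_le (a : Fin n) : T.le T.root a := by
  have : IsTrans (Fin n) (Relation.TransGen T.edge) := ⟨fun a b c h₁ h₂ => h₁.trans h₂⟩
  have : Std.Irrefl (Relation.TransGen T.edge) := ⟨T.acyclic⟩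
  induction a using
    (Finite.wellFounded_of_trans_of_irrefl (Relation.TransGen T.edge)).induction with
  | _ a ih =>
  by_cases h : ∃ b, Relation.TransGen T.edge b a
  · obtain ⟨b, hb⟩ := h
    exact (ih b hb).trans hb.to_reflTransGen
  · have : a = T.root := T.existsUnique_root.unique (fun b hb => h ⟨b, hb⟩)
      T.existsUnique_root.choose_spec.1
    rw [this]
    exact Relation.ReflTransGen.refl

theorem root_eq_of_le {r : Fin n} (h : ∀ a, ¬ T.lt a r) : T.root = r :=
  T.existsUnique_root.unique T.existsUnique_root.choose_spec.1 h

theorem lt_of_le_of_ne {a b : Fin n} (h : T.le a b) (hab : a ≠ b) : T.lt a b := by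
  rcases Relation.reflTransGen_iff_eq_or_transGen.1 h with h | h
  · exact absurd h.symm hab
  · exact h

theorem le_iff {a b : Fin n} : T.le a b ↔ a = b ∨ T.lt a b := by
  rw [le, Relation.reflTransGen_iff_eq_or_transGen, eq_comm]
  rfl

theorem not_lt_of_left {a b : Fin n} (h : T.left a b) : ¬ T.lt a b := fun h' =>
  (T.comparable a b).1 (Or.inl h) (Or.inr (Or.inl h'))

theorem not_gt_of_left {a b : Fin n} (h : T.left a b) : ¬ T.lt b a := fun h' =>
  (T.comparable a b).1 (Or.inl h) (Or.inr (Or.inr h'))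

theorem left_asymm {a b : Fin n} (h : T.left a b) : ¬ T.left b a := fun h' =>
  T.left_irrefl _ (T.left_trans _ _ _ h h')

/-- Of the five possible relative positions of two vertices of a planar tree exactly one occurs, so
that a tree is determined by lower bounds for its two relations that already compare all pairs. -/
theorem eq_of_imp {S T : PlanarTree n} (hlt : ∀ a b, S.lt a b → T.lt a b)
    (hleft : ∀ a b, S.left a b → T.left a b) : S = T := by
  have key : ∀ a b, a = b ∨ S.lt a b ∨ S.lt b a ∨ S.left a b ∨ S.left b a := by
    intro a b
    by_cases h : a = b ∨ S.lt a b ∨ S.lt b a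
    · tauto
    · have := (S.comparable a b).2 h
      tauto
  have irr : ∀ a, ¬ T.lt a a := T.acyclic
  have asymm : ∀ a b, T.lt a b → ¬ T.lt b a := fun a b h h' => T.acyclic a (h.trans h')
  have elt : ∀ a b, S.lt a b ↔ T.lt a b := by
    refine fun a b => ⟨hlt a b, fun h => ?_⟩
    rcases key a b with rfl | h' | h' | h' | h'
    · exact absurd h (irr a)
    · exact h'
    · exact absurd h (asymm _ _ (hlt _ _ h'))
    · exact absurd h (T.not_lt_of_left (hleft _ _ h'))
    · exact absurd h (T.not_gt_of_left (hleft _ _ h'))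
  have eleft : ∀ a b, S.left a b ↔ T.left a b := by
    refine fun a b => ⟨hleft a b, fun h => ?_⟩
    rcases key a b with rfl | h' | h' | h' | h'
    · exact absurd h (T.left_irrefl a)
    · exact absurd (hlt _ _ h') (T.not_lt_of_left h)
    · exact absurd (hlt _ _ h') (T.not_gt_of_left h)
    · exact h'
    · exact absurd h (T.left_asymm (hleft _ _ h'))
  have eedge : ∀ U : PlanarTree n, ∀ a b, U.edge a b ↔ U.lt a b ∧ ¬ ∃ c, U.lt a c ∧ U.lt c b := by
    refine fun U a b => ⟨fun h => ⟨Relation.TransGen.single h, U.edge_minimal a b h⟩, ?_⟩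
    rintro ⟨h, h'⟩
    obtain ⟨c, hc, hb⟩ := Relation.TransGen.head'_iff.1 h
    by_cases hcb : c = b
    · exact hcb ▸ hc
    · exact absurd ⟨c, Relation.TransGen.single hc, U.lt_of_le_of_ne hb hcb⟩ h'
  refine PlanarTree.ext ?_ ?_
  · funext a b
    rw [eq_iff_iff, eedge, eedge]
    simp only [elt]
  · funext a b
    rw [eq_iff_iff, eleft]

end PlanarTree

namespace TreeColoring

variable {n : ℕ} {T : PlanarTree n} {q : Fin n → ℕ}

theorem I_injective (d : TreeColoring T q) {a b c : Fin n} (hb : T.edge a b) (hc : T.edge a c)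
    (h : d.I a b hb = d.I a c hc) : b = c := by
  by_contra hbc
  have key : T.left b c ∨ T.left c b := by
    rw [T.comparable]
    rintro (h | h | h)
    · exact hbc h
    · exact T.edge_minimal _ _ hc ⟨b, Relation.TransGen.single hb, h⟩
    · exact T.edge_minimal _ _ hb ⟨c, Relation.TransGen.single hc, h⟩
  rcases key with h' | h'
  · exact absurd h (d.mono _ _ _ hb hc h').ne
  · exact absurd h (d.mono _ _ _ hc hb h').ne'

theorem pos_of_edge (d : TreeColoring T q) {a b : Fin n} (hb : T.edge a b) : 0 < q a :=
  (Nat.zero_le _).trans_lt (d.I a b hb).2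

theorem eq_of_edge_of_le_one (d : TreeColoring T q) {a b c : Fin n} (hb : T.edge a b)
    (hc : T.edge a c) (h : q a ≤ 1) : b = c :=
  d.I_injective hb hc (Fin.ext (by
    have := (d.I a b hb).2
    have := (d.I a c hc).2
    omega))

end TreeColoring

/-! ### Colourings of words -/

theorem card_filter_get_eq {n : ℕ} (W : List (Fin n)) (a : Fin n) :
    (Finset.univ.filter fun t => W.get t = a).card = W.count a := by
  have h : Multiset.map W.get Finset.univ.val = (W : Multiset (Fin n)) := by
    rw [Fin.univ_val_map, List.ofFn_get]
  rw [← Multiset.coe_count, ← h, Multiset.count_map, Finset.card_def, Finset.filter_val]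
  simp only [eq_comm]

namespace WordColoring

variable {n : ℕ} {W : List (Fin n)} {p : Fin n → ℕ} {p' : ℕ} (c : WordColoring W p p')

theorem get_π (a : Fin n) (i : Fin (p a + 1)) : W.get (c.π a i) = a :=
  (c.occurrence a _).1 ⟨i, rfl⟩

theorem exists_glue {t s : Fin W.length} (hts : (s : ℕ) = t + 1) {a b : Fin n}
    (ha : W.get t = a) (hb : W.get s = b) :
    ∃ i j, c.π a i = t ∧ (∀ i', c.π a i' = t → i' ≤ i) ∧ c.π b j = s ∧
      (∀ j', c.π b j' = s → j ≤ j') ∧ c.ζ a i = c.ζ b j := by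
  subst ha hb
  obtain ⟨m, ⟨⟨i, hi, hm⟩, hmax⟩, ⟨⟨j, hj, hm'⟩, hmin⟩⟩ := c.glue t s hts
  refine ⟨i, j, hi, fun i' h => ?_, hj, fun j' h => ?_, hm.trans hm'.symm⟩
  · rw [← (c.ζ _).le_iff_le, hm]
    exact hmax ⟨i', h, rfl⟩
  · rw [← (c.ζ _).le_iff_le, hm']
    exact hmin ⟨j', h, rfl⟩

/-- The intervals of a colouring are arranged along the word. -/
theorem ζ_le_of_π_lt {a b : Fin n} {i : Fin (p a + 1)} {j : Fin (p b + 1)}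
    (h : c.π a i < c.π b j) : c.ζ a i ≤ c.ζ b j := by
  obtain ⟨m, hm⟩ : ∃ m, (c.π b j : ℕ) = c.π a i + m + 1 :=
    ⟨c.π b j - c.π a i - 1, by have : (c.π a i : ℕ) < c.π b j := h; omega⟩
  clear h
  induction m generalizing b j with
  | zero =>
    obtain ⟨i', j', -, hi, -, hj, e⟩ := c.exists_glue hm (c.get_π a i) (c.get_π b j)
    exact ((c.ζ a).monotone (hi i rfl)).trans (e.le.trans ((c.ζ b).monotone (hj j rfl)))
  | succ m ih =>
    have hs : (c.π a i : ℕ) + m + 1 < W.length := by have := (c.π b j).2; omega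
    obtain ⟨i', j', hi', -, -, hj, e⟩ := c.exists_glue
      (t := ⟨(c.π a i : ℕ) + m + 1, hs⟩) (s := c.π b j) hm rfl (c.get_π b j)
    exact (ih (b := W.get ⟨(c.π a i : ℕ) + m + 1, hs⟩) (j := i') (by rw [hi'])).trans
      (e.le.trans ((c.ζ b).monotone (hj j rfl)))

theorem π_monotone (a : Fin n) : Monotone (c.π a) := by
  intro i j hij
  by_contra h
  have := (c.ζ a).le_iff_le.1 (c.ζ_le_of_π_lt (not_le.1 h))
  rw [le_antisymm hij this] at h
  exact h le_rfl

theorem count_le (c : WordColoring W p p') (a : Fin n) : W.count a ≤ p a + 1 := by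
  rw [← card_filter_get_eq]
  calc _ ≤ (Finset.univ.image (c.π a)).card := by
        refine Finset.card_le_card fun t ht => ?_
        obtain ⟨i, hi⟩ := (c.occurrence a t).2 (Finset.mem_filter.1 ht).2
        exact Finset.mem_image.2 ⟨i, Finset.mem_univ _, hi⟩
    _ ≤ _ := Finset.card_image_le.trans (by simp)

/-- A vertex enclosed between two occurrences of one letter has at least two indices: its first and
last index are glued to indices of `a` that belong to different occurrences. -/
theorem pos_of_infix (c : WordColoring W p p') {a b : Fin n} (h : [a, b, a] <:+: W) : 0 < p b := by
  obtain ⟨X, Y, h⟩ := h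
  by_contra h0
  have hl : W.length = X.length + 3 + Y.length := by
    rw [← h]
    simp
    omega
  have g (r : ℕ) (hr : r < 3) (e : X.length + r < W.length) :
      W.get ⟨X.length + r, e⟩ = [a, b, a][r] := by
    simp only [List.get_eq_getElem, ← h]
    rw [List.getElem_append_left (by simp; omega), List.getElem_append_right (by simp)]
    simp
  obtain ⟨i, j, hi, -, -, -, e⟩ := c.exists_glue (t := ⟨X.length + 0, by omega⟩)
    (s := ⟨X.length + 1, by omega⟩) (a := a) (b := b) rfl (g 0 (by omega) _) (g 1 (by omega) _)
  obtain ⟨j', i', -, -, hi', -, e'⟩ := c.exists_glue (t := ⟨X.length + 1, by omega⟩)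
    (s := ⟨X.length + 2, by omega⟩) (a := b) (b := a) rfl (g 1 (by omega) _) (g 2 (by omega) _)
  have hj : j = j' := Fin.ext (by have := j.2; have := j'.2; omega)
  rw [hj] at e
  have := (c.ζ a).injective (e.trans e')
  rw [this, hi'] at hi
  have := congrArg Fin.val hi
  simp at this

/-- Within one occurrence, the values of `ζ` are consecutive. -/
theorem ζ_succ {a : Fin n} {i j : Fin (p a + 1)} (hij : (j : ℕ) = i + 1) (h : c.π a i = c.π a j) :
    (c.ζ a j : ℕ) = c.ζ a i + 1 := by
  have hlt : c.ζ a i < c.ζ a j := (c.ζ a).lt_iff_lt.2 (Fin.lt_def.2 (by omega))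
  by_contra hne
  have hlt' : (c.ζ a i : ℕ) + 1 < c.ζ a j := by
    have : (c.ζ a i : ℕ) < c.ζ a j := hlt
    omega
  obtain ⟨l, hl, e⟩ := (c.interval a (c.π a j)).out (x := c.ζ a i) ⟨i, h, rfl⟩
    (y := c.ζ a j) ⟨j, rfl, rfl⟩
    (show (⟨(c.ζ a i : ℕ) + 1, by omega⟩ : Fin (p' + 1)) ∈ Set.Icc _ _ from
      ⟨Fin.le_def.2 (by simp), Fin.le_def.2 hlt'.le⟩)
  have h₁ : c.ζ a i < c.ζ a l := by rw [e]; exact Fin.lt_def.2 (by simp)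
  have h₂ : c.ζ a l < c.ζ a j := by rw [e]; exact Fin.lt_def.2 hlt'
  rw [(c.ζ a).lt_iff_lt, Fin.lt_def] at h₁ h₂
  omega

theorem ζ_eq_zero {a : Fin n} {i : Fin (p a + 1)} (h : (c.π a i : ℕ) = 0)
    (hmin : ∀ j, c.π a j = c.π a i → i ≤ j) : c.ζ a i = 0 := by
  obtain ⟨b, j, hj⟩ := c.cover 0
  rw [← Fin.le_zero_iff, ← hj]
  rcases eq_or_ne (c.π b j) (c.π a i) with e | e
  · have hab : b = a := by rw [← c.get_π b j, e, c.get_π]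
    subst hab
    exact (c.ζ b).monotone (hmin j e)
  · refine c.ζ_le_of_π_lt (Fin.lt_def.2 ?_)
    have : (c.π b j : ℕ) ≠ c.π a i := fun h => e (Fin.ext h)
    omega

/-- A colouring is determined by the distribution of the indices onto the occurrences: the values
of `ζ` are read off by walking along the word. -/
theorem eq_of_π_eq {c d : WordColoring W p p'} (h : c.π = d.π) : c = d := by
  refine WordColoring.ext (funext fun a => RelEmbedding.ext fun i => ?_) h
  obtain ⟨m, hm⟩ : ∃ m : ℕ ×ₗ ℕ, m = toLex ((c.π a i : ℕ), (i : ℕ)) := ⟨_, rfl⟩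
  induction m using WellFoundedLT.induction generalizing a i with
  | _ m ih =>
  subst hm
  by_cases hfirst : ∀ j, c.π a j = c.π a i → i ≤ j
  · rcases Nat.eq_zero_or_pos (c.π a i : ℕ) with h0 | h0
    · rw [c.ζ_eq_zero h0 hfirst, d.ζ_eq_zero (h ▸ h0) (h ▸ hfirst)]
    · have ht : (c.π a i : ℕ) - 1 < W.length := by omega
      obtain ⟨j, i', hj, hj', hi, hi', e⟩ := c.exists_glue (t := ⟨(c.π a i : ℕ) - 1, ht⟩)
        (s := c.π a i) (by simp; omega) rfl (c.get_π a i)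
      obtain ⟨k, l, hk, hk', hl, hl', e'⟩ := d.exists_glue (t := ⟨(c.π a i : ℕ) - 1, ht⟩)
        (s := c.π a i) (by simp; omega) rfl (c.get_π a i)
      rw [← h] at hk hk' hl hl'
      obtain rfl : j = k := le_antisymm (hk' _ hj) (hj' _ hk)
      obtain rfl : i = i' := le_antisymm (hfirst _ hi) (hi' _ rfl)
      obtain rfl : i = l := le_antisymm (hfirst _ hl) (hl' _ rfl)
      rw [← e, ← e']
      refine ih _ ?_ _ j rfl
      rw [Prod.Lex.toLex_lt_toLex]
      left
      rw [hj]
      simp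
      omega
  · push Not at hfirst
    obtain ⟨j, hj, hji⟩ := hfirst
    have hji' : (j : ℕ) < i := hji
    have hl : (i : ℕ) - 1 < p a + 1 := by omega
    have hπ : c.π a ⟨(i : ℕ) - 1, hl⟩ = c.π a i :=
      le_antisymm (c.π_monotone a (Fin.le_def.2 (by simp)))
        (hj ▸ c.π_monotone a (Fin.le_def.2 (Nat.le_sub_one_of_lt hji')))
    have e := ih _ (by
      rw [Prod.Lex.toLex_lt_toLex]
      right
      exact ⟨congrArg Fin.val hπ, Nat.sub_one_lt (by omega)⟩) a ⟨(i : ℕ) - 1, hl⟩ rfl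
    refine Fin.ext ?_
    rw [c.ζ_succ (i := ⟨(i : ℕ) - 1, hl⟩) (j := i) (by simp; omega) hπ,
      d.ζ_succ (i := ⟨(i : ℕ) - 1, hl⟩) (j := i) (by simp; omega) (h ▸ hπ), e]

end WordColoring

/-- The conditions under which tables of natural numbers describe a colouring, where `z a i` is the
value `ζ a i` and `o a i` the position in the word of the occurrence `π a i`. All quantifiers are
bounded, so that the conditions can be decided. -/
def IsColoringTable {n : ℕ} (W : List (Fin n)) (p : Fin n → ℕ) (p' : ℕ)
    (z o : Fin n → ℕ → ℕ) : Prop :=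
  (∀ a, ∀ i < p a + 1, z a i < p' + 1 ∧ o a i < W.length) ∧
  (∀ a, ∀ i < p a, z a i < z a (i + 1)) ∧
  (∀ j < p' + 1, ∃ a, ∃ i < p a + 1, z a i = j) ∧
  (∀ a, ∀ t : Fin W.length, (∃ i < p a + 1, o a i = t) ↔ W.get t = a) ∧
  (∀ a, ∀ i < p a + 1, ∀ j < i, o a j = o a i →
    z a i = z a j + (i - j) ∧ ∀ l < i, j ≤ l → o a l = o a i) ∧
  (∀ t : Fin (W.length - 1), ∀ a b, W[(t : ℕ)]? = some a → W[(t : ℕ) + 1]? = some b →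
    ∃ i < p a + 1, ∃ j < p b + 1, o a i = t ∧ o b j = t + 1 ∧ z a i = z b j ∧
      (∀ i' < p a + 1, o a i' = t → i' ≤ i) ∧ (∀ j' < p b + 1, o b j' = t + 1 → j ≤ j'))

instance {n : ℕ} (W : List (Fin n)) (p : Fin n → ℕ) (p' : ℕ) (z o : Fin n → ℕ → ℕ) :
    Decidable (IsColoringTable W p p' z o) := by
  unfold IsColoringTable
  refine @instDecidableAnd _ _ ?_ (@instDecidableAnd _ _ ?_ (@instDecidableAnd _ _ ?_
    (@instDecidableAnd _ _ ?_ (@instDecidableAnd _ _ ?_ ?_)))) <;> infer_instance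

/-- The colouring given by tables of natural numbers. -/
def WordColoring.ofTable {n : ℕ} {W : List (Fin n)} {p : Fin n → ℕ} {p' : ℕ}
    (z o : Fin n → ℕ → ℕ) (h : IsColoringTable W p p' z o) : WordColoring W p p' where
  ζ a := OrderEmbedding.ofStrictMono (fun i => ⟨z a i, (h.1 a i i.2).1⟩)
    (Fin.strictMono_iff_lt_succ.2 fun i => Fin.lt_def.2 (h.2.1 a i i.2))
  π a i := ⟨o a i, (h.1 a i i.2).2⟩
  cover j := by
    obtain ⟨a, i, hi, e⟩ := h.2.2.1 j j.2
    exact ⟨a, ⟨i, hi⟩, Fin.ext e⟩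
  occurrence a t := by
    rw [← h.2.2.2.1 a t]
    refine ⟨fun ⟨i, hi⟩ => ⟨i, i.2, congrArg Fin.val hi⟩, fun ⟨i, hi, e⟩ => ⟨⟨i, hi⟩, Fin.ext e⟩⟩
  interval a t := by
    refine ⟨?_⟩
    rintro _ ⟨i, hi, rfl⟩ _ ⟨j, hj, rfl⟩ x ⟨h₁, h₂⟩
    have hi' : o a i = t := congrArg Fin.val hi
    have hj' : o a j = t := congrArg Fin.val hj
    have h₁' : z a i ≤ x := h₁
    have h₂' : (x : ℕ) ≤ z a j := h₂
    have mono : ∀ m l : ℕ, l + m < p a + 1 → z a l ≤ z a (l + m) := by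
      intro m l hl
      induction m with
      | zero => simp
      | succ m ih =>
        exact (ih (by omega)).trans (h.2.1 a (l + m) (by omega)).le
    rcases lt_trichotomy (i : ℕ) j with hij | hij | hij
    · obtain ⟨e, hl⟩ := h.2.2.2.2.1 a j j.2 i hij (hi'.trans hj'.symm)
      have hlp : (i : ℕ) + (x - z a i) < p a + 1 := by have := j.2; omega
      have ho : o a (i + (x - z a i)) = t := by
        rcases eq_or_ne ((i : ℕ) + (x - z a i)) j with e' | e'
        · rw [e', hj']
        · rw [hl _ (by omega) (by omega), hj']
      refine ⟨⟨i + (x - z a i), hlp⟩, Fin.ext ho, Fin.ext ?_⟩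
      change z a (i + (x - z a i)) = x
      rcases Nat.eq_zero_or_pos ((x : ℕ) - z a i) with e' | e'
      · rw [e', add_zero]
        omega
      · rw [(h.2.2.2.2.1 a _ hlp i (by omega) (hi'.trans ho.symm)).1]
        omega
    · refine ⟨i, hi, Fin.ext ?_⟩
      rw [← hij] at h₂'
      exact le_antisymm h₁' h₂'
    · have := mono (i - j) j (by omega)
      rw [show (j : ℕ) + (i - j) = i by omega] at this
      exact ⟨i, hi, Fin.ext (by change z a i = x; omega)⟩
  glue t s hts := by
    obtain ⟨i, hi, j, hj, e₁, e₂, e₃, h₁, h₂⟩ := h.2.2.2.2.2 ⟨t, by omega⟩ (W.get t) (W.get s)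
      (by simp) (by simp [← hts])
    refine ⟨⟨z (W.get t) i, (h.1 _ i hi).1⟩,
      ⟨⟨⟨i, hi⟩, Fin.ext e₁, rfl⟩, ?_⟩,
      ⟨⟨⟨j, hj⟩, Fin.ext (e₂.trans hts.symm), Fin.ext e₃.symm⟩, ?_⟩⟩
    · rintro _ ⟨i', hi', rfl⟩
      refine (OrderEmbedding.le_iff_le _ (a := i') (b := ⟨i, hi⟩)).2 ?_
      exact Fin.le_def.2 (h₁ i' i'.2 (congrArg Fin.val hi'))
    · rintro _ ⟨j', hj', rfl⟩
      refine le_of_eq_of_le (Fin.ext e₃)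
        ((OrderEmbedding.le_iff_le _ (a := ⟨j, hj⟩) (b := j')).2 ?_)
      exact Fin.le_def.2 (h₂ j' j'.2 ((congrArg Fin.val hj').trans hts))

/-! ### Maximal quilts -/

namespace MaximalQuilt

variable {m : ℕ} (Q : MaximalQuilt (m + 2))

/-- The word of a maximal quilt begins with the root, which does not occur again. -/
theorem exists_word_eq : ∃ W, Q.1.word = 0 :: W ∧ 0 ∉ W ∧ ∀ b, b ≠ 0 → Q.1.tree.lt 0 b := by
  have hlen := Q.2.1
  obtain ⟨x, W, hW⟩ : ∃ x W, Q.1.word = x :: W := by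
    match h : Q.1.word with
    | [] => rw [h] at hlen; simp at hlen
    | x :: W => exact ⟨x, W, rfl⟩
  obtain rfl : x = 0 := by
    by_contra hx
    have := Q.2.2 (Fin.pos_of_ne_zero hx)
    simp only [hW, List.idxOf_cons_self] at this
    omega
  have hroot : Q.1.tree.root = 0 := by
    by_contra h
    have hmem : Q.1.tree.root ∈ W := by
      have := Q.1.isWord.surj Q.1.tree.root
      rw [hW] at this
      simpa [h] using this
    refine Q.1.order 0 Q.1.tree.root ?_ (Q.1.tree.lt_of_le_of_ne (Q.1.tree.root_le 0) h)
    rw [hW]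
    exact List.Sublist.cons_cons _ (List.singleton_sublist.2 hmem)
  have hlt : ∀ b, b ≠ 0 → Q.1.tree.lt 0 b := fun b hb =>
    Q.1.tree.lt_of_le_of_ne (hroot ▸ Q.1.tree.root_le b) hb.symm
  refine ⟨W, hW, fun h0 => ?_, hlt⟩
  obtain ⟨c, hc, hsub⟩ := exists_sublist_of_two_le_count (b := 0) Q.1.isWord.nondegenerate (by
    have := List.count_pos_iff.2 h0
    rw [hW, List.count_cons_self]
    omega)
  rcases Q.1.nested _ _ hsub with h | h
  · exact Q.1.tree.not_gt_of_left h (hlt c hc)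
  · exact hc h

/-- After the root, the word of a maximal quilt is a longest word without interlacing, beginning and
ending with the vertex `1`. -/
theorem exists_tail_eq : ∃ W, Q.1.word = 0 :: 1 :: W ∧ (1 :: W).getLast? = some 1 ∧
    ∀ b, b ≠ 0 → b ≠ 1 → Q.1.word.count b = 1 → ∃ c, [c, b, c] <:+: Q.1.word := by
  obtain ⟨W, hW, h0, -⟩ := Q.exists_word_eq
  have hlen : W.length = 2 * m + 1 := by
    have := Q.2.1
    rw [hW, List.length_cons] at this
    omega
  have hmem : ∀ b, b ≠ 0 → b ∈ W := fun b hb => by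
    have := Q.1.isWord.surj b
    rw [hW] at this
    simpa [hb] using this
  have hcard : W.toFinset.card = m + 1 := by
    have : W.toFinset = Finset.univ.erase 0 := by
      ext b
      rw [List.mem_toFinset, Finset.mem_erase]
      exact ⟨fun h => ⟨fun h' => h0 (h' ▸ h), Finset.mem_univ _⟩, fun h => hmem b h.1⟩
    rw [this, Finset.card_erase_of_mem (Finset.mem_univ _), Finset.card_univ, Fintype.card_fin]
    rfl
  have hchain := Q.1.isWord.nondegenerate
  have hI := Q.1.isWord.noInterlacing
  rw [hW] at hchain hI
  obtain ⟨s, hs, hs', hs''⟩ := (length_add_one_le_two_mul_card W (by rintro rfl; simp at hlen)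
    (List.isChain_cons.1 hchain).2
    (fun a b hab h => hI a b hab (h.trans (List.sublist_cons_self _ _)))).2 (by omega)
  match W, hW, hs, hs', hs'' with
  | s' :: W, hW, hs, hs', hs'' =>
    obtain rfl : s' = s := by simpa using hs
    have hs0 : s' ≠ 0 := fun h => h0 (by simp [h])
    have hs1 : s' = 1 := by
      by_contra h
      have h₁ : (1 : Fin (m + 2)) < s' := by
        rw [Fin.lt_def]
        have h₀ : (s' : ℕ) ≠ 0 := fun e => hs0 (Fin.ext e)
        have h₁ : (s' : ℕ) ≠ 1 := fun e => h (Fin.ext e)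
        simp
        omega
      have := Q.2.2 h₁
      simp only [hW] at this
      rw [List.idxOf_cons_ne _ (by simp), List.idxOf_cons_ne _ h, List.idxOf_cons_ne _ hs0.symm,
        List.idxOf_cons_self] at this
      omega
    subst hs1
    refine ⟨W, hW, hs', fun b hb hb1 hc => ?_⟩
    rw [hW, List.count_cons_of_ne hb.symm] at hc
    obtain ⟨c, hc⟩ := hs'' b (hmem b hb) hb1 hc
    rw [hW]
    exact ⟨c, hc.trans ⟨[0], [], by simp⟩⟩

/-- The vertex `1` comes second and last in the word, so that all the others but the root are nested
in it. -/
theorem left_one {b : Fin (m + 2)} (hb : b ≠ 0) (hb1 : b ≠ 1) : Q.1.tree.left b 1 := by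
  obtain ⟨W, hW, hlast, -⟩ := Q.exists_tail_eq
  have hbW : b ∈ W := by
    have := Q.1.isWord.surj b
    rw [hW] at this
    simpa [hb, hb1] using this
  rcases List.eq_nil_or_concat W with rfl | ⟨V, x, rfl⟩
  · simp at hbW
  obtain rfl : x = 1 := by
    rw [List.concat_eq_append, ← List.cons_append, List.getLast?_append] at hlast
    simpa using hlast
  have hbV : b ∈ V := by simpa [hb1] using hbW
  refine (Q.1.nested 1 b ?_).resolve_right hb1
  rw [hW, List.concat_eq_append]
  refine List.Sublist.cons _ (List.Sublist.cons_cons _ ?_)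
  exact (List.singleton_sublist.2 hbV).append (List.Sublist.refl [1])

/-- The vertex `1` is a child of the root: any other parent would be to the left of it. -/
theorem edge_zero_one : Q.1.tree.edge 0 1 := by
  obtain ⟨W, -, -, hlt⟩ := Q.exists_word_eq
  obtain ⟨c, -, hc⟩ := Relation.TransGen.tail'_iff.1 (hlt 1 (by simp))
  by_cases h0 : c = 0
  · exact h0 ▸ hc
  by_cases h1 : c = 1
  · exact absurd (Relation.TransGen.single (h1 ▸ hc)) (Q.1.tree.acyclic 1)
  · exact absurd (Relation.TransGen.single hc) (Q.1.tree.not_lt_of_left (Q.left_one h0 h1))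

section Colored

variable {p q : Fin (m + 2) → ℕ} {p' : ℕ}

/-- A vertex other than `0` and `1` either occurs twice, hence has two indices, or is enclosed
between two occurrences of one letter. -/
theorem pos_of_coloring (c : WordColoring Q.1.word p p') {b : Fin (m + 2)} (hb : b ≠ 0)
    (hb1 : b ≠ 1) : 0 < p b := by
  by_contra h
  obtain ⟨W, -, -, hcount⟩ := Q.exists_tail_eq
  have h₁ := c.count_le b
  have h₂ := List.count_pos_iff.2 (Q.1.isWord.surj b)
  obtain ⟨a, ha⟩ := hcount b hb hb1 (by omega)
  exact h (c.pos_of_infix ha)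

/-- In a maximal quilt that acts nontrivially in shifted total degree `1`, all vertices other than
`0` and `1` lie on a chain. -/
theorem comparable_of_coloring (c : WordColoring Q.1.word p p') (d : TreeColoring Q.1.tree q)
    (hpq : ∀ a, p a + q a = 2) {a b : Fin (m + 2)} (ha : a ≠ 0) (ha1 : a ≠ 1) (hb : b ≠ 0)
    (hb1 : b ≠ 1) : Q.1.tree.le a b ∨ Q.1.tree.le b a := by
  obtain ⟨W, -, -, hlt⟩ := Q.exists_word_eq
  have child : ∀ b, b ≠ 0 → b ≠ 1 → ∃ x, Q.1.tree.edge 0 x ∧ x ≠ 1 ∧ Q.1.tree.le x b := by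
    intro b hb hb1
    obtain ⟨x, hx, hxb⟩ := Relation.TransGen.head'_iff.1 (hlt b hb)
    refine ⟨x, hx, ?_, hxb⟩
    rintro rfl
    exact Q.1.tree.not_gt_of_left (Q.left_one hb hb1)
      (Q.1.tree.lt_of_le_of_ne hxb (Ne.symm hb1))
  obtain ⟨x, hx, hx1, hxa⟩ := child a ha ha1
  obtain ⟨y, hy, hy1, hyb⟩ := child b hb hb1
  -- the root has at most two children, one of which is the vertex `1`
  obtain rfl : x = y := by
    by_contra hxy
    have h₁ : d.I 0 x hx ≠ d.I 0 1 Q.edge_zero_one := fun h => hx1 (d.I_injective _ _ h)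
    have h₂ : d.I 0 y hy ≠ d.I 0 1 Q.edge_zero_one := fun h => hy1 (d.I_injective _ _ h)
    have h₃ : d.I 0 x hx ≠ d.I 0 y hy := fun h => hxy (d.I_injective _ _ h)
    rw [Ne, Fin.ext_iff] at h₁ h₂ h₃
    have := (d.I 0 x hx).2
    have := (d.I 0 y hy).2
    have := (d.I 0 1 Q.edge_zero_one).2
    have := hpq 0
    omega
  have hx0 : x ≠ 0 := by
    rintro rfl
    exact Q.1.tree.acyclic _ (Relation.TransGen.single hx)
  -- the vertices other than the root and `1` have at most one child
  have key : ∀ z, Q.1.tree.le x z → Relation.ReflTransGen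
      (fun s t => Q.1.tree.edge s t ∧ q s ≤ 1) x z := by
    intro z hz
    induction hz with
    | refl => exact Relation.ReflTransGen.refl
    | @tail s t hs hst ih =>
      refine ih.tail ⟨hst, ?_⟩
      have hs0 : s ≠ 0 := by
        rintro rfl
        exact Q.1.tree.acyclic _ ((Q.1.tree.lt_of_le_of_ne hs hx0).trans (hlt x hx0))
      have hs1 : s ≠ 1 := by
        rintro rfl
        exact Q.1.tree.not_lt_of_left (Q.left_one hx0 hx1) (Q.1.tree.lt_of_le_of_ne hs hx1)
      have := Q.pos_of_coloring c hs0 hs1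
      have := hpq s
      omega
  have hU : Relator.RightUnique (fun s t => Q.1.tree.edge s t ∧ q s ≤ 1) :=
    fun s t u h₁ h₂ => d.eq_of_edge_of_le_one h₁.1 h₂.1 h₁.2
  refine (Relation.ReflTransGen.total_of_right_unique hU (key a hxa) (key b hyb)).imp ?_ ?_ <;>
    exact fun h => h.lift id fun _ _ h => h.1

/-- A letter between two occurrences of `b` would be to the left of `b`, which is impossible in a
chain. -/
theorem count_eq_one (c : WordColoring Q.1.word p p') (d : TreeColoring Q.1.tree q)
    (hpq : ∀ a, p a + q a = 2) {b : Fin (m + 2)} (hb : b ≠ 0) (hb1 : b ≠ 1) :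
    Q.1.word.count b = 1 := by
  have h₂ := List.count_pos_iff.2 (Q.1.isWord.surj b)
  by_contra hne
  obtain ⟨a, hab, hsub⟩ :=
    exists_sublist_of_two_le_count (b := b) Q.1.isWord.nondegenerate (by omega)
  have hl := (Q.1.nested _ _ hsub).resolve_right hab
  by_cases ha : a = 0
  · obtain ⟨W, -, -, hlt⟩ := Q.exists_word_eq
    exact Q.1.tree.not_lt_of_left hl (ha ▸ hlt b hb)
  by_cases ha1 : a = 1
  · exact Q.1.tree.left_asymm hl (ha1 ▸ Q.left_one hb hb1)
  rcases Q.comparable_of_coloring c d hpq ha ha1 hb hb1 with h | h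
  · exact Q.1.tree.not_lt_of_left hl (Q.1.tree.lt_of_le_of_ne h hab)
  · exact Q.1.tree.not_gt_of_left hl (Q.1.tree.lt_of_le_of_ne h hab.symm)

theorem count_one_eq (c : WordColoring Q.1.word p p') (d : TreeColoring Q.1.tree q)
    (hpq : ∀ a, p a + q a = 2) : Q.1.word.count 1 = m + 1 := by
  have hsum : ∑ a, Q.1.word.count a = Q.1.word.length := by
    rw [← List.sum_toFinset_count_eq_length]
    refine (Finset.sum_subset (Finset.subset_univ _) fun a _ ha => ?_).symm
    exact List.count_eq_zero_of_not_mem fun h => ha (List.mem_toFinset.2 h)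
  rw [Fin.sum_univ_succ, Fin.sum_univ_succ] at hsum
  have hrest : ∀ i : Fin m, Q.1.word.count i.succ.succ = 1 := fun i =>
    Q.count_eq_one c d hpq (Fin.succ_ne_zero _) (by
      rw [Ne, ← Fin.succ_zero_eq_one, Fin.succ_inj]
      exact Fin.succ_ne_zero _)
  have h0 : Q.1.word.count 0 = 1 := by
    obtain ⟨W, hW, h0, -⟩ := Q.exists_word_eq
    rw [hW, List.count_cons_self, List.count_eq_zero_of_not_mem h0]
  have hlen := Q.2.1
  simp only [hrest, Finset.sum_const, Finset.card_univ, Fintype.card_fin, smul_eq_mul, mul_one, h0,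
    Fin.succ_zero_eq_one] at hsum
  omega

/-- A maximal quilt with more than four vertices vanishes in shifted total degree `1`: the vertex
`1` occurs `m + 1` times, and has at most three indices. -/
theorem le_two_of_coloring (c : WordColoring Q.1.word p p') (d : TreeColoring Q.1.tree q)
    (hpq : ∀ a, p a + q a = 2) : m ≤ 2 := by
  have h₁ := Q.count_one_eq c d hpq
  have h₂ := c.count_le 1
  have h₃ := hpq 1
  omega

end Colored

end MaximalQuilt

/-! ### The maximal quilts with at most four vertices -/

theorem transGen_cherry (a b : Fin 3) :
    Relation.TransGen (fun a b : Fin 3 => a = 0 ∧ b ≠ 0) a b ↔ a = 0 ∧ b ≠ 0 := by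
  refine ⟨fun h => ?_, fun h => Relation.TransGen.single h⟩
  induction h with
  | single h => exact h
  | tail _ h ih => exact absurd h.1 ih.2

/-- The planar tree with edges `0 → 2` and `0 → 1`, with `2` to the left of `1`. -/
def cherryTree : PlanarTree 3 where
  edge a b := a = 0 ∧ b ≠ 0
  left a b := a = 2 ∧ b = 1
  left_irrefl := by decide
  left_trans := by decide
  acyclic := by simp only [transGen_cherry]; decide
  existsUnique_root := by
    simp only [transGen_cherry]
    exact ⟨0, by decide, by decide⟩
  edge_minimal := by simp only [transGen_cherry]; decide
  comparable := by simp only [transGen_cherry]; decide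
  inherit := by simp only [Relation.reflTransGen_iff_eq_or_transGen, transGen_cherry]; decide

theorem cherryTree_lt (a b : Fin 3) : cherryTree.lt a b ↔ a = 0 ∧ b ≠ 0 := transGen_cherry a b

theorem transGen_fork (a b : Fin 4) :
    Relation.TransGen (fun a b : Fin 4 => a = 0 ∧ (b = 1 ∨ b = 2) ∨ a = 2 ∧ b = 3) a b ↔
      a = 0 ∧ b ≠ 0 ∨ a = 2 ∧ b = 3 := by
  refine ⟨fun h => ?_, fun h => ?_⟩
  · induction h with
    | single h => revert h; revert a; decide +revert
    | tail _ h ih => revert h ih; clear * -; decide +revert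
  · by_cases h' : a = 0 ∧ b = 3
    · exact (Relation.TransGen.single (b := 2) (by simp [h'])).tail (by simp [h'])
    · exact Relation.TransGen.single (by revert a b; decide)

/-- The planar tree with edges `0 → 2`, `2 → 3` and `0 → 1`, with `2` to the left of `1`. -/
def forkTree : PlanarTree 4 where
  edge a b := a = 0 ∧ (b = 1 ∨ b = 2) ∨ a = 2 ∧ b = 3
  left a b := (a = 2 ∨ a = 3) ∧ b = 1
  left_irrefl := by decide
  left_trans := by decide
  acyclic := by simp only [transGen_fork]; decide
  existsUnique_root := by
    simp only [transGen_fork]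
    exact ⟨0, by decide, by decide⟩
  edge_minimal := by simp only [transGen_fork]; decide
  comparable := by simp only [transGen_fork]; decide
  inherit := by simp only [Relation.reflTransGen_iff_eq_or_transGen, transGen_fork]; decide

theorem forkTree_lt (a b : Fin 4) : forkTree.lt a b ↔ a = 0 ∧ b ≠ 0 ∨ a = 2 ∧ b = 3 :=
  transGen_fork a b

theorem twoTree_lt (r a b : Fin 2) : (twoTree r).lt a b ↔ a = r ∧ b ≠ r := by
  refine ⟨fun h => ?_, fun h => Relation.TransGen.single h⟩
  induction h with
  | single h => exact h
  | tail _ h ih => exact absurd h.1 ih.2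

/-- The quilt with word `0121` and with the tree with edges `0 → 2` and `0 → 1`. -/
def cherryQuilt : Quilt 3 where
  word := [0, 1, 2, 1]
  tree := cherryTree
  isWord := ⟨by decide, by decide, by decide⟩
  order := by
    simp only [cherryTree_lt]
    decide
  nested := by
    change ∀ a b : Fin 3, List.Sublist [a, b, a] [0, 1, 2, 1] → (b = 2 ∧ a = 1) ∨ b = a
    decide

/-- The quilt with word `012131` and with the tree with edges `0 → 2`, `2 → 3` and `0 → 1`. -/
def forkQuilt : Quilt 4 where
  word := [0, 1, 2, 1, 3, 1]
  tree := forkTree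
  isWord := ⟨by decide, by decide, by decide⟩
  order := by
    simp only [forkTree_lt]
    decide
  nested := by
    change ∀ a b : Fin 4, List.Sublist [a, b, a] [0, 1, 2, 1, 3, 1] →
      ((b = 2 ∨ b = 3) ∧ a = 1) ∨ b = a
    decide

namespace MaximalQuilt

/-- The quilt with two vertices and root `0`, as a maximal quilt. -/
def edge : MaximalQuilt 2 :=
  ⟨twoQuilt 0, rfl, by
    change StrictMono fun a => List.idxOf a [(0 : Fin 2), 1]
    intro a b
    revert a b
    decide⟩

/-- The quilt with word `0121`, as a maximal quilt. -/
def cherry : MaximalQuilt 3 :=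
  ⟨cherryQuilt, rfl, by
    change StrictMono fun a => List.idxOf a [(0 : Fin 3), 1, 2, 1]
    intro a b
    revert a b
    decide⟩

/-- The quilt with word `012131`, as a maximal quilt. -/
def fork : MaximalQuilt 4 :=
  ⟨forkQuilt, rfl, by
    change StrictMono fun a => List.idxOf a [(0 : Fin 4), 1, 2, 1, 3, 1]
    intro a b
    revert a b
    decide⟩

theorem eq_edge (Q : MaximalQuilt 2) : Q = edge := by
  obtain ⟨W, hW, -, -⟩ := Q.exists_tail_eq (m := 0)
  obtain ⟨-, -, -, hlt⟩ := Q.exists_word_eq (m := 0)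
  have hlen := Q.2.1
  refine Subtype.ext (Quilt.ext ?_ (PlanarTree.eq_of_imp (S := twoTree 0) ?_ ?_).symm)
  · rw [hW] at hlen ⊢
    obtain rfl : W = [] := List.length_eq_zero_iff.1 (by simpa using hlen)
    rfl
  · intro a b h
    obtain ⟨rfl, h'⟩ := (twoTree_lt _ _ _).1 h
    exact hlt b h'
  · exact fun a b h => h.elim

theorem eq_cherry (Q : MaximalQuilt 3) : Q = cherry := by
  obtain ⟨W, hW, hlast, -⟩ := Q.exists_tail_eq (m := 1)
  obtain ⟨-, -, -, hlt⟩ := Q.exists_word_eq (m := 1)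
  have hlen := Q.2.1
  refine Subtype.ext (Quilt.ext ?_ (PlanarTree.eq_of_imp (S := cherryTree) ?_ ?_).symm)
  · have hsurj := Q.1.isWord.surj 2
    rw [hW] at hlen hsurj ⊢
    match W, hlen, hlast, hsurj with
    | [x, y], _, hlast, hsurj =>
      obtain rfl : y = 1 := by simpa using hlast
      obtain rfl : x = 2 := by
        clear * - hsurj
        revert x
        decide
      rfl
  · intro a b h
    obtain ⟨rfl, h'⟩ := (cherryTree_lt _ _).1 h
    exact hlt b h'
  · rintro a b ⟨rfl, rfl⟩
    exact Q.left_one (by decide) (by decide)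

/-- In contrast to the case of two or three vertices, there are several maximal quilts with four
vertices; all but one of them have no colourings in shifted total degree `1`. -/
theorem eq_fork (Q : MaximalQuilt 4) {p q : Fin 4 → ℕ} {p' : ℕ}
    (c : WordColoring Q.1.word p p') (d : TreeColoring Q.1.tree q) (hpq : ∀ a, p a + q a = 2) :
    Q = fork := by
  obtain ⟨W, hW, hlast, -⟩ := Q.exists_tail_eq (m := 2)
  obtain ⟨-, -, -, hlt⟩ := Q.exists_word_eq (m := 2)
  have hlen := Q.2.1
  have hword : Q.1.word = [0, 1, 2, 1, 3, 1] := by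
    have h₂ := Q.count_eq_one c d hpq (b := 2) (by decide) (by decide)
    have h₃ := Q.count_eq_one c d hpq (b := 3) (by decide) (by decide)
    have h₁ := Q.count_one_eq c d hpq
    have hchain := Q.1.isWord.nondegenerate
    have hidx := Q.2.2 (show (2 : Fin 4) < 3 by decide)
    simp only [hW] at hidx
    rw [hW] at hlen h₁ h₂ h₃ hchain ⊢
    match W, hlen, hlast, h₁, h₂, h₃, hchain, hidx with
    | [x, y, z, t], _, hlast, h₁, h₂, h₃, hchain, hidx =>
      obtain rfl : t = 1 := by simpa using hlast
      have key : ∀ x y z : Fin 4, [0, 1, x, y, z, 1].count (1 : Fin 4) = 3 →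
          [0, 1, x, y, z, 1].count (2 : Fin 4) = 1 →
          [0, 1, x, y, z, 1].count (3 : Fin 4) = 1 → x ≠ 1 → z ≠ 1 →
          [0, 1, x, y, z, 1].idxOf (2 : Fin 4) < [0, 1, x, y, z, 1].idxOf (3 : Fin 4) →
          x = 2 ∧ y = 1 ∧ z = 3 := by
        decide
      obtain ⟨rfl, rfl, rfl⟩ := key x y z h₁ h₂ h₃ (by simp at hchain; tauto)
        (by simp at hchain; tauto) hidx
      rfl
  refine Subtype.ext (Quilt.ext hword (PlanarTree.eq_of_imp (S := forkTree) ?_ ?_).symm)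
  · intro a b h
    rcases (forkTree_lt _ _).1 h with ⟨rfl, h'⟩ | ⟨rfl, rfl⟩
    · exact hlt b h'
    · refine ((Q.comparable_of_coloring c d hpq (a := 2) (b := 3) (by decide) (by decide)
        (by decide) (by decide)).resolve_right fun h => ?_) |> fun h =>
          Q.1.tree.lt_of_le_of_ne h (by decide)
      exact Q.1.order 2 3 (by rw [hword]; decide) (Q.1.tree.lt_of_le_of_ne h (by decide))
  · rintro a b ⟨h, rfl⟩
    exact Q.left_one (by rintro rfl; revert h; decide) (by rintro rfl; revert h; decide)

end MaximalQuilt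

/-! ### Computation of signs and positions -/

/-- A form of `Interposed` with bounded quantifiers. -/
theorem interposed_iff {n : ℕ} (W : List (Fin n)) (b : Fin n) :
    Interposed W b ↔
      ∃ j < W.length, ∃ i < j, i + 1 < j ∧ W[i + 1]? = some b ∧ W[i]? = W[j]? := by
  constructor
  · rintro ⟨a, X, Y, Z, rfl⟩
    refine ⟨X.length + 2 + Y.length, by simp; omega, X.length, by omega, by omega, ?_, ?_⟩
    · simp
    · have h : X.length + 2 + Y.length = (X ++ a :: b :: Y).length := by
        simp
        omega
      rw [h, List.getElem?_append_right le_rfl]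
      simp
  · rintro ⟨j, hj, i, hi, hij, hb, he⟩
    refine ⟨W[j], W.take i, (W.take j).drop (i + 2), W.drop (j + 1), ?_⟩
    rw [List.getElem?_eq_getElem hj, List.getElem?_eq_getElem (by omega), Option.some_inj] at he
    rw [List.getElem?_eq_getElem (by omega), Option.some_inj] at hb
    have h₁ : W.take j = W.take i ++ W[j] :: b :: (W.take j).drop (i + 2) := by
      conv_lhs => rw [← List.take_append_drop i (W.take j)]
      rw [List.take_take, min_eq_left hi.le, List.drop_eq_getElem_cons (by simp; omega),
        List.drop_eq_getElem_cons (by simp; omega)]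
      simp [he, hb]
    rw [← h₁, List.cons_eq_append_iff.2 (Or.inl ⟨rfl, rfl⟩)]
    simp

instance {n : ℕ} (W : List (Fin n)) : DecidablePred (Interposed W) := fun b =>
  decidable_of_iff _ (interposed_iff W b).symm

namespace Quilt

variable {n : ℕ} (Q : Quilt n) {p q : Fin n → ℕ} {p' : ℕ}
  (c : WordColoring Q.word p p') (d : TreeColoring Q.tree q)

/-- `VertLT` for letters given as a vertex and a number. -/
def VertRel (a : Fin n) (i : ℕ) (b : Fin n) (j : ℕ) : Prop :=
  ((Interposed Q.word a ∧ i = 0) ∧ (Interposed Q.word b ∧ j = 0) ∧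
    Q.word.idxOf b < Q.word.idxOf a) ∨
  ((Interposed Q.word a ∧ i = 0) ∧ ¬ (Interposed Q.word b ∧ j = 0)) ∨
  (¬ (Interposed Q.word a ∧ i = 0) ∧ ¬ (Interposed Q.word b ∧ j = 0) ∧
    (c.π a ⟨min i (p a), by omega⟩ < c.π b ⟨min j (p b), by omega⟩ ∨
      (c.π a ⟨min i (p a), by omega⟩ = c.π b ⟨min j (p b), by omega⟩ ∧ i < j)))

/-- `HorizLT` for letters given as a vertex and a number. -/
def HorizRel (a : Fin n) (i : ℕ) (b : Fin n) (j : ℕ) : Prop :=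
  (a = b ∧ i < j) ∨ Q.tree.left a b ∨
    (∃ x, ∃ e : Q.tree.edge a x, Q.tree.le x b ∧ i < d.I a x e) ∨
    (∃ x, ∃ e : Q.tree.edge b x, Q.tree.le x a ∧ (d.I b x e : ℕ) ≤ j)

instance (a : Fin n) (i : ℕ) (b : Fin n) (j : ℕ) : Decidable (Q.VertRel c a i b j) := by
  unfold VertRel
  infer_instance

instance [DecidableRel Q.tree.edge] [DecidableRel Q.tree.left] [DecidableRel Q.tree.le]
    (a : Fin n) (i : ℕ) (b : Fin n) (j : ℕ) : Decidable (Q.HorizRel d a i b j) := by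
  unfold HorizRel
  infer_instance

/-- The number of inversions that determines the sign of a colouring, as a sum that can be
evaluated. -/
def inversions [DecidableRel Q.tree.edge] [DecidableRel Q.tree.left] [DecidableRel Q.tree.le] :
    ℕ :=
  let v : Fin n → ℕ := fun a => if Interposed Q.word a ∧ p a = 0 then 2 else p a
  let h : Fin n → ℕ := fun a => numHoriz q a - 1
  (∑ a, ∑ i ∈ Finset.range (v a), ∑ b, ∑ j ∈ Finset.range (v b),
    if (a < b ∨ (a = b ∧ i < j)) ∧ Q.VertRel c b j a i then 1 else 0) +
  (∑ a, ∑ _i ∈ Finset.range (h a), ∑ b, ∑ _j ∈ Finset.range (v b), if a < b then 1 else 0) +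
  (∑ a, ∑ i ∈ Finset.range (h a), ∑ b, ∑ j ∈ Finset.range (h b),
    if (a < b ∨ (a = b ∧ i < j)) ∧ Q.HorizRel d b j a i then 1 else 0)

theorem sign_eq [DecidableRel Q.tree.edge] [DecidableRel Q.tree.left] [DecidableRel Q.tree.le] :
    Q.sign c d = (-1) ^ Q.inversions c d := by
  classical
  have hv : ∀ a, (if Interposed Q.word a ∧ p a = 0 then 2 else p a) = Q.numVert p a := by
    intro a
    unfold numVert
    congr
  have hV : ∀ s t, Q.VertLT c s t = Q.VertRel c s.1 s.2 t.1 t.2 := fun _ _ => rfl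
  have hH : ∀ s t, Q.HorizLT d s t = Q.HorizRel d s.1 s.2 t.1 t.2 := fun _ _ => rfl
  rw [sign, inversions, Finset.card_filter]
  congr 1
  simp only [Fintype.sum_prod_type, Fintype.sum_sum_type, Fintype.sum_sigma, hv, Finset.sum_range,
    InitialLT, ShuffledLT, and_false, if_false, Finset.sum_const_zero, zero_add,
    Finset.sum_add_distrib, and_true, hV, hH]
  congr!

end Quilt

namespace TreeColoring

variable {n : ℕ} {T : PlanarTree n} {q : Fin n → ℕ} (d : TreeColoring T q)

instance [DecidableRel T.edge] (s : Σ a, Fin (q a)) : Decidable (d.IsOpen s) := by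
  unfold IsOpen
  infer_instance

instance [DecidableRel T.edge] [DecidableRel T.left] [DecidableRel T.le] (s t : Σ a, Fin (q a)) :
    Decidable (d.InputLT s t) := by
  unfold InputLT
  infer_instance

theorem position_eq [DecidableRel T.edge] [DecidableRel T.left] [DecidableRel T.le]
    (s : Σ a, Fin (q a)) :
    d.position s = (Finset.univ.filter fun t => d.IsOpen t ∧ d.InputLT t s).card := by
  unfold position
  congr!

end TreeColoring

instance (r : Fin 2) : DecidableRel (twoTree r).edge := fun a b =>
  inferInstanceAs (Decidable (a = r ∧ b ≠ r))

instance (r : Fin 2) : DecidableRel (twoTree r).left := fun _ _ =>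
  inferInstanceAs (Decidable False)

instance (r : Fin 2) : DecidableRel (twoTree r).le := fun a b =>
  decidable_of_iff (a = b ∨ a = r ∧ b ≠ r) (by rw [PlanarTree.le_iff, twoTree_lt])

instance : DecidableRel cherryTree.edge := fun a b => inferInstanceAs (Decidable (a = 0 ∧ b ≠ 0))

instance : DecidableRel cherryTree.left := fun a b => inferInstanceAs (Decidable (a = 2 ∧ b = 1))

instance : DecidableRel cherryTree.le := fun a b =>
  decidable_of_iff (a = b ∨ a = 0 ∧ b ≠ 0) (by rw [PlanarTree.le_iff, cherryTree_lt])

instance : DecidableRel forkTree.edge := fun a b =>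
  inferInstanceAs (Decidable (a = 0 ∧ (b = 1 ∨ b = 2) ∨ a = 2 ∧ b = 3))

instance : DecidableRel forkTree.left := fun a b =>
  inferInstanceAs (Decidable ((a = 2 ∨ a = 3) ∧ b = 1))

instance : DecidableRel forkTree.le := fun a b =>
  decidable_of_iff (a = b ∨ (a = 0 ∧ b ≠ 0 ∨ a = 2 ∧ b = 3))
    (by rw [PlanarTree.le_iff, forkTree_lt])

section Eval

variable {k : Type*} [CommRing k] {C : Type u} [Category.{v} C] {A : AlgDiagram.{w} k C}

/-! ### Cochains of shifted total degree one as functions -/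

namespace DegreeOne

variable (F : DegreeOne A)

/-- The bilinear map given by the component of bidegree `(0, 2)`. -/
noncomputable def mulVal (x : C) (a b : A.obj x) : A.obj x :=
  (F.f (ComposableArrows.mk₀ (Opposite.op x)) :
    MultilinearMap k (fun _ : Fin 2 => A.obj x) (A.obj x)) ![a, b]

/-- The linear map given by the component of bidegree `(1, 1)`. -/
noncomputable def mapVal {x y : C} (φ : x ⟶ y) (a : A.obj x) : A.obj y :=
  (F.g (ComposableArrows.mk₁ φ.op) : MultilinearMap k (fun _ : Fin 1 => A.obj x) (A.obj y))
    fun _ => a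

/-- The element given by the component of bidegree `(2, 0)`. -/
noncomputable def twistVal {x y z : C} (φ : x ⟶ y) (ψ : y ⟶ z) : A.obj z :=
  (F.h (ComposableArrows.mk₂ ψ.op φ.op) : MultilinearMap k (fun _ : Fin 0 => A.obj x) (A.obj z))
    Fin.elim0

theorem f_apply (Φ : Simplex C 0) (v : Fin 2 → A.obj (Φ.vertex (Fin.last 0))) :
    F.f Φ v = F.mulVal (Φ.vertex 0) (v 0) (v 1) := by
  obtain ⟨x, rfl⟩ := ComposableArrows.mk₀_surjective Φ
  unfold mulVal
  refine congrArg (F.f _) ?_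
  funext i
  fin_cases i <;> rfl

theorem g_apply (Φ : Simplex C 1) (v : Fin 1 → A.obj (Φ.vertex (Fin.last 1))) :
    F.g Φ v = F.mapVal (x := Φ.vertex 1) (y := Φ.vertex 0)
      (Φ.map (homOfLE (Fin.zero_le 1))).unop (v 0) := by
  obtain ⟨x, y, φ, rfl⟩ := ComposableArrows.mk₁_surjective Φ
  unfold mapVal
  refine congrArg (F.g _) ?_
  funext i
  fin_cases i
  rfl

theorem h_apply (Φ : Simplex C 2) (v : Fin 0 → A.obj (Φ.vertex (Fin.last 2))) :
    F.h Φ v = F.twistVal (x := Φ.vertex 2) (y := Φ.vertex 1) (z := Φ.vertex 0)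
      (Φ.map (homOfLE (by decide : (1 : Fin 3) ≤ 2))).unop
      (Φ.map (homOfLE (by decide : (0 : Fin 3) ≤ 1))).unop := by
  obtain ⟨x, y, z, φ, ψ, rfl⟩ := ComposableArrows.mk₂_surjective Φ
  unfold twistVal
  refine congrArg (F.h _) ?_
  funext i
  exact i.elim0

end DegreeOne

/-! ### Evaluation of compositions along trees -/

section Tree

variable {n : ℕ} {T : PlanarTree n} {p q : Fin n → ℕ} {p' : ℕ}
  (ζ : ∀ a, Fin (p a + 1) ↪o Fin (p' + 1)) (d : TreeColoring T q)
  (f : ∀ a, Cochain A (p a) (q a)) (Φ : Simplex C p')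
  (x : ℕ → A.obj (Φ.vertex (Fin.last p')))

open Classical in
/-- The `j`-th argument of the cochain at the vertex `a` in the composition along a tree. -/
noncomputable def evalInput (a : Fin n) (j : Fin (q a)) :
    A.obj (Φ.vertex (ζ a (Fin.last (p a)))) :=
  if h : ∃ b, ∃ e : T.edge a b, d.I a b e = j then
    A.along Φ (ζ a (Fin.last (p a))) (ζ h.choose 0) (evalVertex A ζ d f Φ x h.choose)
  else A.along Φ (ζ a (Fin.last (p a))) (Fin.last p') (x (d.position ⟨a, j⟩))

theorem evalVertex_eq (a : Fin n) :
    evalVertex A ζ d f Φ x a = f a (Φ.pull (ζ a)) (evalInput ζ d f Φ x a) := by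
  exact WellFounded.fix_eq _ _ a

theorem evalInput_of_edge {a b : Fin n} (e : T.edge a b) {j : Fin (q a)} (h : d.I a b e = j) :
    evalInput ζ d f Φ x a j =
      A.along Φ (ζ a (Fin.last (p a))) (ζ b 0) (evalVertex A ζ d f Φ x b) := by
  have h' : ∃ b, ∃ e : T.edge a b, d.I a b e = j := ⟨b, e, h⟩
  rw [evalInput, dif_pos h']
  obtain ⟨e', h''⟩ := h'.choose_spec
  exact congrArg (fun b => A.along Φ (ζ a (Fin.last (p a))) (ζ b 0) (evalVertex A ζ d f Φ x b))
    (d.I_injective e' e (h''.trans h.symm))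

theorem evalInput_of_isOpen {a : Fin n} {j : Fin (q a)} (h : d.IsOpen ⟨a, j⟩) :
    evalInput ζ d f Φ x a j =
      A.along Φ (ζ a (Fin.last (p a))) (Fin.last p') (x (d.position ⟨a, j⟩)) := by
  rw [evalInput, dif_neg h]

end Tree

theorem AlgDiagram.along_of_le {p : ℕ} (Φ : Simplex C p) {i l : Fin (p + 1)} (h : i ≤ l)
    (a : A.obj (Φ.vertex l)) : A.along Φ i l a = A.map (Φ.map (homOfLE h)).unop a := by
  rw [AlgDiagram.along, dif_pos h]
  rfl

theorem AlgDiagram.along_self {p : ℕ} (Φ : Simplex C p) (i : Fin (p + 1))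
    (a : A.obj (Φ.vertex i)) : A.along Φ i i a = a := by
  rw [AlgDiagram.along_of_le Φ le_rfl]
  have : Φ.map (homOfLE (le_refl i)) = 𝟙 _ := Φ.map_id i
  rw [this]
  exact A.map_id _ a

end Eval

/-! ### The colourings in shifted total degree one -/

namespace WordColoring

variable {n : ℕ} {W : List (Fin n)} {p : Fin n → ℕ} {p' : ℕ}

theorem eq_ofTable (c : WordColoring W p p') {z o : Fin n → ℕ → ℕ}
    (h : IsColoringTable W p p' z o) (hπ : ∀ a (i : Fin (p a + 1)), (c.π a i : ℕ) = o a i) :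
    c = ofTable z o h :=
  eq_of_π_eq (funext fun a => funext fun i => Fin.ext (hπ a i))

/-- A colouring is unique if the indices can be distributed onto the occurrences in only one way. -/
theorem eq_ofTable_of_forall {z o : Fin n → ℕ → ℕ} (h : IsColoringTable W p p' z o)
    (ho : ∀ a, ∀ f : Fin (p a + 1) → Fin W.length, Monotone f →
      (∀ t, (∃ i, f i = t) ↔ W.get t = a) → ∀ i : Fin (p a + 1), (f i : ℕ) = o a i)
    (c : WordColoring W p p') : c = ofTable z o h :=
  c.eq_ofTable h fun a i => ho a (c.π a) (c.π_monotone a) (c.occurrence a) i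

/-- There are at most two colourings if the indices of all vertices but one can be distributed onto
the occurrences in only one way, and those of the exceptional vertex `s` in two ways. -/
theorem eq_ofTable_or_of_forall {z o z' o' : Fin n → ℕ → ℕ} (h : IsColoringTable W p p' z o)
    (h' : IsColoringTable W p p' z' o') (s : Fin n)
    (ho : ∀ a, ∀ f : Fin (p a + 1) → Fin W.length, Monotone f →
      (∀ t, (∃ i, f i = t) ↔ W.get t = a) →
        (∀ i : Fin (p a + 1), (f i : ℕ) = o a i) ∧
          (a ≠ s → ∀ i : Fin (p a + 1), (f i : ℕ) = o' a i) ∨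
        (∀ i : Fin (p a + 1), (f i : ℕ) = o' a i) ∧
          (a ≠ s → ∀ i : Fin (p a + 1), (f i : ℕ) = o a i))
    (c : WordColoring W p p') : c = ofTable z o h ∨ c = ofTable z' o' h' := by
  have key := fun a => ho a (c.π a) (c.π_monotone a) (c.occurrence a)
  rcases key s with hs | hs
  · refine Or.inl (c.eq_ofTable h fun a => ?_)
    by_cases ha : a = s
    · exact ha ▸ hs.1
    · exact (key a).elim (fun h => h.1) fun h => h.2 ha
  · refine Or.inr (c.eq_ofTable h' fun a => ?_)
    by_cases ha : a = s
    · exact ha ▸ hs.1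
    · exact (key a).elim (fun h => h.2 ha) fun h => h.1

end WordColoring

theorem twoTree_edge (r : Fin 2) : (twoTree r).edge r (r + 1) :=
  ⟨rfl, (by decide : ∀ r : Fin 2, r + 1 ≠ r) r⟩

theorem cherryTree_edge₁ : cherryTree.edge 0 1 := ⟨rfl, by decide⟩

theorem cherryTree_edge₂ : cherryTree.edge 0 2 := ⟨rfl, by decide⟩

theorem forkTree_edge₁ : forkTree.edge 0 1 := Or.inl ⟨rfl, Or.inl rfl⟩

theorem forkTree_edge₂ : forkTree.edge 0 2 := Or.inl ⟨rfl, Or.inr rfl⟩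

theorem forkTree_edge₃ : forkTree.edge 2 3 := Or.inr ⟨rfl, rfl⟩

/-- The colouring of a tree with two vertices that attaches the child to the input `j`. -/
def edgeColoring (r : Fin 2) {q : Fin 2 → ℕ} (j : Fin (q r)) : TreeColoring (twoTree r) q where
  I _ _ e := ⟨j, by rw [e.1]; exact j.2⟩
  mono _ _ _ _ _ h := h.elim

theorem exists_eq_edgeColoring {r : Fin 2} {q : Fin 2 → ℕ} (d : TreeColoring (twoTree r) q) :
    ∃ j, d = edgeColoring r j := by
  refine ⟨d.I r (r + 1) (twoTree_edge r), TreeColoring.ext ?_⟩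
  funext a b h
  obtain rfl : a = r := h.1
  obtain rfl : b = a + 1 := (by decide : ∀ a b : Fin 2, b ≠ a → b = a + 1) a b h.2
  rfl

theorem eq_edgeColoring_of_one {r : Fin 2} {q : Fin 2 → ℕ} (h : q r = 1)
    (d : TreeColoring (twoTree r) q) : d = edgeColoring r ⟨0, by omega⟩ := by
  obtain ⟨j, rfl⟩ := exists_eq_edgeColoring d
  exact congrArg _ (Fin.ext (by simp; omega))

theorem eq_edgeColoring_of_two {r : Fin 2} {q : Fin 2 → ℕ} (h : q r = 2)
    (d : TreeColoring (twoTree r) q) :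
    d = edgeColoring r ⟨0, by omega⟩ ∨ d = edgeColoring r ⟨1, by omega⟩ := by
  obtain ⟨j, rfl⟩ := exists_eq_edgeColoring d
  have : (j : ℕ) = 0 ∨ (j : ℕ) = 1 := by omega
  exact this.imp (fun h => congrArg _ (Fin.ext h)) fun h => congrArg _ (Fin.ext h)

theorem edgeColoring_ne {r : Fin 2} {q : Fin 2 → ℕ} (h : q r = 2) :
    edgeColoring r (⟨0, by omega⟩ : Fin (q r)) ≠ edgeColoring r ⟨1, by omega⟩ := fun e => by
  have := congrArg (fun d : TreeColoring (twoTree r) q => (d.I r (r + 1) (twoTree_edge r) : ℕ)) e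
  exact absurd this (by simp [edgeColoring])

/-- The colouring of the tree with edges `0 → 2`, `0 → 1`, when the root has two inputs. -/
def cherryColoring {q : Fin 3 → ℕ} (h : q 0 = 2) : TreeColoring cherryTree q where
  I a b e := ⟨if b = 2 then 0 else 1, by
    rw [e.1, h]
    split_ifs <;> simp⟩
  mono a b c hb hc h := by
    rw [Fin.lt_def]
    simp [h.1, h.2]

theorem eq_cherryColoring {q : Fin 3 → ℕ} (h : q 0 = 2) (d : TreeColoring cherryTree q) :
    d = cherryColoring h := by
  refine TreeColoring.ext ?_
  have hlt := d.mono 0 2 1 cherryTree_edge₂ cherryTree_edge₁ ⟨rfl, rfl⟩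
  rw [Fin.lt_def] at hlt
  have := (d.I 0 1 cherryTree_edge₁).2
  funext a b e
  refine Fin.ext ?_
  obtain ⟨rfl, hb⟩ := e
  obtain rfl | rfl : b = 1 ∨ b = 2 := by
    revert hb
    revert b
    decide
  · change (d.I 0 1 cherryTree_edge₁ : ℕ) = 1
    omega
  · change (d.I 0 2 cherryTree_edge₂ : ℕ) = 0
    omega

/-- The colouring of the tree with edges `0 → 2`, `2 → 3`, `0 → 1`, when the root has two inputs and
the vertex `2` has one. -/
def forkColoring {q : Fin 4 → ℕ} (h : q 0 = 2) (h' : q 2 = 1) : TreeColoring forkTree q where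
  I a b e := ⟨if b = 1 then 1 else 0, by
    rcases e with ⟨rfl, -⟩ | ⟨rfl, rfl⟩
    · rw [h]
      split_ifs <;> simp
    · rw [h']
      simp⟩
  mono a b c hb hc h := by
    have : b ≠ 1 := by
      rintro rfl
      exact absurd h.1 (by decide)
    rw [Fin.lt_def]
    simp [h.2, this]

theorem eq_forkColoring {q : Fin 4 → ℕ} (h : q 0 = 2) (h' : q 2 = 1) (d : TreeColoring forkTree q) :
    d = forkColoring h h' := by
  refine TreeColoring.ext ?_
  have hlt := d.mono 0 2 1 forkTree_edge₂ forkTree_edge₁ ⟨Or.inl rfl, rfl⟩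
  rw [Fin.lt_def] at hlt
  have := (d.I 0 1 forkTree_edge₁).2
  have := (d.I 2 3 forkTree_edge₃).2
  funext a b e
  refine Fin.ext ?_
  rcases e with ⟨rfl, rfl | rfl⟩ | ⟨rfl, rfl⟩
  · change (d.I 0 1 forkTree_edge₁ : ℕ) = 1
    omega
  · change (d.I 0 2 forkTree_edge₂ : ℕ) = 0
    omega
  · change (d.I 2 3 forkTree_edge₃ : ℕ) = 0
    omega

/-! ### Explicit values of quilts -/

instance (r : Fin 2) : DecidableRel (twoQuilt r).tree.edge :=
  inferInstanceAs (DecidableRel (twoTree r).edge)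

instance (r : Fin 2) : DecidableRel (twoQuilt r).tree.left :=
  inferInstanceAs (DecidableRel (twoTree r).left)

instance (r : Fin 2) : DecidableRel (twoQuilt r).tree.le :=
  inferInstanceAs (DecidableRel (twoTree r).le)

instance : DecidableRel cherryQuilt.tree.edge := inferInstanceAs (DecidableRel cherryTree.edge)

instance : DecidableRel cherryQuilt.tree.left := inferInstanceAs (DecidableRel cherryTree.left)

instance : DecidableRel cherryQuilt.tree.le := inferInstanceAs (DecidableRel cherryTree.le)

instance : DecidableRel forkQuilt.tree.edge := inferInstanceAs (DecidableRel forkTree.edge)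

instance : DecidableRel forkQuilt.tree.left := inferInstanceAs (DecidableRel forkTree.left)

instance : DecidableRel forkQuilt.tree.le := inferInstanceAs (DecidableRel forkTree.le)

section Values

variable {k : Type*} [CommRing k] {C : Type u} [Category.{v} C] {A : AlgDiagram.{w} k C}

/-- The morphism `x_j → x_i` of a simplex `x₀ ← x₁ ← ... ← x_p`, for `i ≤ j`. -/
abbrev Simplex.hom {p : ℕ} (Φ : Simplex C p) (i j : Fin (p + 1)) (h : i ≤ j := by decide) :
    Φ.vertex j ⟶ Φ.vertex i :=
  (Φ.map (homOfLE h)).unop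

/-- The components of type `i` of cochains of total degree `2`. The type of a vertex is `0`, `1` or
`2` according to which of the components `f`, `g`, `h` is put there, and is also its number `p`. -/
abbrev components {n : ℕ} (F : Fin n → DegreeOne A) (i : Fin n → Fin 3) :
    ∀ a, Cochain A (i a) (2 - i a) := fun a => (F a).comp (i a)

/-- The operation of a quilt on the components of type `i` of cochains of total degree `2`. -/
noncomputable abbrev quiltTerm {n : ℕ} (Q : Quilt n) (F : Fin n → DegreeOne A) (i : Fin n → Fin 3)
    (p' q' : ℕ) : Values A p' q' :=
  quiltAction A Q (p := fun a => i a) (q := fun a => 2 - i a) (components F i) p' q'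

section Sum

variable {n : ℕ} {Q : Quilt n} {p q : Fin n → ℕ} {p' q' : ℕ} [DecidableRel Q.tree.edge]
  [DecidableRel Q.tree.left] [DecidableRel Q.tree.le] {f : ∀ a, Cochain A (p a) (q a)}
  {Φ : Simplex C p'} {x : Fin q' → A.obj (Φ.vertex (Fin.last p'))}

theorem quiltAction_of_unique (h : q' + n = 1 + ∑ a, q a) {c : WordColoring Q.word p p'}
    (hc : ∀ c', c' = c) {d : TreeColoring Q.tree q} (hd : ∀ d', d' = d) {m : ℕ}
    (hm : Q.inversions c d = m) :
    quiltAction A Q f p' q' Φ x = (-1 : ℤ) ^ m • act A c.ζ d f q' Φ x := by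
  have hs : (Finset.univ : Finset (WordColoring Q.word p p')) = {c} := by
    ext c'
    simp [hc c']
  have ht : (Finset.univ : Finset (TreeColoring Q.tree q)) = {d} := by
    ext d'
    simp [hd d']
  rw [quiltAction, if_pos h, hs, ht, Finset.sum_singleton, Finset.sum_singleton, Q.sign_eq, hm]
  rfl

theorem quiltAction_of_word_pair (h : q' + n = 1 + ∑ a, q a) {c₁ c₂ : WordColoring Q.word p p'}
    (hne : c₁ ≠ c₂) (hc : ∀ c', c' = c₁ ∨ c' = c₂) {d : TreeColoring Q.tree q} (hd : ∀ d', d' = d)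
    {m₁ m₂ : ℕ} (hm₁ : Q.inversions c₁ d = m₁) (hm₂ : Q.inversions c₂ d = m₂) :
    quiltAction A Q f p' q' Φ x =
      (-1 : ℤ) ^ m₁ • act A c₁.ζ d f q' Φ x + (-1 : ℤ) ^ m₂ • act A c₂.ζ d f q' Φ x := by
  classical
  have hs : (Finset.univ : Finset (WordColoring Q.word p p')) = {c₁, c₂} := by
    ext c'
    simp [hc c']
  have ht : (Finset.univ : Finset (TreeColoring Q.tree q)) = {d} := by
    ext d'
    simp [hd d']
  rw [quiltAction, if_pos h, hs, ht, Finset.sum_pair hne, Finset.sum_singleton,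
    Finset.sum_singleton, Q.sign_eq, Q.sign_eq, hm₁, hm₂]
  rfl

theorem quiltAction_of_tree_pair (h : q' + n = 1 + ∑ a, q a) {c : WordColoring Q.word p p'}
    (hc : ∀ c', c' = c) {d₁ d₂ : TreeColoring Q.tree q} (hne : d₁ ≠ d₂)
    (hd : ∀ d', d' = d₁ ∨ d' = d₂) {m₁ m₂ : ℕ} (hm₁ : Q.inversions c d₁ = m₁)
    (hm₂ : Q.inversions c d₂ = m₂) :
    quiltAction A Q f p' q' Φ x =
      (-1 : ℤ) ^ m₁ • act A c.ζ d₁ f q' Φ x + (-1 : ℤ) ^ m₂ • act A c.ζ d₂ f q' Φ x := by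
  classical
  have hs : (Finset.univ : Finset (WordColoring Q.word p p')) = {c} := by
    ext c'
    simp [hc c']
  have ht : (Finset.univ : Finset (TreeColoring Q.tree q)) = {d₁, d₂} := by
    ext d'
    simp [hd d']
  rw [quiltAction, if_pos h, hs, ht, Finset.sum_singleton, Finset.sum_pair hne, Q.sign_eq,
    Q.sign_eq, hm₁, hm₂]
  rfl

end Sum

section Act

variable {n : ℕ} {T : PlanarTree n} {p q : Fin n → ℕ} {p' q' : ℕ}
  (ζ : ∀ a, Fin (p a + 1) ↪o Fin (p' + 1)) (d : TreeColoring T q)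
  (f : ∀ a, Cochain A (p a) (q a)) (Φ : Simplex C p')
  (x : Fin q' → A.obj (Φ.vertex (Fin.last p')))

/-- Arguments of a cochain, extended by zero to a sequence. -/
abbrev extend (i : ℕ) : A.obj (Φ.vertex (Fin.last p')) := if h : i < q' then x ⟨i, h⟩ else 0

theorem act_eq {r : Fin n} (hr : ∀ a, ¬ T.lt a r) :
    act A ζ d f q' Φ x = A.along Φ 0 (ζ r 0) (evalVertex A ζ d f Φ (extend Φ x) r) := by
  obtain rfl := T.root_eq_of_le hr
  rfl

theorem evalInput_extend [DecidableRel T.edge] [DecidableRel T.left] [DecidableRel T.le] {a : Fin n}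
    {j : Fin (q a)} (h : d.IsOpen ⟨a, j⟩) {m : ℕ}
    (hm : (Finset.univ.filter fun t => d.IsOpen t ∧ d.InputLT t ⟨a, j⟩).card = m) (hm' : m < q') :
    evalInput ζ d f Φ (extend Φ x) a j =
      A.along Φ (ζ a (Fin.last (p a))) (Fin.last p') (x ⟨m, hm'⟩) := by
  rw [evalInput_of_isOpen ζ d f Φ _ h, d.position_eq, hm, extend, dif_pos hm']

end Act

end Values

section Terms

variable {k : Type*} [CommRing k] {C : Type u} [Category.{v} C] {A : AlgDiagram.{w} k C}

theorem twoTree_root (r a : Fin 2) : ¬ (twoTree r).lt a r := by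
  rw [twoTree_lt]
  exact fun h => h.2 rfl

theorem cherryTree_root (a : Fin 3) : ¬ cherryTree.lt a 0 := by
  rw [cherryTree_lt]
  exact fun h => h.2 rfl

theorem forkTree_root (a : Fin 4) : ¬ forkTree.lt a 0 := by
  rw [forkTree_lt]
  revert a
  decide

/-- The colouring of the word of `twoQuilt 0` when the vertices have the types `f`, `f`. -/
def edgeWord_zero_ff : WordColoring (twoQuilt 0).word (fun a => ((![0, 0] a : Fin 3) : ℕ)) 0 :=
  .ofTable (fun a i => (![[0], [0]] a).getD i 0)
    (fun a i => (![[0], [1]] a).getD i 0) (by decide +kernel)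

/-- There is one colouring of the word, and there are two of the tree, as the root has two inputs.
The values of the composition at the vertices are computed from the leaves to the root; this and the
following explicit values are obtained in the same way. -/
theorem twoQuilt_zero_ff (F : Fin 2 → DegreeOne A) (Φ : Simplex C 0)
    (x : Fin 3 → A.obj (Φ.vertex (Fin.last 0))) :
    quiltTerm (twoQuilt 0) F ![0, 0] 0 3 Φ x =
      -(F 0).mulVal (Φ.vertex 0) ((F 1).mulVal (Φ.vertex 0) (x 0) (x 1)) (x 2) +
        (F 0).mulVal (Φ.vertex 0) (x 0) ((F 1).mulVal (Φ.vertex 0) (x 1) (x 2)) := by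
  have hc : ∀ c, c = edgeWord_zero_ff := WordColoring.eq_ofTable_of_forall _ (by decide +kernel)
  refine (quiltAction_of_tree_pair (m₁ := 1) (m₂ := 0) (by decide) hc
    (edgeColoring_ne rfl) (eq_edgeColoring_of_two rfl) (by decide +kernel)
    (by decide +kernel)).trans ?_
  rw [Odd.neg_one_pow (by decide), neg_one_smul, Even.neg_one_pow (by decide), one_smul]
  refine congrArg₂ (· + ·) (congrArg Neg.neg ?_) ?_
  · let ev := evalVertex A edgeWord_zero_ff.ζ (edgeColoring 0 ⟨0, by decide⟩) (components F ![0, 0])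
      Φ (extend Φ x)
    have e₁ : ev 1 = (F 1).mulVal (Φ.vertex 0) (x 0) (x 1) :=
      (evalVertex_eq ..).trans ((DegreeOne.f_apply ..).trans (congrArg₂ _
        ((evalInput_extend (m := 0) (h := by decide +kernel) (hm := by decide +kernel)
          (hm' := by decide) ..).trans
          (A.along_self Φ 0 _))
        ((evalInput_extend (m := 1) (h := by decide +kernel) (hm := by decide +kernel)
          (hm' := by decide) ..).trans
          (A.along_self Φ 0 _))))
    have e₀ : ev 0 = (F 0).mulVal (Φ.vertex 0) (ev 1) (x 2) :=
      (evalVertex_eq ..).trans ((DegreeOne.f_apply ..).trans (congrArg₂ _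
        ((evalInput_of_edge (b := 1) (e := twoTree_edge 0) (h := rfl) ..).trans
          (A.along_self Φ 0 _))
        ((evalInput_extend (m := 2) (h := by decide +kernel) (hm := by decide +kernel)
          (hm' := by decide) ..).trans
          (A.along_self Φ 0 _))))
    rw [e₁] at e₀
    exact (act_eq _ _ _ Φ x (twoTree_root 0)).trans ((A.along_self Φ 0 _).trans e₀)
  · let ev := evalVertex A edgeWord_zero_ff.ζ (edgeColoring 0 ⟨1, by decide⟩) (components F ![0, 0])
      Φ (extend Φ x)
    have e₁ : ev 1 = (F 1).mulVal (Φ.vertex 0) (x 1) (x 2) :=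
      (evalVertex_eq ..).trans ((DegreeOne.f_apply ..).trans (congrArg₂ _
        ((evalInput_extend (m := 1) (h := by decide +kernel) (hm := by decide +kernel)
          (hm' := by decide) ..).trans
          (A.along_self Φ 0 _))
        ((evalInput_extend (m := 2) (h := by decide +kernel) (hm := by decide +kernel)
          (hm' := by decide) ..).trans
          (A.along_self Φ 0 _))))
    have e₀ : ev 0 = (F 0).mulVal (Φ.vertex 0) (x 0) (ev 1) :=
      (evalVertex_eq ..).trans ((DegreeOne.f_apply ..).trans (congrArg₂ _
        ((evalInput_extend (m := 0) (h := by decide +kernel) (hm := by decide +kernel)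
          (hm' := by decide) ..).trans
          (A.along_self Φ 0 _))
        ((evalInput_of_edge (b := 1) (e := twoTree_edge 0) (h := rfl) ..).trans
          (A.along_self Φ 0 _))))
    rw [e₁] at e₀
    exact (act_eq _ _ _ Φ x (twoTree_root 0)).trans ((A.along_self Φ 0 _).trans e₀)

/-- The colouring of the word of `twoQuilt 0` when the vertices have the types `f`, `g`. -/
def edgeWord_zero_fg : WordColoring (twoQuilt 0).word (fun a => ((![0, 1] a : Fin 3) : ℕ)) 1 :=
  .ofTable (fun a i => (![[0], [0, 1]] a).getD i 0)
    (fun a i => (![[0], [1, 1]] a).getD i 0) (by decide +kernel)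

theorem twoQuilt_zero_fg (F : Fin 2 → DegreeOne A) (Φ : Simplex C 1)
    (x : Fin 2 → A.obj (Φ.vertex (Fin.last 1))) :
    quiltTerm (twoQuilt 0) F ![0, 1] 1 2 Φ x =
      -(F 0).mulVal (Φ.vertex 0) ((F 1).mapVal (Φ.hom 0 1) (x 0)) (A.map (Φ.hom 0 1) (x 1)) +
        -(F 0).mulVal (Φ.vertex 0) (A.map (Φ.hom 0 1) (x 0)) ((F 1).mapVal (Φ.hom 0 1) (x 1)) := by
  have hc : ∀ c, c = edgeWord_zero_fg := WordColoring.eq_ofTable_of_forall _ (by decide +kernel)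
  refine (quiltAction_of_tree_pair (m₁ := 1) (m₂ := 1) (by decide) hc
    (edgeColoring_ne rfl) (eq_edgeColoring_of_two rfl) (by decide +kernel)
    (by decide +kernel)).trans ?_
  rw [Odd.neg_one_pow (by decide), neg_one_smul, neg_one_smul]
  refine congrArg₂ (· + ·) (congrArg Neg.neg ?_) (congrArg Neg.neg ?_)
  · let ev := evalVertex A edgeWord_zero_fg.ζ (edgeColoring 0 ⟨0, by decide⟩) (components F ![0, 1])
      Φ (extend Φ x)
    have e₁ : ev 1 = (F 1).mapVal (Φ.hom 0 1) (x 0) :=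
      (evalVertex_eq ..).trans ((DegreeOne.g_apply ..).trans (congrArg _
        ((evalInput_extend (m := 0) (h := by decide +kernel) (hm := by decide +kernel)
          (hm' := by decide) ..).trans
          (A.along_self Φ 1 _))))
    have e₀ : ev 0 = (F 0).mulVal (Φ.vertex 0) (ev 1) (A.map (Φ.hom 0 1) (x 1)) :=
      (evalVertex_eq ..).trans ((DegreeOne.f_apply ..).trans (congrArg₂ _
        ((evalInput_of_edge (b := 1) (e := twoTree_edge 0) (h := rfl) ..).trans
          (A.along_self Φ 0 _))
        ((evalInput_extend (m := 1) (h := by decide +kernel) (hm := by decide +kernel)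
          (hm' := by decide) ..).trans
          (A.along_of_le Φ (by decide) _))))
    rw [e₁] at e₀
    exact (act_eq _ _ _ Φ x (twoTree_root 0)).trans ((A.along_self Φ 0 _).trans e₀)
  · let ev := evalVertex A edgeWord_zero_fg.ζ (edgeColoring 0 ⟨1, by decide⟩) (components F ![0, 1])
      Φ (extend Φ x)
    have e₁ : ev 1 = (F 1).mapVal (Φ.hom 0 1) (x 1) :=
      (evalVertex_eq ..).trans ((DegreeOne.g_apply ..).trans (congrArg _
        ((evalInput_extend (m := 1) (h := by decide +kernel) (hm := by decide +kernel)
          (hm' := by decide) ..).trans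
          (A.along_self Φ 1 _))))
    have e₀ : ev 0 = (F 0).mulVal (Φ.vertex 0) (A.map (Φ.hom 0 1) (x 0)) (ev 1) :=
      (evalVertex_eq ..).trans ((DegreeOne.f_apply ..).trans (congrArg₂ _
        ((evalInput_extend (m := 0) (h := by decide +kernel) (hm := by decide +kernel)
          (hm' := by decide) ..).trans
          (A.along_of_le Φ (by decide) _))
        ((evalInput_of_edge (b := 1) (e := twoTree_edge 0) (h := rfl) ..).trans
          (A.along_self Φ 0 _))))
    rw [e₁] at e₀
    exact (act_eq _ _ _ Φ x (twoTree_root 0)).trans ((A.along_self Φ 0 _).trans e₀)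

/-- The colouring of the word of `twoQuilt 0` when the vertices have the types `g`, `f`. -/
def edgeWord_zero_gf : WordColoring (twoQuilt 0).word (fun a => ((![1, 0] a : Fin 3) : ℕ)) 1 :=
  .ofTable (fun a i => (![[0, 1], [1]] a).getD i 0)
    (fun a i => (![[0, 0], [1]] a).getD i 0) (by decide +kernel)

theorem twoQuilt_zero_gf (F : Fin 2 → DegreeOne A) (Φ : Simplex C 1)
    (x : Fin 2 → A.obj (Φ.vertex (Fin.last 1))) :
    quiltTerm (twoQuilt 0) F ![1, 0] 1 2 Φ x =
      (F 0).mapVal (Φ.hom 0 1) ((F 1).mulVal (Φ.vertex 1) (x 0) (x 1)) := by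
  have hc : ∀ c, c = edgeWord_zero_gf := WordColoring.eq_ofTable_of_forall _ (by decide +kernel)
  refine (quiltAction_of_unique (m := 0) (by decide) hc (eq_edgeColoring_of_one rfl)
    (by decide +kernel)).trans ?_
  rw [Even.neg_one_pow (by decide), one_smul]
  let ev := evalVertex A edgeWord_zero_gf.ζ (edgeColoring 0 ⟨0, by decide⟩) (components F ![1, 0])
    Φ (extend Φ x)
  have e₁ : ev 1 = (F 1).mulVal (Φ.vertex 1) (x 0) (x 1) :=
    (evalVertex_eq ..).trans ((DegreeOne.f_apply ..).trans (congrArg₂ _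
      ((evalInput_extend (m := 0) (h := by decide +kernel) (hm := by decide +kernel)
        (hm' := by decide) ..).trans
        (A.along_self Φ 1 _))
      ((evalInput_extend (m := 1) (h := by decide +kernel) (hm := by decide +kernel)
        (hm' := by decide) ..).trans
        (A.along_self Φ 1 _))))
  have e₀ : ev 0 = (F 0).mapVal (Φ.hom 0 1) (ev 1) :=
    (evalVertex_eq ..).trans ((DegreeOne.g_apply ..).trans (congrArg _
      ((evalInput_of_edge (b := 1) (e := twoTree_edge 0) (h := rfl) ..).trans
        (A.along_self Φ 1 _))))
  rw [e₁] at e₀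
  exact (act_eq _ _ _ Φ x (twoTree_root 0)).trans ((A.along_self Φ 0 _).trans e₀)

/-- The colouring of the word of `twoQuilt 0` when the vertices have the types `f`, `h`. -/
def edgeWord_zero_fh : WordColoring (twoQuilt 0).word (fun a => ((![0, 2] a : Fin 3) : ℕ)) 2 :=
  .ofTable (fun a i => (![[0], [0, 1, 2]] a).getD i 0)
    (fun a i => (![[0], [1, 1, 1]] a).getD i 0) (by decide +kernel)

theorem twoQuilt_zero_fh (F : Fin 2 → DegreeOne A) (Φ : Simplex C 2)
    (x : Fin 1 → A.obj (Φ.vertex (Fin.last 2))) :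
    quiltTerm (twoQuilt 0) F ![0, 2] 2 1 Φ x =
      -(F 0).mulVal (Φ.vertex 0) ((F 1).twistVal (Φ.hom 1 2) (Φ.hom 0 1))
        (A.map (Φ.hom 0 2) (x 0)) +
        (F 0).mulVal (Φ.vertex 0) (A.map (Φ.hom 0 2) (x 0))
          ((F 1).twistVal (Φ.hom 1 2) (Φ.hom 0 1)) := by
  have hc : ∀ c, c = edgeWord_zero_fh := WordColoring.eq_ofTable_of_forall _ (by decide +kernel)
  refine (quiltAction_of_tree_pair (m₁ := 3) (m₂ := 2) (by decide) hc
    (edgeColoring_ne rfl) (eq_edgeColoring_of_two rfl) (by decide +kernel)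
    (by decide +kernel)).trans ?_
  rw [Odd.neg_one_pow (by decide), neg_one_smul, Even.neg_one_pow (by decide), one_smul]
  refine congrArg₂ (· + ·) (congrArg Neg.neg ?_) ?_
  · let ev := evalVertex A edgeWord_zero_fh.ζ (edgeColoring 0 ⟨0, by decide⟩) (components F ![0, 2])
      Φ (extend Φ x)
    have e₁ : ev 1 = (F 1).twistVal (Φ.hom 1 2) (Φ.hom 0 1) :=
      (evalVertex_eq ..).trans (DegreeOne.h_apply ..)
    have e₀ : ev 0 = (F 0).mulVal (Φ.vertex 0) (ev 1) (A.map (Φ.hom 0 2) (x 0)) :=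
      (evalVertex_eq ..).trans ((DegreeOne.f_apply ..).trans (congrArg₂ _
        ((evalInput_of_edge (b := 1) (e := twoTree_edge 0) (h := rfl) ..).trans
          (A.along_self Φ 0 _))
        ((evalInput_extend (m := 0) (h := by decide +kernel) (hm := by decide +kernel)
          (hm' := by decide) ..).trans
          (A.along_of_le Φ (by decide) _))))
    rw [e₁] at e₀
    exact (act_eq _ _ _ Φ x (twoTree_root 0)).trans ((A.along_self Φ 0 _).trans e₀)
  · let ev := evalVertex A edgeWord_zero_fh.ζ (edgeColoring 0 ⟨1, by decide⟩) (components F ![0, 2])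
      Φ (extend Φ x)
    have e₁ : ev 1 = (F 1).twistVal (Φ.hom 1 2) (Φ.hom 0 1) :=
      (evalVertex_eq ..).trans (DegreeOne.h_apply ..)
    have e₀ : ev 0 = (F 0).mulVal (Φ.vertex 0) (A.map (Φ.hom 0 2) (x 0)) (ev 1) :=
      (evalVertex_eq ..).trans ((DegreeOne.f_apply ..).trans (congrArg₂ _
        ((evalInput_extend (m := 0) (h := by decide +kernel) (hm := by decide +kernel)
          (hm' := by decide) ..).trans
          (A.along_of_le Φ (by decide) _))
        ((evalInput_of_edge (b := 1) (e := twoTree_edge 0) (h := rfl) ..).trans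
          (A.along_self Φ 0 _))))
    rw [e₁] at e₀
    exact (act_eq _ _ _ Φ x (twoTree_root 0)).trans ((A.along_self Φ 0 _).trans e₀)

/-- The colouring of the word of `twoQuilt 0` when the vertices have the types `g`, `g`. -/
def edgeWord_zero_gg : WordColoring (twoQuilt 0).word (fun a => ((![1, 1] a : Fin 3) : ℕ)) 2 :=
  .ofTable (fun a i => (![[0, 1], [1, 2]] a).getD i 0)
    (fun a i => (![[0, 0], [1, 1]] a).getD i 0) (by decide +kernel)

theorem twoQuilt_zero_gg (F : Fin 2 → DegreeOne A) (Φ : Simplex C 2)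
    (x : Fin 1 → A.obj (Φ.vertex (Fin.last 2))) :
    quiltTerm (twoQuilt 0) F ![1, 1] 2 1 Φ x =
      (F 0).mapVal (Φ.hom 0 1) ((F 1).mapVal (Φ.hom 1 2) (x 0)) := by
  have hc : ∀ c, c = edgeWord_zero_gg := WordColoring.eq_ofTable_of_forall _ (by decide +kernel)
  refine (quiltAction_of_unique (m := 0) (by decide) hc (eq_edgeColoring_of_one rfl)
    (by decide +kernel)).trans ?_
  rw [Even.neg_one_pow (by decide), one_smul]
  let ev := evalVertex A edgeWord_zero_gg.ζ (edgeColoring 0 ⟨0, by decide⟩) (components F ![1, 1])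
    Φ (extend Φ x)
  have e₁ : ev 1 = (F 1).mapVal (Φ.hom 1 2) (x 0) :=
    (evalVertex_eq ..).trans ((DegreeOne.g_apply ..).trans (congrArg _
      ((evalInput_extend (m := 0) (h := by decide +kernel) (hm := by decide +kernel)
        (hm' := by decide) ..).trans
        (A.along_self Φ 2 _))))
  have e₀ : ev 0 = (F 0).mapVal (Φ.hom 0 1) (ev 1) :=
    (evalVertex_eq ..).trans ((DegreeOne.g_apply ..).trans (congrArg _
      ((evalInput_of_edge (b := 1) (e := twoTree_edge 0) (h := rfl) ..).trans
        (A.along_self Φ 1 _))))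
  rw [e₁] at e₀
  exact (act_eq _ _ _ Φ x (twoTree_root 0)).trans ((A.along_self Φ 0 _).trans e₀)

/-- The colouring of the word of `twoQuilt 0` when the vertices have the types `g`, `h`. -/
def edgeWord_zero_gh : WordColoring (twoQuilt 0).word (fun a => ((![1, 2] a : Fin 3) : ℕ)) 3 :=
  .ofTable (fun a i => (![[0, 1], [1, 2, 3]] a).getD i 0)
    (fun a i => (![[0, 0], [1, 1, 1]] a).getD i 0) (by decide +kernel)

theorem twoQuilt_zero_gh (F : Fin 2 → DegreeOne A) (Φ : Simplex C 3)
    (x : Fin 0 → A.obj (Φ.vertex (Fin.last 3))) :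
    quiltTerm (twoQuilt 0) F ![1, 2] 3 0 Φ x =
      (F 0).mapVal (Φ.hom 0 1) ((F 1).twistVal (Φ.hom 2 3) (Φ.hom 1 2)) := by
  have hc : ∀ c, c = edgeWord_zero_gh := WordColoring.eq_ofTable_of_forall _ (by decide +kernel)
  refine (quiltAction_of_unique (m := 0) (by decide) hc (eq_edgeColoring_of_one rfl)
    (by decide +kernel)).trans ?_
  rw [Even.neg_one_pow (by decide), one_smul]
  let ev := evalVertex A edgeWord_zero_gh.ζ (edgeColoring 0 ⟨0, by decide⟩) (components F ![1, 2])
    Φ (extend Φ x)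
  have e₁ : ev 1 = (F 1).twistVal (Φ.hom 2 3) (Φ.hom 1 2) :=
    (evalVertex_eq ..).trans (DegreeOne.h_apply ..)
  have e₀ : ev 0 = (F 0).mapVal (Φ.hom 0 1) (ev 1) :=
    (evalVertex_eq ..).trans ((DegreeOne.g_apply ..).trans (congrArg _
      ((evalInput_of_edge (b := 1) (e := twoTree_edge 0) (h := rfl) ..).trans
        (A.along_self Φ 1 _))))
  rw [e₁] at e₀
  exact (act_eq _ _ _ Φ x (twoTree_root 0)).trans ((A.along_self Φ 0 _).trans e₀)

/-- The colouring of the word of `twoQuilt 1` when the vertices have the types `f`, `f`. -/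
def edgeWord_one_ff : WordColoring (twoQuilt 1).word (fun a => ((![0, 0] a : Fin 3) : ℕ)) 0 :=
  .ofTable (fun a i => (![[0], [0]] a).getD i 0)
    (fun a i => (![[1], [0]] a).getD i 0) (by decide +kernel)

theorem twoQuilt_one_ff (F : Fin 2 → DegreeOne A) (Φ : Simplex C 0)
    (x : Fin 3 → A.obj (Φ.vertex (Fin.last 0))) :
    quiltTerm (twoQuilt 1) F ![0, 0] 0 3 Φ x =
      (F 1).mulVal (Φ.vertex 0) ((F 0).mulVal (Φ.vertex 0) (x 0) (x 1)) (x 2) +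
        -(F 1).mulVal (Φ.vertex 0) (x 0) ((F 0).mulVal (Φ.vertex 0) (x 1) (x 2)) := by
  have hc : ∀ c, c = edgeWord_one_ff := WordColoring.eq_ofTable_of_forall _ (by decide +kernel)
  refine (quiltAction_of_tree_pair (m₁ := 0) (m₂ := 1) (by decide) hc
    (edgeColoring_ne rfl) (eq_edgeColoring_of_two rfl) (by decide +kernel)
    (by decide +kernel)).trans ?_
  rw [Even.neg_one_pow (by decide), one_smul, Odd.neg_one_pow (by decide), neg_one_smul]
  refine congrArg₂ (· + ·) ?_ (congrArg Neg.neg ?_)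
  · let ev := evalVertex A edgeWord_one_ff.ζ (edgeColoring 1 ⟨0, by decide⟩) (components F ![0, 0])
      Φ (extend Φ x)
    have e₀ : ev 0 = (F 0).mulVal (Φ.vertex 0) (x 0) (x 1) :=
      (evalVertex_eq ..).trans ((DegreeOne.f_apply ..).trans (congrArg₂ _
        ((evalInput_extend (m := 0) (h := by decide +kernel) (hm := by decide +kernel)
          (hm' := by decide) ..).trans
          (A.along_self Φ 0 _))
        ((evalInput_extend (m := 1) (h := by decide +kernel) (hm := by decide +kernel)
          (hm' := by decide) ..).trans
          (A.along_self Φ 0 _))))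
    have e₁ : ev 1 = (F 1).mulVal (Φ.vertex 0) (ev 0) (x 2) :=
      (evalVertex_eq ..).trans ((DegreeOne.f_apply ..).trans (congrArg₂ _
        ((evalInput_of_edge (b := 0) (e := twoTree_edge 1) (h := rfl) ..).trans
          (A.along_self Φ 0 _))
        ((evalInput_extend (m := 2) (h := by decide +kernel) (hm := by decide +kernel)
          (hm' := by decide) ..).trans
          (A.along_self Φ 0 _))))
    rw [e₀] at e₁
    exact (act_eq _ _ _ Φ x (twoTree_root 1)).trans ((A.along_self Φ 0 _).trans e₁)
  · let ev := evalVertex A edgeWord_one_ff.ζ (edgeColoring 1 ⟨1, by decide⟩) (components F ![0, 0])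
      Φ (extend Φ x)
    have e₀ : ev 0 = (F 0).mulVal (Φ.vertex 0) (x 1) (x 2) :=
      (evalVertex_eq ..).trans ((DegreeOne.f_apply ..).trans (congrArg₂ _
        ((evalInput_extend (m := 1) (h := by decide +kernel) (hm := by decide +kernel)
          (hm' := by decide) ..).trans
          (A.along_self Φ 0 _))
        ((evalInput_extend (m := 2) (h := by decide +kernel) (hm := by decide +kernel)
          (hm' := by decide) ..).trans
          (A.along_self Φ 0 _))))
    have e₁ : ev 1 = (F 1).mulVal (Φ.vertex 0) (x 0) (ev 0) :=
      (evalVertex_eq ..).trans ((DegreeOne.f_apply ..).trans (congrArg₂ _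
        ((evalInput_extend (m := 0) (h := by decide +kernel) (hm := by decide +kernel)
          (hm' := by decide) ..).trans
          (A.along_self Φ 0 _))
        ((evalInput_of_edge (b := 0) (e := twoTree_edge 1) (h := rfl) ..).trans
          (A.along_self Φ 0 _))))
    rw [e₀] at e₁
    exact (act_eq _ _ _ Φ x (twoTree_root 1)).trans ((A.along_self Φ 0 _).trans e₁)

/-- The colouring of the word of `twoQuilt 1` when the vertices have the types `f`, `g`. -/
def edgeWord_one_fg : WordColoring (twoQuilt 1).word (fun a => ((![0, 1] a : Fin 3) : ℕ)) 1 :=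
  .ofTable (fun a i => (![[1], [0, 1]] a).getD i 0)
    (fun a i => (![[1], [0, 0]] a).getD i 0) (by decide +kernel)

theorem twoQuilt_one_fg (F : Fin 2 → DegreeOne A) (Φ : Simplex C 1)
    (x : Fin 2 → A.obj (Φ.vertex (Fin.last 1))) :
    quiltTerm (twoQuilt 1) F ![0, 1] 1 2 Φ x =
      -(F 1).mapVal (Φ.hom 0 1) ((F 0).mulVal (Φ.vertex 1) (x 0) (x 1)) := by
  have hc : ∀ c, c = edgeWord_one_fg := WordColoring.eq_ofTable_of_forall _ (by decide +kernel)
  refine (quiltAction_of_unique (m := 1) (by decide) hc (eq_edgeColoring_of_one rfl)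
    (by decide +kernel)).trans ?_
  rw [Odd.neg_one_pow (by decide), neg_one_smul, neg_inj]
  let ev := evalVertex A edgeWord_one_fg.ζ (edgeColoring 1 ⟨0, by decide⟩) (components F ![0, 1])
    Φ (extend Φ x)
  have e₀ : ev 0 = (F 0).mulVal (Φ.vertex 1) (x 0) (x 1) :=
    (evalVertex_eq ..).trans ((DegreeOne.f_apply ..).trans (congrArg₂ _
      ((evalInput_extend (m := 0) (h := by decide +kernel) (hm := by decide +kernel)
        (hm' := by decide) ..).trans
        (A.along_self Φ 1 _))
      ((evalInput_extend (m := 1) (h := by decide +kernel) (hm := by decide +kernel)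
        (hm' := by decide) ..).trans
        (A.along_self Φ 1 _))))
  have e₁ : ev 1 = (F 1).mapVal (Φ.hom 0 1) (ev 0) :=
    (evalVertex_eq ..).trans ((DegreeOne.g_apply ..).trans (congrArg _
      ((evalInput_of_edge (b := 0) (e := twoTree_edge 1) (h := rfl) ..).trans
        (A.along_self Φ 1 _))))
  rw [e₀] at e₁
  exact (act_eq _ _ _ Φ x (twoTree_root 1)).trans ((A.along_self Φ 0 _).trans e₁)

/-- The colouring of the word of `cherryQuilt` when the vertices have the types `f`, `g`, `g`. -/
def cherryWord_fgg : WordColoring cherryQuilt.word (fun a => ((![0, 1, 1] a : Fin 3) : ℕ)) 1 :=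
  .ofTable (fun a i => (![[0], [0, 1], [0, 1]] a).getD i 0)
    (fun a i => (![[0], [1, 3], [2, 2]] a).getD i 0) (by decide +kernel)

theorem cherryQuilt_fgg (F : Fin 3 → DegreeOne A) (Φ : Simplex C 1)
    (x : Fin 2 → A.obj (Φ.vertex (Fin.last 1))) :
    quiltTerm cherryQuilt F ![0, 1, 1] 1 2 Φ x =
      -(F 0).mulVal (Φ.vertex 0) ((F 2).mapVal (Φ.hom 0 1) (x 0))
        ((F 1).mapVal (Φ.hom 0 1) (x 1)) := by
  have hc : ∀ c, c = cherryWord_fgg := WordColoring.eq_ofTable_of_forall _ (by decide +kernel)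
  refine (quiltAction_of_unique (m := 3) (by decide) hc (eq_cherryColoring rfl)
    (by decide +kernel)).trans ?_
  rw [Odd.neg_one_pow (by decide), neg_one_smul, neg_inj]
  let ev := evalVertex A cherryWord_fgg.ζ (cherryColoring rfl) (components F ![0, 1, 1])
    Φ (extend Φ x)
  have e₂ : ev 2 = (F 2).mapVal (Φ.hom 0 1) (x 0) :=
    (evalVertex_eq ..).trans ((DegreeOne.g_apply ..).trans (congrArg _
      ((evalInput_extend (m := 0) (h := by decide +kernel) (hm := by decide +kernel)
        (hm' := by decide) ..).trans
        (A.along_self Φ 1 _))))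
  have e₁ : ev 1 = (F 1).mapVal (Φ.hom 0 1) (x 1) :=
    (evalVertex_eq ..).trans ((DegreeOne.g_apply ..).trans (congrArg _
      ((evalInput_extend (m := 1) (h := by decide +kernel) (hm := by decide +kernel)
        (hm' := by decide) ..).trans
        (A.along_self Φ 1 _))))
  have e₀ : ev 0 = (F 0).mulVal (Φ.vertex 0) (ev 2) (ev 1) :=
    (evalVertex_eq ..).trans ((DegreeOne.f_apply ..).trans (congrArg₂ _
      ((evalInput_of_edge (b := 2) (e := cherryTree_edge₂) (h := rfl) ..).trans
        (A.along_self Φ 0 _))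
      ((evalInput_of_edge (b := 1) (e := cherryTree_edge₁) (h := rfl) ..).trans
        (A.along_self Φ 0 _))))
  rw [e₁, e₂] at e₀
  exact (act_eq _ _ _ Φ x cherryTree_root).trans ((A.along_self Φ 0 _).trans e₀)

/-- The colouring of the word of `cherryQuilt` when the vertices have the types `f`, `g`, `h`. -/
def cherryWord_fgh : WordColoring cherryQuilt.word (fun a => ((![0, 1, 2] a : Fin 3) : ℕ)) 2 :=
  .ofTable (fun a i => (![[0], [0, 2], [0, 1, 2]] a).getD i 0)
    (fun a i => (![[0], [1, 3], [2, 2, 2]] a).getD i 0) (by decide +kernel)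

theorem cherryQuilt_fgh (F : Fin 3 → DegreeOne A) (Φ : Simplex C 2)
    (x : Fin 1 → A.obj (Φ.vertex (Fin.last 2))) :
    quiltTerm cherryQuilt F ![0, 1, 2] 2 1 Φ x =
      -(F 0).mulVal (Φ.vertex 0) ((F 2).twistVal (Φ.hom 1 2) (Φ.hom 0 1))
        ((F 1).mapVal (Φ.hom 0 2) (x 0)) := by
  have hc : ∀ c, c = cherryWord_fgh := WordColoring.eq_ofTable_of_forall _ (by decide +kernel)
  refine (quiltAction_of_unique (m := 5) (by decide) hc (eq_cherryColoring rfl)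
    (by decide +kernel)).trans ?_
  rw [Odd.neg_one_pow (by decide), neg_one_smul, neg_inj]
  let ev := evalVertex A cherryWord_fgh.ζ (cherryColoring rfl) (components F ![0, 1, 2])
    Φ (extend Φ x)
  have e₂ : ev 2 = (F 2).twistVal (Φ.hom 1 2) (Φ.hom 0 1) :=
    (evalVertex_eq ..).trans (DegreeOne.h_apply ..)
  have e₁ : ev 1 = (F 1).mapVal (Φ.hom 0 2) (x 0) :=
    (evalVertex_eq ..).trans ((DegreeOne.g_apply ..).trans (congrArg _
      ((evalInput_extend (m := 0) (h := by decide +kernel) (hm := by decide +kernel)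
        (hm' := by decide) ..).trans
        (A.along_self Φ 2 _))))
  have e₀ : ev 0 = (F 0).mulVal (Φ.vertex 0) (ev 2) (ev 1) :=
    (evalVertex_eq ..).trans ((DegreeOne.f_apply ..).trans (congrArg₂ _
      ((evalInput_of_edge (b := 2) (e := cherryTree_edge₂) (h := rfl) ..).trans
        (A.along_self Φ 0 _))
      ((evalInput_of_edge (b := 1) (e := cherryTree_edge₁) (h := rfl) ..).trans
        (A.along_self Φ 0 _))))
  rw [e₁, e₂] at e₀
  exact (act_eq _ _ _ Φ x cherryTree_root).trans ((A.along_self Φ 0 _).trans e₀)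

/-- The colouring of the word of `cherryQuilt` when the vertices have the types `f`, `h`, `g`, with
one index of the vertex `1` after the interposed vertex. -/
def cherryWord_fhg₁ : WordColoring cherryQuilt.word (fun a => ((![0, 2, 1] a : Fin 3) : ℕ)) 2 :=
  .ofTable (fun a i => (![[0], [0, 1, 2], [1, 2]] a).getD i 0)
    (fun a i => (![[0], [1, 1, 3], [2, 2]] a).getD i 0) (by decide +kernel)

/-- The colouring of the word of `cherryQuilt` when the vertices have the types `f`, `h`, `g`, with
two indices of the vertex `1` after the interposed vertex. -/
def cherryWord_fhg₂ : WordColoring cherryQuilt.word (fun a => ((![0, 2, 1] a : Fin 3) : ℕ)) 2 :=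
  .ofTable (fun a i => (![[0], [0, 1, 2], [0, 1]] a).getD i 0)
    (fun a i => (![[0], [1, 3, 3], [2, 2]] a).getD i 0) (by decide +kernel)

/-- Here the word has two colourings: of the three indices of the vertex `1`, either two or one come
before the interposed vertex. -/
theorem cherryQuilt_fhg (F : Fin 3 → DegreeOne A) (Φ : Simplex C 2)
    (x : Fin 1 → A.obj (Φ.vertex (Fin.last 2))) :
    quiltTerm cherryQuilt F ![0, 2, 1] 2 1 Φ x =
      (F 0).mulVal (Φ.vertex 0) (A.map (Φ.hom 0 1) ((F 2).mapVal (Φ.hom 1 2) (x 0)))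
        ((F 1).twistVal (Φ.hom 1 2) (Φ.hom 0 1)) +
        (F 0).mulVal (Φ.vertex 0) ((F 2).mapVal (Φ.hom 0 1) (A.map (Φ.hom 1 2) (x 0)))
          ((F 1).twistVal (Φ.hom 1 2) (Φ.hom 0 1)) := by
  have hc : ∀ c, c = cherryWord_fhg₁ ∨ c = cherryWord_fhg₂ :=
    WordColoring.eq_ofTable_or_of_forall _ _ 1 (by decide +kernel)
  have hne : cherryWord_fhg₁ ≠ cherryWord_fhg₂ := fun h => by
    have := congrArg (fun c => (c.π 1 ⟨1, by decide⟩ : ℕ)) h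
    exact absurd this (by decide +kernel)
  refine (quiltAction_of_word_pair (m₁ := 6) (m₂ := 6) (by decide) hne hc (eq_cherryColoring rfl)
    (by decide +kernel) (by decide +kernel)).trans ?_
  rw [Even.neg_one_pow (by decide), one_smul, one_smul]
  refine congrArg₂ (· + ·) ?_ ?_
  · let ev := evalVertex A cherryWord_fhg₁.ζ (cherryColoring rfl) (components F ![0, 2, 1])
      Φ (extend Φ x)
    have e₂ : ev 2 = (F 2).mapVal (Φ.hom 1 2) (x 0) :=
      (evalVertex_eq ..).trans ((DegreeOne.g_apply ..).trans (congrArg _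
        ((evalInput_extend (m := 0) (h := by decide +kernel) (hm := by decide +kernel)
          (hm' := by decide) ..).trans
          (A.along_self Φ 2 _))))
    have e₁ : ev 1 = (F 1).twistVal (Φ.hom 1 2) (Φ.hom 0 1) :=
      (evalVertex_eq ..).trans (DegreeOne.h_apply ..)
    have e₀ : ev 0 = (F 0).mulVal (Φ.vertex 0) (A.map (Φ.hom 0 1) (ev 2)) (ev 1) :=
      (evalVertex_eq ..).trans ((DegreeOne.f_apply ..).trans (congrArg₂ _
        ((evalInput_of_edge (b := 2) (e := cherryTree_edge₂) (h := rfl) ..).trans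
          (A.along_of_le Φ (by decide) _))
        ((evalInput_of_edge (b := 1) (e := cherryTree_edge₁) (h := rfl) ..).trans
          (A.along_self Φ 0 _))))
    rw [e₁, e₂] at e₀
    exact (act_eq _ _ _ Φ x cherryTree_root).trans ((A.along_self Φ 0 _).trans e₀)
  · let ev := evalVertex A cherryWord_fhg₂.ζ (cherryColoring rfl) (components F ![0, 2, 1])
      Φ (extend Φ x)
    have e₂ : ev 2 = (F 2).mapVal (Φ.hom 0 1) (A.map (Φ.hom 1 2) (x 0)) :=
      (evalVertex_eq ..).trans ((DegreeOne.g_apply ..).trans (congrArg _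
        ((evalInput_extend (m := 0) (h := by decide +kernel) (hm := by decide +kernel)
          (hm' := by decide) ..).trans
          (A.along_of_le Φ (by decide) _))))
    have e₁ : ev 1 = (F 1).twistVal (Φ.hom 1 2) (Φ.hom 0 1) :=
      (evalVertex_eq ..).trans (DegreeOne.h_apply ..)
    have e₀ : ev 0 = (F 0).mulVal (Φ.vertex 0) (ev 2) (ev 1) :=
      (evalVertex_eq ..).trans ((DegreeOne.f_apply ..).trans (congrArg₂ _
        ((evalInput_of_edge (b := 2) (e := cherryTree_edge₂) (h := rfl) ..).trans
          (A.along_self Φ 0 _))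
        ((evalInput_of_edge (b := 1) (e := cherryTree_edge₁) (h := rfl) ..).trans
          (A.along_self Φ 0 _))))
    rw [e₁, e₂] at e₀
    exact (act_eq _ _ _ Φ x cherryTree_root).trans ((A.along_self Φ 0 _).trans e₀)

/-- The colouring of the word of `cherryQuilt` when the vertices have the types `f`, `h`, `h`, with
one index of the vertex `1` after the interposed vertex. -/
def cherryWord_fhh₁ : WordColoring cherryQuilt.word (fun a => ((![0, 2, 2] a : Fin 3) : ℕ)) 3 :=
  .ofTable (fun a i => (![[0], [0, 1, 3], [1, 2, 3]] a).getD i 0)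
    (fun a i => (![[0], [1, 1, 3], [2, 2, 2]] a).getD i 0) (by decide +kernel)

/-- The colouring of the word of `cherryQuilt` when the vertices have the types `f`, `h`, `h`, with
two indices of the vertex `1` after the interposed vertex. -/
def cherryWord_fhh₂ : WordColoring cherryQuilt.word (fun a => ((![0, 2, 2] a : Fin 3) : ℕ)) 3 :=
  .ofTable (fun a i => (![[0], [0, 2, 3], [0, 1, 2]] a).getD i 0)
    (fun a i => (![[0], [1, 3, 3], [2, 2, 2]] a).getD i 0) (by decide +kernel)

/-- As for the types `f`, `h`, `g`, the word has two colourings. They have opposite signs. -/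
theorem cherryQuilt_fhh (F : Fin 3 → DegreeOne A) (Φ : Simplex C 3)
    (x : Fin 0 → A.obj (Φ.vertex (Fin.last 3))) :
    quiltTerm cherryQuilt F ![0, 2, 2] 3 0 Φ x =
      (F 0).mulVal (Φ.vertex 0) (A.map (Φ.hom 0 1) ((F 2).twistVal (Φ.hom 2 3) (Φ.hom 1 2)))
        ((F 1).twistVal (Φ.hom 1 3) (Φ.hom 0 1)) +
        -(F 0).mulVal (Φ.vertex 0) ((F 2).twistVal (Φ.hom 1 2) (Φ.hom 0 1))
          ((F 1).twistVal (Φ.hom 2 3) (Φ.hom 0 2)) := by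
  have hc : ∀ c, c = cherryWord_fhh₁ ∨ c = cherryWord_fhh₂ :=
    WordColoring.eq_ofTable_or_of_forall _ _ 1 (by decide +kernel)
  have hne : cherryWord_fhh₁ ≠ cherryWord_fhh₂ := fun h => by
    have := congrArg (fun c => (c.π 1 ⟨1, by decide⟩ : ℕ)) h
    exact absurd this (by decide +kernel)
  refine (quiltAction_of_word_pair (m₁ := 10) (m₂ := 11) (by decide) hne hc (eq_cherryColoring rfl)
    (by decide +kernel) (by decide +kernel)).trans ?_
  rw [Even.neg_one_pow (by decide), one_smul, Odd.neg_one_pow (by decide), neg_one_smul]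
  refine congrArg₂ (· + ·) ?_ (congrArg Neg.neg ?_)
  · let ev := evalVertex A cherryWord_fhh₁.ζ (cherryColoring rfl) (components F ![0, 2, 2])
      Φ (extend Φ x)
    have e₂ : ev 2 = (F 2).twistVal (Φ.hom 2 3) (Φ.hom 1 2) :=
      (evalVertex_eq ..).trans (DegreeOne.h_apply ..)
    have e₁ : ev 1 = (F 1).twistVal (Φ.hom 1 3) (Φ.hom 0 1) :=
      (evalVertex_eq ..).trans (DegreeOne.h_apply ..)
    have e₀ : ev 0 = (F 0).mulVal (Φ.vertex 0) (A.map (Φ.hom 0 1) (ev 2)) (ev 1) :=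
      (evalVertex_eq ..).trans ((DegreeOne.f_apply ..).trans (congrArg₂ _
        ((evalInput_of_edge (b := 2) (e := cherryTree_edge₂) (h := rfl) ..).trans
          (A.along_of_le Φ (by decide) _))
        ((evalInput_of_edge (b := 1) (e := cherryTree_edge₁) (h := rfl) ..).trans
          (A.along_self Φ 0 _))))
    rw [e₁, e₂] at e₀
    exact (act_eq _ _ _ Φ x cherryTree_root).trans ((A.along_self Φ 0 _).trans e₀)
  · let ev := evalVertex A cherryWord_fhh₂.ζ (cherryColoring rfl) (components F ![0, 2, 2])
      Φ (extend Φ x)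
    have e₂ : ev 2 = (F 2).twistVal (Φ.hom 1 2) (Φ.hom 0 1) :=
      (evalVertex_eq ..).trans (DegreeOne.h_apply ..)
    have e₁ : ev 1 = (F 1).twistVal (Φ.hom 2 3) (Φ.hom 0 2) :=
      (evalVertex_eq ..).trans (DegreeOne.h_apply ..)
    have e₀ : ev 0 = (F 0).mulVal (Φ.vertex 0) (ev 2) (ev 1) :=
      (evalVertex_eq ..).trans ((DegreeOne.f_apply ..).trans (congrArg₂ _
        ((evalInput_of_edge (b := 2) (e := cherryTree_edge₂) (h := rfl) ..).trans
          (A.along_self Φ 0 _))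
        ((evalInput_of_edge (b := 1) (e := cherryTree_edge₁) (h := rfl) ..).trans
          (A.along_self Φ 0 _))))
    rw [e₁, e₂] at e₀
    exact (act_eq _ _ _ Φ x cherryTree_root).trans ((A.along_self Φ 0 _).trans e₀)

/-- The colouring of the word of `forkQuilt` when the vertices have the types `f`, `h`, `g`, `g`. -/
def forkWord_fhgg : WordColoring forkQuilt.word (fun a => ((![0, 2, 1, 1] a : Fin 3) : ℕ)) 2 :=
  .ofTable (fun a i => (![[0], [0, 1, 2], [0, 1], [1, 2]] a).getD i 0)
    (fun a i => (![[0], [1, 3, 5], [2, 2], [4, 4]] a).getD i 0) (by decide +kernel)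

theorem forkQuilt_fhgg (F : Fin 4 → DegreeOne A) (Φ : Simplex C 2)
    (x : Fin 1 → A.obj (Φ.vertex (Fin.last 2))) :
    quiltTerm forkQuilt F ![0, 2, 1, 1] 2 1 Φ x =
      -(F 0).mulVal (Φ.vertex 0) ((F 2).mapVal (Φ.hom 0 1) ((F 3).mapVal (Φ.hom 1 2) (x 0)))
        ((F 1).twistVal (Φ.hom 1 2) (Φ.hom 0 1)) := by
  have hc : ∀ c, c = forkWord_fhgg := WordColoring.eq_ofTable_of_forall _ (by decide +kernel)
  refine (quiltAction_of_unique (m := 11) (by decide) hc (eq_forkColoring rfl rfl)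
    (by decide +kernel)).trans ?_
  rw [Odd.neg_one_pow (by decide), neg_one_smul, neg_inj]
  let ev := evalVertex A forkWord_fhgg.ζ (forkColoring rfl rfl) (components F ![0, 2, 1, 1])
    Φ (extend Φ x)
  have e₃ : ev 3 = (F 3).mapVal (Φ.hom 1 2) (x 0) :=
    (evalVertex_eq ..).trans ((DegreeOne.g_apply ..).trans (congrArg _
      ((evalInput_extend (m := 0) (h := by decide +kernel) (hm := by decide +kernel)
        (hm' := by decide) ..).trans
        (A.along_self Φ 2 _))))
  have e₂ : ev 2 = (F 2).mapVal (Φ.hom 0 1) (ev 3) :=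
    (evalVertex_eq ..).trans ((DegreeOne.g_apply ..).trans (congrArg _
      ((evalInput_of_edge (b := 3) (e := forkTree_edge₃) (h := rfl) ..).trans
        (A.along_self Φ 1 _))))
  have e₁ : ev 1 = (F 1).twistVal (Φ.hom 1 2) (Φ.hom 0 1) :=
    (evalVertex_eq ..).trans (DegreeOne.h_apply ..)
  have e₀ : ev 0 = (F 0).mulVal (Φ.vertex 0) (ev 2) (ev 1) :=
    (evalVertex_eq ..).trans ((DegreeOne.f_apply ..).trans (congrArg₂ _
      ((evalInput_of_edge (b := 2) (e := forkTree_edge₂) (h := rfl) ..).trans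
        (A.along_self Φ 0 _))
      ((evalInput_of_edge (b := 1) (e := forkTree_edge₁) (h := rfl) ..).trans
        (A.along_self Φ 0 _))))
  rw [e₁, e₂, e₃] at e₀
  exact (act_eq _ _ _ Φ x forkTree_root).trans ((A.along_self Φ 0 _).trans e₀)

/-- The colouring of the word of `forkQuilt` when the vertices have the types `f`, `h`, `g`, `h`. -/
def forkWord_fhgh : WordColoring forkQuilt.word (fun a => ((![0, 2, 1, 2] a : Fin 3) : ℕ)) 3 :=
  .ofTable (fun a i => (![[0], [0, 1, 3], [0, 1], [1, 2, 3]] a).getD i 0)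
    (fun a i => (![[0], [1, 3, 5], [2, 2], [4, 4, 4]] a).getD i 0) (by decide +kernel)

theorem forkQuilt_fhgh (F : Fin 4 → DegreeOne A) (Φ : Simplex C 3)
    (x : Fin 0 → A.obj (Φ.vertex (Fin.last 3))) :
    quiltTerm forkQuilt F ![0, 2, 1, 2] 3 0 Φ x =
      -(F 0).mulVal (Φ.vertex 0) ((F 2).mapVal (Φ.hom 0 1) ((F 3).twistVal (Φ.hom 2 3) (Φ.hom 1 2)))
        ((F 1).twistVal (Φ.hom 1 3) (Φ.hom 0 1)) := by
  have hc : ∀ c, c = forkWord_fhgh := WordColoring.eq_ofTable_of_forall _ (by decide +kernel)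
  refine (quiltAction_of_unique (m := 15) (by decide) hc (eq_forkColoring rfl rfl)
    (by decide +kernel)).trans ?_
  rw [Odd.neg_one_pow (by decide), neg_one_smul, neg_inj]
  let ev := evalVertex A forkWord_fhgh.ζ (forkColoring rfl rfl) (components F ![0, 2, 1, 2])
    Φ (extend Φ x)
  have e₃ : ev 3 = (F 3).twistVal (Φ.hom 2 3) (Φ.hom 1 2) :=
    (evalVertex_eq ..).trans (DegreeOne.h_apply ..)
  have e₂ : ev 2 = (F 2).mapVal (Φ.hom 0 1) (ev 3) :=
    (evalVertex_eq ..).trans ((DegreeOne.g_apply ..).trans (congrArg _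
      ((evalInput_of_edge (b := 3) (e := forkTree_edge₃) (h := rfl) ..).trans
        (A.along_self Φ 1 _))))
  have e₁ : ev 1 = (F 1).twistVal (Φ.hom 1 3) (Φ.hom 0 1) :=
    (evalVertex_eq ..).trans (DegreeOne.h_apply ..)
  have e₀ : ev 0 = (F 0).mulVal (Φ.vertex 0) (ev 2) (ev 1) :=
    (evalVertex_eq ..).trans ((DegreeOne.f_apply ..).trans (congrArg₂ _
      ((evalInput_of_edge (b := 2) (e := forkTree_edge₂) (h := rfl) ..).trans
        (A.along_self Φ 0 _))
      ((evalInput_of_edge (b := 1) (e := forkTree_edge₁) (h := rfl) ..).trans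
        (A.along_self Φ 0 _))))
  rw [e₁, e₂, e₃] at e₀
  exact (act_eq _ _ _ Φ x forkTree_root).trans ((A.along_self Φ 0 _).trans e₀)

end Terms

section Totals

variable {k : Type*} [CommRing k] {C : Type u} [Category.{v} C] {A : AlgDiagram.{w} k C}

/-! ### The total operations in shifted total degree one -/

/-- If the cochain at a vertex is zero, the composition vanishes at all ancestors of the vertex. -/
theorem evalVertex_eq_zero {n : ℕ} {T : PlanarTree n} {p q : Fin n → ℕ} {p' : ℕ}
    (ζ : ∀ a, Fin (p a + 1) ↪o Fin (p' + 1)) (d : TreeColoring T q)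
    (f : ∀ a, Cochain A (p a) (q a)) (Φ : Simplex C p')
    (x : ℕ → A.obj (Φ.vertex (Fin.last p'))) {a b : Fin n} (hb : f b = 0) (hab : T.le a b) :
    evalVertex A ζ d f Φ x a = 0 := by
  induction hab using Relation.ReflTransGen.head_induction_on with
  | refl =>
    rw [evalVertex_eq, hb]
    rfl
  | @head a c hac _ ih =>
    rw [evalVertex_eq]
    refine (f a (Φ.pull (ζ a))).map_coord_zero (d.I a c hac) ?_
    rw [evalInput_of_edge ζ d f Φ x hac rfl, ih, map_zero]
    rfl

theorem act_eq_zero {n : ℕ} {T : PlanarTree n} {p q : Fin n → ℕ} {p' q' : ℕ}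
    (ζ : ∀ a, Fin (p a + 1) ↪o Fin (p' + 1)) (d : TreeColoring T q)
    (f : ∀ a, Cochain A (p a) (q a)) {b : Fin n} (hb : f b = 0) :
    act A ζ d f q' = 0 := by
  funext Φ x
  exact (congrArg _ (evalVertex_eq_zero ζ d f Φ _ hb (T.root_le b))).trans (map_zero _)

/-- Only those types of the vertices contribute to the action of a quilt for which there are
colourings and the cochains have nonzero components. -/
theorem quiltActionTotal_eq_sum {n : ℕ} {Q : Quilt n} (F : Fin n → DegreeOne A) (p' q' : ℕ)
    (S : Finset (Fin n → Fin 3))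
    (hS : ∀ i : Fin n → Fin 3, q' + n = 1 + ∑ a, (2 - (i a : ℕ)) →
      WordColoring Q.word (fun a => i a) p' → TreeColoring Q.tree (fun a => 2 - (i a : ℕ)) →
      (∀ a, (F a).comp (i a) ≠ 0) → i ∈ S) :
    quiltActionTotal A Q F p' q' = ∑ i ∈ S, quiltTerm Q F i p' q' := by
  refine (Finset.sum_subset (Finset.subset_univ S) fun i _ hi => ?_).symm
  by_contra h
  have h₁ : q' + n = 1 + ∑ a, (2 - (i a : ℕ)) := by
    by_contra h'
    exact h (if_neg h')
  unfold quiltTerm quiltAction at h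
  rw [if_pos h₁] at h
  obtain ⟨c, -, h⟩ := Finset.exists_ne_zero_of_sum_ne_zero h
  obtain ⟨d, -, h⟩ := Finset.exists_ne_zero_of_sum_ne_zero h
  refine hi (hS i h₁ c d fun a ha => h ?_)
  rw [act_eq_zero c.ζ d (fun a => (F a).comp (i a)) ha, smul_zero]

theorem mulDegreeOne_comp_eq_zero {j : Fin 3} (hj : j ≠ 0) : (mulDegreeOne A).comp j = 0 := by
  fin_cases j
  · exact absurd rfl hj
  · rfl
  · rfl

/-- The root has a child, hence an input. -/
theorem twoQuilt_type {r : Fin 2} {i : Fin 2 → Fin 3}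
    (d : TreeColoring (twoQuilt r).tree (fun a => 2 - (i a : ℕ))) : i r ≠ 2 := by
  intro h
  have := TreeColoring.pos_of_edge d (twoTree_edge r)
  rw [h] at this
  exact absurd this (by decide)

/-- The root has two children, the vertex `1` occurs twice, and `2` is enclosed by `1`. -/
theorem cherryQuilt_type {p' : ℕ} {i : Fin 3 → Fin 3}
    (c : WordColoring cherryQuilt.word (fun a => i a) p')
    (d : TreeColoring cherryQuilt.tree (fun a => 2 - (i a : ℕ))) :
    i 0 = 0 ∧ i 1 ≠ 0 ∧ i 2 ≠ 0 := by
  have h₁ := d.mono 0 2 1 cherryTree_edge₂ cherryTree_edge₁ ⟨rfl, rfl⟩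
  rw [Fin.lt_def] at h₁
  have h₂ := (d.I 0 1 cherryTree_edge₁).2
  have h₃ := c.count_le 1
  rw [show cherryQuilt.word.count 1 = 2 from rfl] at h₃
  have h₄ := c.pos_of_infix (a := 1) (b := 2) ⟨[0], [], rfl⟩
  simp only [Fin.ext_iff, ne_eq, Fin.val_zero]
  omega

/-- The root has two children, the vertex `1` occurs three times, `2` has a child, and both `2` and
`3` are enclosed by `1`. -/
theorem forkQuilt_type {p' : ℕ} {i : Fin 4 → Fin 3}
    (c : WordColoring forkQuilt.word (fun a => i a) p')
    (d : TreeColoring forkQuilt.tree (fun a => 2 - (i a : ℕ))) :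
    i 0 = 0 ∧ i 1 = 2 ∧ i 2 = 1 ∧ i 3 ≠ 0 := by
  have h₁ := d.mono 0 2 1 forkTree_edge₂ forkTree_edge₁ ⟨Or.inl rfl, rfl⟩
  rw [Fin.lt_def] at h₁
  have h₂ := (d.I 0 1 forkTree_edge₁).2
  have h₃ := c.count_le 1
  rw [show forkQuilt.word.count 1 = 3 from rfl] at h₃
  have h₄ := c.pos_of_infix (a := 1) (b := 2) ⟨[0], [3, 1], rfl⟩
  have h₅ := c.pos_of_infix (a := 1) (b := 3) ⟨[0, 1, 2], [], rfl⟩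
  have h₆ := TreeColoring.pos_of_edge d forkTree_edge₃
  have h₇ := (i 1).2
  simp only [Fin.ext_iff, ne_eq, Fin.val_zero, Fin.val_one, Fin.val_two]
  omega

theorem twoQuilt_zero_total (F : Fin 2 → DegreeOne A) (p' q' : ℕ) {S : Finset (Fin 2 → Fin 3)}
    (hS : Finset.univ.filter (fun i : Fin 2 → Fin 3 =>
      q' + 2 = 1 + ∑ a, (2 - (i a : ℕ)) ∧ i 0 ≠ 2) = S) :
    quiltActionTotal A (twoQuilt 0) F p' q' = ∑ i ∈ S, quiltTerm (twoQuilt 0) F i p' q' :=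
  quiltActionTotal_eq_sum _ _ _ _ fun _ h _ d _ =>
    hS ▸ Finset.mem_filter.2 ⟨Finset.mem_univ _, h, twoQuilt_type d⟩

theorem twoQuilt_one_total (F : DegreeOne A) (p' q' : ℕ) {S : Finset (Fin 2 → Fin 3)}
    (hS : Finset.univ.filter (fun i : Fin 2 → Fin 3 =>
      q' + 2 = 1 + ∑ a, (2 - (i a : ℕ)) ∧ i 0 = 0 ∧ i 1 ≠ 2) = S) :
    quiltActionTotal A (twoQuilt 1) ![mulDegreeOne A, F] p' q' =
      ∑ i ∈ S, quiltTerm (twoQuilt 1) ![mulDegreeOne A, F] i p' q' :=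
  quiltActionTotal_eq_sum _ _ _ _ fun _ h _ d h' => hS ▸ Finset.mem_filter.2 ⟨Finset.mem_univ _, h,
    by_contra fun h0 => h' 0 (mulDegreeOne_comp_eq_zero h0), twoQuilt_type d⟩

theorem cherryQuilt_total (F : Fin 3 → DegreeOne A) (p' q' : ℕ) {S : Finset (Fin 3 → Fin 3)}
    (hS : Finset.univ.filter (fun i : Fin 3 → Fin 3 =>
      q' + 3 = 1 + ∑ a, (2 - (i a : ℕ)) ∧ i 0 = 0 ∧ i 1 ≠ 0 ∧ i 2 ≠ 0) = S) :
    quiltActionTotal A cherryQuilt F p' q' = ∑ i ∈ S, quiltTerm cherryQuilt F i p' q' :=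
  quiltActionTotal_eq_sum _ _ _ _ fun _ h c d _ =>
    hS ▸ Finset.mem_filter.2 ⟨Finset.mem_univ _, h, cherryQuilt_type c d⟩

theorem forkQuilt_total (F : Fin 4 → DegreeOne A) (p' q' : ℕ) {S : Finset (Fin 4 → Fin 3)}
    (hS : Finset.univ.filter (fun i : Fin 4 → Fin 3 =>
      q' + 4 = 1 + ∑ a, (2 - (i a : ℕ)) ∧ i 0 = 0 ∧ i 1 = 2 ∧ i 2 = 1 ∧ i 3 ≠ 0) = S) :
    quiltActionTotal A forkQuilt F p' q' = ∑ i ∈ S, quiltTerm forkQuilt F i p' q' :=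
  quiltActionTotal_eq_sum _ _ _ _ fun _ h c d _ =>
    hS ▸ Finset.mem_filter.2 ⟨Finset.mem_univ _, h, forkQuilt_type c d⟩

theorem twoQuilt_zero_total_03 (F : Fin 2 → DegreeOne A) :
    quiltActionTotal A (twoQuilt 0) F 0 3 = quiltTerm (twoQuilt 0) F ![0, 0] 0 3 := by
  rw [twoQuilt_zero_total F 0 3 (S := {![0, 0]}) (by decide +kernel), Finset.sum_singleton]

theorem twoQuilt_zero_total_12 (F : Fin 2 → DegreeOne A) :
    quiltActionTotal A (twoQuilt 0) F 1 2 =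
      quiltTerm (twoQuilt 0) F ![0, 1] 1 2 + quiltTerm (twoQuilt 0) F ![1, 0] 1 2 := by
  rw [twoQuilt_zero_total F 1 2 (S := {![0, 1], ![1, 0]}) (by decide +kernel),
    Finset.sum_pair (by decide)]

theorem twoQuilt_zero_total_21 (F : Fin 2 → DegreeOne A) :
    quiltActionTotal A (twoQuilt 0) F 2 1 =
      quiltTerm (twoQuilt 0) F ![0, 2] 2 1 + quiltTerm (twoQuilt 0) F ![1, 1] 2 1 := by
  rw [twoQuilt_zero_total F 2 1 (S := {![0, 2], ![1, 1]}) (by decide +kernel),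
    Finset.sum_pair (by decide)]

theorem twoQuilt_zero_total_30 (F : Fin 2 → DegreeOne A) :
    quiltActionTotal A (twoQuilt 0) F 3 0 = quiltTerm (twoQuilt 0) F ![1, 2] 3 0 := by
  rw [twoQuilt_zero_total F 3 0 (S := {![1, 2]}) (by decide +kernel), Finset.sum_singleton]

theorem twoQuilt_one_total_03 (F : DegreeOne A) :
    quiltActionTotal A (twoQuilt 1) ![mulDegreeOne A, F] 0 3 =
      quiltTerm (twoQuilt 1) ![mulDegreeOne A, F] ![0, 0] 0 3 := by
  rw [twoQuilt_one_total F 0 3 (S := {![0, 0]}) (by decide +kernel), Finset.sum_singleton]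

theorem twoQuilt_one_total_12 (F : DegreeOne A) :
    quiltActionTotal A (twoQuilt 1) ![mulDegreeOne A, F] 1 2 =
      quiltTerm (twoQuilt 1) ![mulDegreeOne A, F] ![0, 1] 1 2 := by
  rw [twoQuilt_one_total F 1 2 (S := {![0, 1]}) (by decide +kernel), Finset.sum_singleton]

theorem twoQuilt_one_total_21 (F : DegreeOne A) :
    quiltActionTotal A (twoQuilt 1) ![mulDegreeOne A, F] 2 1 = 0 := by
  rw [twoQuilt_one_total F 2 1 (S := ∅) (by decide +kernel), Finset.sum_empty]

theorem twoQuilt_one_total_30 (F : DegreeOne A) :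
    quiltActionTotal A (twoQuilt 1) ![mulDegreeOne A, F] 3 0 = 0 := by
  rw [twoQuilt_one_total F 3 0 (S := ∅) (by decide +kernel), Finset.sum_empty]

theorem cherryQuilt_total_03 (F : Fin 3 → DegreeOne A) :
    quiltActionTotal A cherryQuilt F 0 3 = 0 := by
  rw [cherryQuilt_total F 0 3 (S := ∅) (by decide +kernel), Finset.sum_empty]

theorem cherryQuilt_total_12 (F : Fin 3 → DegreeOne A) :
    quiltActionTotal A cherryQuilt F 1 2 = quiltTerm cherryQuilt F ![0, 1, 1] 1 2 := by
  rw [cherryQuilt_total F 1 2 (S := {![0, 1, 1]}) (by decide +kernel), Finset.sum_singleton]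

theorem cherryQuilt_total_21 (F : Fin 3 → DegreeOne A) :
    quiltActionTotal A cherryQuilt F 2 1 =
      quiltTerm cherryQuilt F ![0, 1, 2] 2 1 + quiltTerm cherryQuilt F ![0, 2, 1] 2 1 := by
  rw [cherryQuilt_total F 2 1 (S := {![0, 1, 2], ![0, 2, 1]}) (by decide +kernel),
    Finset.sum_pair (by decide)]

theorem cherryQuilt_total_30 (F : Fin 3 → DegreeOne A) :
    quiltActionTotal A cherryQuilt F 3 0 = quiltTerm cherryQuilt F ![0, 2, 2] 3 0 := by
  rw [cherryQuilt_total F 3 0 (S := {![0, 2, 2]}) (by decide +kernel), Finset.sum_singleton]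

theorem forkQuilt_total_03 (F : Fin 4 → DegreeOne A) :
    quiltActionTotal A forkQuilt F 0 3 = 0 := by
  rw [forkQuilt_total F 0 3 (S := ∅) (by decide +kernel), Finset.sum_empty]

theorem forkQuilt_total_12 (F : Fin 4 → DegreeOne A) :
    quiltActionTotal A forkQuilt F 1 2 = 0 := by
  rw [forkQuilt_total F 1 2 (S := ∅) (by decide +kernel), Finset.sum_empty]

theorem forkQuilt_total_21 (F : Fin 4 → DegreeOne A) :
    quiltActionTotal A forkQuilt F 2 1 = quiltTerm forkQuilt F ![0, 2, 1, 1] 2 1 := by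
  rw [forkQuilt_total F 2 1 (S := {![0, 2, 1, 1]}) (by decide +kernel), Finset.sum_singleton]

theorem forkQuilt_total_30 (F : Fin 4 → DegreeOne A) :
    quiltActionTotal A forkQuilt F 3 0 = quiltTerm forkQuilt F ![0, 2, 1, 2] 3 0 := by
  rw [forkQuilt_total F 3 0 (S := {![0, 2, 1, 2]}) (by decide +kernel), Finset.sum_singleton]

/-! ### The operations of the Maurer–Cartan series -/

theorem pZero_two (F : Fin 2 → DegreeOne A) (p' q' : ℕ) :
    pZero A 2 F p' q' = quiltActionTotal A (twoQuilt 0) F p' q' := by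
  have h : (Finset.univ : Finset (MaximalQuilt 2)) = {MaximalQuilt.edge} := by
    ext Q
    simp [Q.eq_edge]
  rw [pZero, h, Finset.sum_singleton, Even.neg_one_pow (by decide), one_smul]
  rfl

theorem pZero_three (F : Fin 3 → DegreeOne A) (p' q' : ℕ) :
    pZero A 3 F p' q' = quiltActionTotal A cherryQuilt F p' q' := by
  have h : (Finset.univ : Finset (MaximalQuilt 3)) = {MaximalQuilt.cherry} := by
    ext Q
    simp [Q.eq_cherry]
  rw [pZero, h, Finset.sum_singleton, Even.neg_one_pow (by decide), one_smul]
  rfl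

theorem pZero_four (F : Fin 4 → DegreeOne A) (p' q' : ℕ) :
    pZero A 4 F p' q' = -quiltActionTotal A forkQuilt F p' q' := by
  rw [pZero, Finset.sum_eq_single MaximalQuilt.fork, Odd.neg_one_pow (by decide), neg_one_smul]
  · rfl
  · intro Q _ hQ
    rw [quiltActionTotal_eq_sum F p' q' ∅, Finset.sum_empty]
    exact fun i _ c d _ => absurd (Q.eq_fork c d fun a => by have := (i a).2; omega) hQ
  · exact fun h => absurd (Finset.mem_univ _) h

theorem pZero_eq_zero {n : ℕ} (hn : 5 ≤ n) (F : Fin n → DegreeOne A) (p' q' : ℕ) :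
    pZero A n F p' q' = 0 := by
  obtain ⟨m, rfl⟩ : ∃ m, n = m + 2 := ⟨n - 2, by omega⟩
  rw [pZero, Finset.sum_eq_zero, smul_zero]
  intro Q _
  rw [quiltActionTotal_eq_sum F p' q' ∅, Finset.sum_empty]
  intro i _ c d _
  have := Q.le_two_of_coloring c d fun a => by have := (i a).2; omega
  omega

/-- The Maurer–Cartan series is a finite sum of five terms. -/
theorem sum_pTerm (F : DegreeOne A) {N : ℕ} (hN : 4 ≤ N) (p' q' : ℕ) :
    ∑ n ∈ Finset.Icc 2 N, pTerm A n F p' q' =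
      quiltActionTotal A (twoQuilt 0) (fun _ => F) p' q' +
      quiltActionTotal A cherryQuilt (Fin.cons (mulDegreeOne A) fun _ => F) p' q' +
      quiltActionTotal A cherryQuilt (fun _ => F) p' q' -
      quiltActionTotal A forkQuilt (Fin.cons (mulDegreeOne A) fun _ => F) p' q' -
      quiltActionTotal A forkQuilt (fun _ => F) p' q' := by
  have h : ∑ n ∈ Finset.Icc 2 N, pTerm A n F p' q' = ∑ n ∈ Finset.Icc 2 4, pTerm A n F p' q' := by
    refine (Finset.sum_subset (Finset.Icc_subset_Icc_right hN) fun n hn hn' => ?_).symm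
    rw [Finset.mem_Icc] at hn hn'
    rw [pTerm, pZero_eq_zero (by omega), pZero_eq_zero (by omega), add_zero]
  rw [h, (by decide : Finset.Icc 2 4 = {2, 3, 4}), Finset.sum_insert (by decide),
    Finset.sum_pair (by decide), pTerm, pTerm, pTerm, pZero_two, pZero_three, pZero_three,
    pZero_four, pZero_four, pZero_eq_zero (by omega)]
  abel

end Totals

section Coboundary

variable {k : Type*} [CommRing k] {C : Type u} [Category.{v} C] {A : AlgDiagram.{w} k C}

/-! ### The simplicial coboundary -/

instance : DecidableRel trivialTree.edge := fun _ _ => inferInstanceAs (Decidable False)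

instance : DecidableRel trivialTree.left := fun _ _ => inferInstanceAs (Decidable False)

instance : DecidableRel trivialTree.le := fun a b =>
  isTrue (Subsingleton.elim a b ▸ Relation.ReflTransGen.refl)

theorem trivialTree_root (a : Fin 1) : ¬ trivialTree.lt a 0 :=
  Subsingleton.elim 0 a ▸ trivialTree.acyclic 0

/-- The face `δ_i` of a cochain, composed with the maps of the diagram where needed. -/
theorem act_face {p q : ℕ} (f : Cochain A p q) (i : Fin (p + 2)) (Φ : Simplex C (p + 1))
    (x : Fin q → A.obj (Φ.vertex (Fin.last (p + 1)))) :
    act A (n := 1) (p := fun _ => p) (p' := p + 1) (fun _ => Fin.succAboveOrderEmb i)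
        (trivialColoring fun _ => q) (fun _ => f) q Φ x =
      A.along Φ 0 (i.succAbove 0) (f (Φ.pull (Fin.succAboveOrderEmb i)) fun j =>
        A.along Φ (i.succAbove (Fin.last p)) (Fin.last (p + 1)) (x j)) := by
  refine (act_eq _ _ _ Φ x trivialTree_root).trans (congrArg (A.along Φ 0 (i.succAbove 0))
    ((evalVertex_eq ..).trans (congrArg (f _) (funext fun j => ?_))))
  refine evalInput_extend (m := j) (hm' := j.2) (h := fun ⟨_, e, _⟩ => e) (hm := ?_) ..
  rw [← Fin.card_Iio j]
  refine Finset.card_nbij' (fun t => t.2) (fun l => ⟨0, l⟩) ?_ ?_ ?_ ?_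
  · intro t ht
    rcases (Finset.mem_filter.1 ht).2.2 with h | h | ⟨_, h, _⟩ | ⟨_, h, _⟩
    · exact Finset.mem_coe.2 (Finset.mem_Iio.2 (Fin.lt_def.2 h.2))
    all_goals exact h.elim
  · intro l hl
    exact Finset.mem_coe.2 (Finset.mem_filter.2 ⟨Finset.mem_univ _, fun ⟨_, e, _⟩ => e,
      Or.inl ⟨rfl, Fin.lt_def.1 (Finset.mem_Iio.1 (Finset.mem_coe.1 hl))⟩⟩)
  · rintro ⟨a, l⟩ _
    obtain rfl := Subsingleton.elim 0 a
    rfl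
  · exact fun _ _ => rfl

theorem simplicialCoboundary_f (F : DegreeOne A) (Φ : Simplex C 1)
    (x : Fin 2 → A.obj (Φ.vertex (Fin.last 1))) :
    simplicialCoboundary A F.f Φ x =
      A.map (Φ.hom 0 1) (F.mulVal (Φ.vertex 1) (x 0) (x 1)) -
        F.mulVal (Φ.vertex 0) (A.map (Φ.hom 0 1) (x 0)) (A.map (Φ.hom 0 1) (x 1)) := by
  have h₀ := (act_face F.f 0 Φ x).trans ((A.along_of_le Φ (i := 0) (l := 1) (by decide) _).trans
    (congrArg _ ((F.f_apply _ _).trans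
      (congrArg₂ (F.mulVal _) (A.along_self Φ 1 (x 0)) (A.along_self Φ 1 (x 1))))))
  have h₁ := (act_face F.f 1 Φ x).trans ((A.along_self Φ 0 _).trans ((F.f_apply _ _).trans
    (congrArg₂ (F.mulVal _) (A.along_of_le Φ (i := 0) (l := 1) (by decide) (x 0))
      (A.along_of_le Φ (i := 0) (l := 1) (by decide) (x 1)))))
  rw [simplicialCoboundary, Fin.sum_univ_two, sub_eq_add_neg]
  refine congrArg₂ (fun a b : A.obj (Φ.vertex 0) => a + b) ?_ ?_
  · exact (one_smul ℤ _).trans h₀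
  · exact (congrArg (fun e : ℤ => e • _) (by rfl : (-1 : ℤ) ^ 1 = -1)).trans
      ((neg_one_smul ℤ _).trans (congrArg Neg.neg h₁))

theorem simplicialCoboundary_g (F : DegreeOne A) (Φ : Simplex C 2)
    (x : Fin 1 → A.obj (Φ.vertex (Fin.last 2))) :
    simplicialCoboundary A F.g Φ x =
      A.map (Φ.hom 0 1) (F.mapVal (Φ.hom 1 2) (x 0)) - F.mapVal (Φ.hom 0 2) (x 0) +
        F.mapVal (Φ.hom 0 1) (A.map (Φ.hom 1 2) (x 0)) := by
  have h₀ := (act_face F.g 0 Φ x).trans ((A.along_of_le Φ (i := 0) (l := 1) (by decide) _).trans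
    (congrArg _ ((F.g_apply _ _).trans (congrArg _ (A.along_self Φ 2 (x 0))))))
  have h₁ := (act_face F.g 1 Φ x).trans ((A.along_self Φ 0 _).trans
    ((F.g_apply _ _).trans (congrArg _ (A.along_self Φ 2 (x 0)))))
  have h₂ := (act_face F.g 2 Φ x).trans ((A.along_self Φ 0 _).trans ((F.g_apply _ _).trans
    (congrArg _ (A.along_of_le Φ (i := 1) (l := 2) (by decide) (x 0)))))
  rw [simplicialCoboundary, Fin.sum_univ_three, sub_eq_add_neg]
  refine congrArg₂ (fun a b : A.obj (Φ.vertex 0) => a + b)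
    (congrArg₂ (fun a b : A.obj (Φ.vertex 0) => a + b) ?_ ?_) ?_
  · exact (one_smul ℤ _).trans h₀
  · exact (congrArg (fun e : ℤ => e • _) (by rfl : (-1 : ℤ) ^ 1 = -1)).trans
      ((neg_one_smul ℤ _).trans (congrArg Neg.neg h₁))
  · exact (congrArg (fun e : ℤ => e • _) (by rfl : (-1 : ℤ) ^ 2 = 1)).trans
      ((one_smul ℤ _).trans h₂)

theorem simplicialCoboundary_h (F : DegreeOne A) (Φ : Simplex C 3)
    (x : Fin 0 → A.obj (Φ.vertex (Fin.last 3))) :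
    simplicialCoboundary A F.h Φ x =
      A.map (Φ.hom 0 1) (F.twistVal (Φ.hom 2 3) (Φ.hom 1 2)) -
        F.twistVal (Φ.hom 2 3) (Φ.hom 0 2) + F.twistVal (Φ.hom 1 3) (Φ.hom 0 1) -
          F.twistVal (Φ.hom 1 2) (Φ.hom 0 1) := by
  have h₀ := (act_face F.h 0 Φ x).trans ((A.along_of_le Φ (i := 0) (l := 1) (by decide) _).trans
    (congrArg _ (F.h_apply _ _)))
  have h₁ := (act_face F.h 1 Φ x).trans ((A.along_self Φ 0 _).trans (F.h_apply _ _))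
  have h₂ := (act_face F.h 2 Φ x).trans ((A.along_self Φ 0 _).trans (F.h_apply _ _))
  have h₃ := (act_face F.h 3 Φ x).trans ((A.along_self Φ 0 _).trans (F.h_apply _ _))
  rw [simplicialCoboundary, Fin.sum_univ_four, sub_eq_add_neg, sub_eq_add_neg]
  refine congrArg₂ (fun a b : A.obj (Φ.vertex 0) => a + b)
    (congrArg₂ (fun a b : A.obj (Φ.vertex 0) => a + b)
      (congrArg₂ (fun a b : A.obj (Φ.vertex 0) => a + b) ?_ ?_) ?_) ?_
  · exact (one_smul ℤ _).trans h₀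
  · exact (congrArg (fun e : ℤ => e • _) (by rfl : (-1 : ℤ) ^ 1 = -1)).trans
      ((neg_one_smul ℤ _).trans (congrArg Neg.neg h₁))
  · exact (congrArg (fun e : ℤ => e • _) (by rfl : (-1 : ℤ) ^ 2 = 1)).trans
      ((one_smul ℤ _).trans h₂)
  · exact (congrArg (fun e : ℤ => e • _) (by rfl : (-1 : ℤ) ^ 3 = -1)).trans
      ((neg_one_smul ℤ _).trans (congrArg Neg.neg h₃))

end Coboundary

section Equation

variable {k : Type*} [CommRing k] {C : Type u} [Category.{v} C] {A : AlgDiagram.{w} k C}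

/-! ### The components of the Maurer–Cartan equation -/

theorem mulDegreeOne_mulVal (x : C) (a b : A.obj x) : (mulDegreeOne A).mulVal x a b = a * b := rfl

theorem mulDegreeOne_mapVal {x y : C} (φ : x ⟶ y) (a : A.obj x) :
    (mulDegreeOne A).mapVal φ a = 0 := rfl

theorem deformedMul_apply (F : DegreeOne A) (x : C) (a b : A.obj x) :
    deformedMul A F x a b = a * b + F.mulVal x a b := rfl

theorem deformedMap_apply (F : DegreeOne A) {x y : C} (φ : x ⟶ y) (a : A.obj x) :
    deformedMap A F φ a = A.map φ a + F.mapVal φ a := rfl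

theorem deformedTwist_eq (F : DegreeOne A) {x y z : C} (φ : x ⟶ y) (ψ : y ⟶ z) :
    deformedTwist A F φ ψ = (1, F.twistVal φ ψ) := rfl

namespace DegreeOne

variable (F : DegreeOne A)

/-- The additivity of `F.mulVal` is inherited from that of `deformedMul A F` and of the product. -/
theorem mulVal_add_left (x : C) (a a' b : A.obj x) :
    F.mulVal x (a + a') b = F.mulVal x a b + F.mulVal x a' b := by
  have h := (deformedMul A F x).map_add₂ a a' b
  simp only [deformedMul_apply, add_mul] at h
  have h' : (a * b + a' * b) + F.mulVal x (a + a') b =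
      (a * b + a' * b) + (F.mulVal x a b + F.mulVal x a' b) := by
    rw [h]
    abel
  exact add_left_cancel h'

theorem mulVal_add_right (x : C) (a b b' : A.obj x) :
    F.mulVal x a (b + b') = F.mulVal x a b + F.mulVal x a b' := by
  have h := (deformedMul A F x a).map_add b b'
  simp only [deformedMul_apply, mul_add] at h
  have h' : (a * b + a * b') + F.mulVal x a (b + b') =
      (a * b + a * b') + (F.mulVal x a b + F.mulVal x a b') := by
    rw [h]
    abel
  exact add_left_cancel h'

theorem mapVal_add {x y : C} (φ : x ⟶ y) (a b : A.obj x) :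
    F.mapVal φ (a + b) = F.mapVal φ a + F.mapVal φ b := by
  have h := (deformedMap A F φ).map_add a b
  rw [deformedMap_apply, deformedMap_apply, deformedMap_apply, map_add] at h
  have h' : (A.map φ a + A.map φ b) + F.mapVal φ (a + b) =
      (A.map φ a + A.map φ b) + (F.mapVal φ a + F.mapVal φ b) := by
    rw [h]
    abel
  exact add_left_cancel h'

end DegreeOne

theorem Simplex.hom_comp {p : ℕ} (Φ : Simplex C p) (i j l : Fin (p + 1)) (hij : i ≤ j)
    (hjl : j ≤ l) : Φ.hom i l (hij.trans hjl) = Φ.hom j l hjl ≫ Φ.hom i j hij := by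
  rw [← unop_comp, ← Φ.map_comp]
  rfl

theorem cons_apply_of_ne {α : Type*} {n : ℕ} (a b : α) {i : Fin (n + 1)} (hi : i ≠ 0) :
    (Fin.cons a (fun _ => b) : Fin (n + 1) → α) i = b := by
  obtain ⟨j, rfl⟩ := Fin.exists_succ_eq.2 hi
  rfl

variable (F : DegreeOne A) {N : ℕ}

/-- The component of bidegree `(0, 3)` is the associativity of the deformed product. -/
theorem maurerCartanSum_03 (hN : 4 ≤ N) (Φ : Simplex C 0)
    (x : Fin 3 → A.obj (Φ.vertex (Fin.last 0))) :
    maurerCartanSum A F N 0 3 Φ x =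
      deformedMul A F (Φ.vertex 0) (x 0) (deformedMul A F (Φ.vertex 0) (x 1) (x 2)) -
      deformedMul A F (Φ.vertex 0) (deformedMul A F (Φ.vertex 0) (x 0) (x 1)) (x 2) := by
  rw [maurerCartanSum, hochschildCoboundary, sum_pTerm F hN, twoQuilt_zero_total_03,
    twoQuilt_zero_total_03, twoQuilt_one_total_03, cherryQuilt_total_03, cherryQuilt_total_03,
    forkQuilt_total_03, forkQuilt_total_03]
  simp only [simplicialCoboundaryTotal, Pi.add_apply, Pi.sub_apply, Pi.zero_apply, twoQuilt_zero_ff,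
    twoQuilt_one_ff]
  simp only [Matrix.cons_val_zero, Matrix.cons_val_one, mulDegreeOne_mulVal, deformedMul_apply,
    mul_add, add_mul, DegreeOne.mulVal_add_left, DegreeOne.mulVal_add_right, mul_assoc]
  abel

/-- The component of bidegree `(1, 2)` is the compatibility of the deformed maps with the deformed
products. -/
theorem maurerCartanSum_12 (hN : 4 ≤ N) (Φ : Simplex C 1)
    (x : Fin 2 → A.obj (Φ.vertex (Fin.last 1))) :
    maurerCartanSum A F N 1 2 Φ x =
      deformedMap A F (Φ.hom 0 1) (deformedMul A F (Φ.vertex 1) (x 0) (x 1)) -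
        deformedMul A F (Φ.vertex 0) (deformedMap A F (Φ.hom 0 1) (x 0))
          (deformedMap A F (Φ.hom 0 1) (x 1)) := by
  rw [maurerCartanSum, hochschildCoboundary, sum_pTerm F hN, twoQuilt_zero_total_12,
    twoQuilt_zero_total_12, twoQuilt_one_total_12, cherryQuilt_total_12, cherryQuilt_total_12,
    forkQuilt_total_12, forkQuilt_total_12]
  simp only [simplicialCoboundaryTotal, Pi.add_apply, Pi.sub_apply, Pi.zero_apply,
    twoQuilt_zero_fg, twoQuilt_zero_gf, twoQuilt_one_fg, cherryQuilt_fgg, simplicialCoboundary_f]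
  simp (disch := decide) only [cons_apply_of_ne, Fin.cons_zero]
  simp only [Matrix.cons_val_zero, Matrix.cons_val_one, mulDegreeOne_mulVal, mulDegreeOne_mapVal,
    deformedMul_apply, deformedMap_apply]
  simp only [mul_add, add_mul, DegreeOne.mulVal_add_left, DegreeOne.mulVal_add_right,
    DegreeOne.mapVal_add, map_add, map_mul]
  abel

/-- The component of bidegree `(2, 1)` is the functoriality of the deformed maps up to the twists,
in which the unit components of the twists have been multiplied out. -/
theorem maurerCartanSum_21 (hN : 4 ≤ N) (Φ : Simplex C 2)
    (x : Fin 1 → A.obj (Φ.vertex (Fin.last 2))) :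
    maurerCartanSum A F N 2 1 Φ x =
      deformedMap A F (Φ.hom 0 1) (deformedMap A F (Φ.hom 1 2) (x 0)) +
        deformedMul A F (Φ.vertex 0)
          (deformedMap A F (Φ.hom 0 1) (deformedMap A F (Φ.hom 1 2) (x 0)))
          (F.twistVal (Φ.hom 1 2) (Φ.hom 0 1)) -
      (deformedMap A F (Φ.hom 0 2) (x 0) +
        deformedMul A F (Φ.vertex 0) (F.twistVal (Φ.hom 1 2) (Φ.hom 0 1))
          (deformedMap A F (Φ.hom 0 2) (x 0))) := by
  have hmap : A.map (Φ.hom 0 2) (x 0) = A.map (Φ.hom 0 1) (A.map (Φ.hom 1 2) (x 0)) := by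
    rw [Φ.hom_comp 0 1 2 (by decide) (by decide), A.map_comp]
  rw [maurerCartanSum, hochschildCoboundary, sum_pTerm F hN, twoQuilt_zero_total_21,
    twoQuilt_zero_total_21, twoQuilt_one_total_21, cherryQuilt_total_21, cherryQuilt_total_21,
    forkQuilt_total_21, forkQuilt_total_21]
  simp only [simplicialCoboundaryTotal, Pi.add_apply, Pi.sub_apply, Pi.zero_apply,
    twoQuilt_zero_fh, twoQuilt_zero_gg, cherryQuilt_fgh, cherryQuilt_fhg, forkQuilt_fhgg,
    simplicialCoboundary_g]
  simp (disch := decide) only [cons_apply_of_ne, Fin.cons_zero]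
  simp only [Matrix.cons_val_zero, Matrix.cons_val_one, mulDegreeOne_mulVal, mulDegreeOne_mapVal,
    deformedMul_apply, deformedMap_apply]
  simp only [mul_add, add_mul, DegreeOne.mulVal_add_left, DegreeOne.mulVal_add_right,
    DegreeOne.mapVal_add, map_add, hmap]
  abel

/-- The component of bidegree `(3, 0)` is the cocycle condition for the twists, in which their unit
components have been multiplied out. -/
theorem maurerCartanSum_30 (hN : 4 ≤ N) (Φ : Simplex C 3)
    (x : Fin 0 → A.obj (Φ.vertex (Fin.last 3))) :
    maurerCartanSum A F N 3 0 Φ x =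
      F.twistVal (Φ.hom 1 3) (Φ.hom 0 1) +
        deformedMap A F (Φ.hom 0 1) (F.twistVal (Φ.hom 2 3) (Φ.hom 1 2)) +
        deformedMul A F (Φ.vertex 0)
          (deformedMap A F (Φ.hom 0 1) (F.twistVal (Φ.hom 2 3) (Φ.hom 1 2)))
          (F.twistVal (Φ.hom 1 3) (Φ.hom 0 1)) -
      (F.twistVal (Φ.hom 2 3) (Φ.hom 0 2) + F.twistVal (Φ.hom 1 2) (Φ.hom 0 1) +
        deformedMul A F (Φ.vertex 0) (F.twistVal (Φ.hom 1 2) (Φ.hom 0 1))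
          (F.twistVal (Φ.hom 2 3) (Φ.hom 0 2))) := by
  rw [maurerCartanSum, hochschildCoboundary, sum_pTerm F hN, twoQuilt_zero_total_30,
    twoQuilt_zero_total_30, twoQuilt_one_total_30, cherryQuilt_total_30, cherryQuilt_total_30,
    forkQuilt_total_30, forkQuilt_total_30]
  simp only [simplicialCoboundaryTotal, Pi.add_apply, Pi.sub_apply, Pi.zero_apply,
    twoQuilt_zero_gh, cherryQuilt_fhh, forkQuilt_fhgh, simplicialCoboundary_h]
  simp (disch := decide) only [cons_apply_of_ne, Fin.cons_zero]
  simp only [Matrix.cons_val_zero, Matrix.cons_val_one, mulDegreeOne_mulVal, mulDegreeOne_mapVal,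
    deformedMul_apply, deformedMap_apply]
  simp only [add_mul, DegreeOne.mulVal_add_left]
  abel

end Equation

/-! ### Skew diagrams -/

section Unitization

variable {k M : Type*} [CommRing k] [AddCommGroup M] [Module k M] {μ : M →ₗ[k] M →ₗ[k] M}

theorem unitizationMul_assoc (h : ∀ a b c, μ (μ a b) c = μ a (μ b c)) (r s t : k × M) :
    unitizationMul μ (unitizationMul μ r s) t = unitizationMul μ r (unitizationMul μ s t) := by
  refine Prod.ext (mul_assoc _ _ _) ?_
  simp only [unitizationMul, map_add, map_smul, LinearMap.add_apply, LinearMap.smul_apply,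
    smul_add, smul_smul, h, mul_comm t.1]
  abel

theorem unitizationMul_one (r : k × M) : unitizationMul μ r (1, 0) = r := by
  refine Prod.ext (mul_one _) ?_
  simp [unitizationMul]

end Unitization

/-- A bilinear product as a multilinear map in two arguments. -/
def multilinearOfBilinear {k M : Type*} [CommRing k] [AddCommGroup M] [Module k M]
    (μ : M →ₗ[k] M →ₗ[k] M) : MultilinearMap k (fun _ : Fin 2 => M) M :=
  MultilinearMap.mk' (fun v => μ (v 0) (v 1))
    (by
      intro m i x y
      fin_cases i <;> simp [Function.update])
    (by
      intro m i c x
      fin_cases i <;> simp [Function.update])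

section Main

variable {k : Type*} [CommRing k] {C : Type u} [Category.{v} C] {A : AlgDiagram.{w} k C}
  (F : DegreeOne A)

/-- The functoriality axiom for `deform A F`, with the products in the unitalization multiplied out.
Both sides have unit component `0`. -/
theorem deform_functorial_iff {x y z : C} (φ : x ⟶ y) (ψ : y ⟶ z) (a : A.obj x) :
    unitizationMul ((deform A F).mul z) (0, (deform A F).map ψ ((deform A F).map φ a))
        ((deform A F).twist φ ψ) =
      unitizationMul ((deform A F).mul z) ((deform A F).twist φ ψ)
        (0, (deform A F).map (φ ≫ ψ) a) ↔
    deformedMap A F ψ (deformedMap A F φ a) +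
        deformedMul A F z (deformedMap A F ψ (deformedMap A F φ a)) (F.twistVal φ ψ) =
      deformedMap A F (φ ≫ ψ) a +
        deformedMul A F z (F.twistVal φ ψ) (deformedMap A F (φ ≫ ψ) a) := by
  simp only [deform, deformedTwist_eq, unitizationMul, Prod.mk.injEq, zero_smul, one_smul,
    zero_add, add_zero, mul_one, mul_zero, true_and]

/-- The cocycle axiom for `deform A F`, with the products in the unitalization multiplied out. Both
sides have unit component `1`. -/
theorem deform_cocycle_iff {t x y z : C} (φ : t ⟶ x) (ψ : x ⟶ y) (χ : y ⟶ z) :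
    unitizationMul ((deform A F).mul z)
        (((deform A F).twist φ ψ).1, (deform A F).map χ ((deform A F).twist φ ψ).2)
        ((deform A F).twist (φ ≫ ψ) χ) =
      unitizationMul ((deform A F).mul z) ((deform A F).twist ψ χ)
        ((deform A F).twist φ (ψ ≫ χ)) ↔
    F.twistVal (φ ≫ ψ) χ + deformedMap A F χ (F.twistVal φ ψ) +
        deformedMul A F z (deformedMap A F χ (F.twistVal φ ψ)) (F.twistVal (φ ≫ ψ) χ) =
      F.twistVal φ (ψ ≫ χ) + F.twistVal ψ χ +
        deformedMul A F z (F.twistVal ψ χ) (F.twistVal φ (ψ ≫ χ)) := by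
  simp only [deform, deformedTwist_eq, unitizationMul, Prod.mk.injEq, one_smul, mul_one, true_and]

/-- The partial sums are eventually zero, and from the fourth one on they are all equal. -/
theorem IsMaurerCartan.exists_sum_eq_zero {F : DegreeOne A} (h : IsMaurerCartan A F) {p q : ℕ}
    (hpq : p + q = 3) : ∃ N, 4 ≤ N ∧ maurerCartanSum A F N p q = 0 := by
  obtain ⟨N, hN, h'⟩ := ((Filter.eventually_ge_atTop 4).and (h p q hpq)).exists
  exact ⟨N, hN, h'⟩

/-- In one direction the axioms for given morphisms follow from the values of the series at the
simplex formed by them; in the other, the value at a simplex is an axiom for the morphisms in it. -/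
theorem isMaurerCartan_iff : IsMaurerCartan A F ↔ (deform A F).IsSkewDiagram := by
  constructor
  · intro h
    refine ⟨fun x a b c => ?_, fun {x y} φ a b => ?_, fun {x y z} φ ψ a => ?_,
      fun {t x y z} φ ψ χ => ?_⟩
    · obtain ⟨N, hN, h'⟩ := h.exists_sum_eq_zero (p := 0) (q := 3) rfl
      have e := maurerCartanSum_03 F hN (ComposableArrows.mk₀ (Opposite.op x)) ![a, b, c]
      rw [h'] at e
      exact (sub_eq_zero.1 e.symm).symm
    · obtain ⟨N, hN, h'⟩ := h.exists_sum_eq_zero (p := 1) (q := 2) rfl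
      have e := maurerCartanSum_12 F hN (ComposableArrows.mk₁ φ.op) ![a, b]
      rw [h'] at e
      exact sub_eq_zero.1 e.symm
    · obtain ⟨N, hN, h'⟩ := h.exists_sum_eq_zero (p := 2) (q := 1) rfl
      have e := maurerCartanSum_21 F hN (ComposableArrows.mk₂ ψ.op φ.op) ![a]
      rw [h'] at e
      exact (deform_functorial_iff F φ ψ a).2 (sub_eq_zero.1 e.symm)
    · obtain ⟨N, hN, h'⟩ := h.exists_sum_eq_zero (p := 3) (q := 0) rfl
      have e := maurerCartanSum_30 F hN (ComposableArrows.mk₃ χ.op ψ.op φ.op) ![]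
      rw [h'] at e
      exact (deform_cocycle_iff F φ ψ χ).2 (sub_eq_zero.1 e.symm)
  · intro h p q hpq
    filter_upwards [Filter.eventually_ge_atTop 4] with N hN
    funext Φ x
    obtain ⟨rfl, rfl⟩ | ⟨rfl, rfl⟩ | ⟨rfl, rfl⟩ | ⟨rfl, rfl⟩ :
        (p = 0 ∧ q = 3) ∨ (p = 1 ∧ q = 2) ∨ (p = 2 ∧ q = 1) ∨ (p = 3 ∧ q = 0) := by omega
    · rw [maurerCartanSum_03 F hN]
      exact sub_eq_zero.2 (h.assoc _ _ _ _).symm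
    · rw [maurerCartanSum_12 F hN]
      exact sub_eq_zero.2 (h.map_mul _ _ _)
    · rw [maurerCartanSum_21 F hN, Φ.hom_comp 0 1 2 (by decide) (by decide)]
      exact sub_eq_zero.2 ((deform_functorial_iff F _ _ _).1 (h.functorial _ _ _))
    · rw [maurerCartanSum_30 F hN, Φ.hom_comp 0 1 2 (by decide) (by decide),
        Φ.hom_comp 1 2 3 (by decide) (by decide)]
      exact sub_eq_zero.2 ((deform_cocycle_iff F _ _ _).1 (h.cocycle _ _ _))

theorem deform_injective : Function.Injective (deform A) := by
  intro F G h
  obtain ⟨f, g, t⟩ := F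
  obtain ⟨f', g', t'⟩ := G
  have hmul := congrArg SkewData.mul h
  have hmap : @deformedMap _ _ _ _ A ⟨f, g, t⟩ = @deformedMap _ _ _ _ A ⟨f', g', t'⟩ :=
    congrArg (fun D => @SkewData.map _ _ _ _ _ _ _ D) h
  have htwist : @deformedTwist _ _ _ _ A ⟨f, g, t⟩ = @deformedTwist _ _ _ _ A ⟨f', g', t'⟩ :=
    congrArg (fun D => @SkewData.twist _ _ _ _ _ _ _ D) h
  obtain rfl : f = f' := by
    funext Φ
    ext v
    have e := congrArg (fun m => m (Φ.vertex 0) (v 0) (v 1)) hmul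
    have e' := add_left_cancel
      ((deformedMul_apply ⟨f, g, t⟩ _ _ _).symm.trans
        (e.trans (deformedMul_apply ⟨f', g', t'⟩ _ _ _)))
    exact (DegreeOne.f_apply ⟨f, g, t⟩ Φ v).trans
      (e'.trans (DegreeOne.f_apply ⟨f', g', t'⟩ Φ v).symm)
  obtain rfl : g = g' := by
    funext Φ
    ext v
    have e := congrArg (fun m => m (Φ.hom 0 1) (v 0)) hmap
    have e' := add_left_cancel
      ((deformedMap_apply ⟨f, g, t⟩ _ _).symm.trans (e.trans (deformedMap_apply ⟨f, g', t'⟩ _ _)))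
    exact (DegreeOne.g_apply ⟨f, g, t⟩ Φ v).trans
      (e'.trans (DegreeOne.g_apply ⟨f, g', t'⟩ Φ v).symm)
  obtain rfl : t = t' := by
    funext Φ
    ext v
    have e := congrArg (fun m => (m (Φ.hom 1 2) (Φ.hom 0 1)).2) htwist
    exact (DegreeOne.h_apply ⟨f, g, t⟩ Φ v).trans (e.trans (DegreeOne.h_apply ⟨f, g, t'⟩ Φ v).symm)
  rfl

/-- The cochain of shifted total degree one given by the differences of the products and maps of
`D` and of `A`, and by the components of the twists of `D` in the modules of `A`. -/
noncomputable def ofSkewData (D : SkewData k A.obj) : DegreeOne A where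
  f Φ := multilinearOfBilinear
    (D.mul (Φ.vertex 0) - LinearMap.mul k (A.obj (Φ.vertex 0)))
  g Φ := MultilinearMap.ofSubsingleton k (A.obj (Φ.vertex 1)) (A.obj (Φ.vertex 0)) (0 : Fin 1)
    (D.map (Φ.hom 0 1) - (A.map (Φ.hom 0 1) : A.obj (Φ.vertex 1) →ₗ[k] A.obj (Φ.vertex 0)))
  h Φ := MultilinearMap.constOfIsEmpty k _ (D.twist (Φ.hom 1 2) (Φ.hom 0 1)).2

theorem deform_ofSkewData (D : SkewData k A.obj)
    (hD : ∀ (x y z : C) (φ : x ⟶ y) (ψ : y ⟶ z), (D.twist φ ψ).1 = 1) :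
    deform A (ofSkewData D) = D := by
  have hmul : deformedMul A (ofSkewData D) = D.mul := by
    funext x
    ext a b
    exact add_sub_cancel (a * b) (D.mul x a b)
  have hmap : @deformedMap _ _ _ _ A (ofSkewData D) = @SkewData.map _ _ _ _ _ _ _ D := by
    funext x y φ
    ext a
    exact add_sub_cancel (A.map φ a) (D.map φ a)
  have htwist : @deformedTwist _ _ _ _ A (ofSkewData D) = @SkewData.twist _ _ _ _ _ _ _ D := by
    funext x y z φ ψ
    exact Prod.ext (hD x y z φ ψ).symm rfl
  rw [deform, hmul, hmap, htwist]

end Main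

end HochschildQuilt

theorem mainTheorem7 {k : Type*} [CommRing k] {C : Type*} [CategoryTheory.Category C]
    (A : HochschildQuilt.AlgDiagram k C) :
    (∀ F : HochschildQuilt.DegreeOne A,
      HochschildQuilt.IsMaurerCartan A F ↔ (HochschildQuilt.deform A F).IsSkewDiagram) ∧
    Set.BijOn (HochschildQuilt.deform A)
      {F | HochschildQuilt.IsMaurerCartan A F}
      {D | D.IsSkewDiagram ∧
        ∀ (x y z : C) (φ : x ⟶ y) (ψ : y ⟶ z), (D.twist φ ψ).1 = 1} ∧
    ∀ F : HochschildQuilt.DegreeOne A, HochschildQuilt.IsMaurerCartan A F →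
      ∀ (x y z : C) (φ : x ⟶ y) (ψ : y ⟶ z) (c' : k × A.obj z),
        let D := HochschildQuilt.deform A F
        let mul := HochschildQuilt.unitizationMul (D.mul z)
        mul (D.twist φ ψ) c' = (1, 0) → mul c' (D.twist φ ψ) = (1, 0) →
        ∀ a : A.obj x,
          ((0, D.map ψ (D.map φ a)) : k × A.obj z) =
            mul (mul (D.twist φ ψ) (0, D.map (φ ≫ ψ) a)) c' := by
  refine ⟨HochschildQuilt.isMaurerCartan_iff, ⟨?_, ?_, ?_⟩, ?_⟩
  · exact fun F hF => ⟨(HochschildQuilt.isMaurerCartan_iff F).1 hF, fun _ _ _ _ _ => rfl⟩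
  · exact HochschildQuilt.deform_injective.injOn
  · intro D hD
    have e := HochschildQuilt.deform_ofSkewData D hD.2
    refine ⟨HochschildQuilt.ofSkewData D, (HochschildQuilt.isMaurerCartan_iff _).2 ?_, e⟩
    rw [e]
    exact hD.1
  · intro F hF x y z φ ψ c' D mul hc _ a
    have hD : D.IsSkewDiagram := (HochschildQuilt.isMaurerCartan_iff F).1 hF
    have e := congrArg (fun s => mul s c') (hD.functorial φ ψ a)
    refine Eq.trans ?_ e
    refine Eq.trans ?_ (HochschildQuilt.unitizationMul_assoc (hD.assoc z) _ _ _).symm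
    exact (HochschildQuilt.unitizationMul_one _).symm.trans (congrArg (mul _) hc.symm)
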